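/- **Conventions.** All structures are $\mathbb Z_2$-graded; $|z|$ is the degree of a homogeneous $z$, formulas containing $|z|$ are extended additively, submodules and subalgebras are graded, and $[f,g]=fg-(-1)^{|f||g|}gf$ for endomorphisms. Let $K$ be a unital supercommutative superring containing $\frac12$, let $A$ be a superextension of $K$ (a unital associative supercommutative $K$-superalgebra), and let $\mathcal M$ be an $A$-supermodule, with $am=(-1)^{|a||m|}ma$. For $F\in\{A,K\}$, $\operatorname{End}_F\mathcal M$ is the set of additive $f$ with $f(ma)=f(m)a$ for $a\in F$. An $A$-quadratic form is an $A$-bilinear map $q:\mathcal M\times\mathcal M\to A$ of degree $\bar 0$ (so $q(ma,n)=q(m,an)$ and $q(m,na)=q(m,n)a$) with $q(m,n)=(-1)^{|m||n|}q(n,m)$. $\operatorname{Der}_K$ denotes the Lie superalgebra of $K$-superderivations (sums of an even and an odd one). Put $\operatorname{osp}(q)=\{x\in\operatorname{End}_A\mathcal M: q(x(m),n)+(-1)^{|m||n|}q(x(n),m)=0\ \forall m,n\}$, $\mathbf E_{m,n}(p)=m\,q(n,p)-(-1)^{|n||p|}q(m,p)\,n$, $\operatorname{eosp}(q)=\operatorname{span}_{\mathbb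 Z}\{\mathbf E_{m,n}\}$, and let $\overline{\operatorname{eosp}(q)}$ be the set of all sums $\sum_i x_i$ of families in $\operatorname{eosp}(q)$ such that for each $m$ only finitely many $x_i(m)$ are nonzero. For a $K$-subalgebra $\mathcal E$ with $\operatorname{eosp}(q)\subset\mathcal E\subset\operatorname{osp}(q)$ let $\mathcal E_\infty=A\oplus\mathcal M\oplus\mathcal M\oplus\mathcal E$ with the bracket $$[(a,m,n,x),(a',m',n',x')]=\bigl(q(m,n')-q(n,m'),\ am'+xm'-ma'-(-1)^{|x'||m|}x'm,\ -an'+xn'+na'-(-1)^{|x'||n|}x'n,\ \mathbf E_{m,n'}+\mathbf E_{n,m'}+[x,x']\bigr).$$ Let $\operatorname{ad}\mathcal E_\infty$ be the set of inner derivations, $\operatorname{ad}\mathcal E$ those given by elements $(0,0,0,x)$, and $\operatorname{ad_{loc}}\mathcal E_\infty$ the set of locally inner derivations ($d\in\operatorname{Der}_K\mathcal E_\infty$ that agree on every finite subset with some $\operatorname{ad}y$). Let $\mathcal S$ be spanned by the homogeneous $S\in\operatorname{End}_K\mathcal M$ with $[S,A\,\mathrm{Id}]\subset A\,\mathrm{Id}$,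 $[S,q(m,n)\mathrm{Id}]=(q(S(m),n)+(-1)^{|m||n|}q(S(n),m))\mathrm{Id}$ and $[S,\mathcal E]\subset\mathcal E$; let $\mathcal T$ be spanned by the homogeneous $T\in\operatorname{End}_K\mathcal M$ with $[T,A\,\mathrm{Id}]\subset\mathcal E$, $[T,q(m,n)\mathrm{Id}]=\mathbf E_{T(m),n}+(-1)^{|m||n|}\mathbf E_{T(n),m}$ and $[T,\mathcal E]\subset A\,\mathrm{Id}$. For $S\in\mathcal S$, $T\in\mathcal T$ put, identifying $A$ with $A\,\mathrm{Id}$, $$d_{S,T}(a,m,n,x)=([S,a\,\mathrm{Id}]+[T,x],\ (S+T)(m),\ (S-T)(n),\ [T,a\,\mathrm{Id}]+[S,x]),$$ and let $\mathcal D$ be the set of all $d_{S,T}$. A form on a free $A$-supermodule is *almost diagonalizable* if there is a homogeneous basis $(n_i)_{i\in I}$ such that for each $i$ there is $\underline i\in I$ with $q(n_i,n_{\underline i})$ homogeneous and invertible in $A$ and $q(n_i,n_j)=0$ for $j\ne\underline i$; it is *invertibly diagonalizable* if moreover $\underline i=i$ for all $i$. $D=I\rtimes B$ means that the Lie superalgebra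 $D$ is the direct sum of an ideal $I$ and a subalgebra $B$. **Theorem.** Let $\mathcal N,\mathcal R$ be free $A$-supermodules with $\operatorname{rank}(\mathcal N\oplus\mathcal R)>2$ (the rank being the number of elements of the given homogeneous bases) and $A$-quadratic forms $q_{\mathcal N}$, $q_{\mathcal R}\equiv0$, where $q_{\mathcal N}$ is an orthogonal sum of an almost diagonalizable form and an invertibly diagonalizable form on a free $A$-supermodule of rank $2$. Let $\mathcal M=\mathcal N\oplus\mathcal R$, $q=q_{\mathcal N}\oplus q_{\mathcal R}$, and let $\mathcal E$ be a $K$-subalgebra of $\operatorname{osp}(q)$ containing $\operatorname{eosp}(q)$. Let $(n_i)_{i\in I}$ be the resulting homogeneous basis of $\mathcal N$ for which $q_{\mathcal N}$ is almost diagonal and $(r_j)_{j\in J}$ a homogeneous basis of $\mathcal R$. For $\Delta\in\operatorname{Der}_KA$ let $\Delta_{\mathcal M}\in\operatorname{End}_K\mathcal M$ be $$\Delta_{\mathcal M}\Bigl(\sum_i a_in_i+\sum_j b_jr_j\Bigr)=\sum_i\Bigl(\tfrac12\Delta(q(n_i,n_{\underline i}))\,q(n_i,n_{\underline i})^{-1}a_i+\Delta(a_i)\Bigr)n_i+\sum_j\Delta(b_j)r_j,$$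 and $(\operatorname{Der}_KA)_{\mathcal M}=\{\Delta_{\mathcal M}:\Delta\in\operatorname{Der}_KA\}$. Then: * $\Delta\mapsto\Delta_{\mathcal M}$ is an isomorphism of Lie superalgebras $\operatorname{Der}_KA\to(\operatorname{Der}_KA)_{\mathcal M}$. The sums $\operatorname{osp}(q)\oplus(\operatorname{Der}_KA)_{\mathcal M}$ and $\operatorname{End}_A\mathcal R\oplus(\operatorname{Der}_KA)_{\mathcal M}$ are direct, where $\operatorname{End}_A\mathcal R$ is extended by $0$ on $\mathcal N$. * On $\mathcal X=\{S\in\operatorname{osp}(q)\oplus(\operatorname{Der}_KA)_{\mathcal M}:[S,\mathcal E]\subset\mathcal E\}$ the map $S\mapsto d_{S,0}$ is a well-defined monomorphism of Lie superalgebras into $\mathcal D$, and $$\operatorname{Der}_K\mathcal E_\infty=\operatorname{ad}\mathcal E_\infty+\{d_{S,0}:S\in\mathcal X\}.$$ * $\operatorname{ad}\mathcal E_\infty\cap\{d_{S,0}:S\in\mathcal X\}=\operatorname{ad}\mathcal E_\infty\cap\{d_{S,0}:S\in\operatorname{osp}(q),[S,\mathcal E]\subset\mathcal E\}=\operatorname{ad}\mathcal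 E=\{d_{S,0}:S\in\mathcal E\}$. * Whenever $\mathcal S=\mathcal E\rtimes\mathcal S_0$, one has $\operatorname{Der}_K\mathcal E_\infty=\operatorname{ad}\mathcal E_\infty\rtimes\{d_{S,0}:S\in\mathcal S_0\}$. * (1) If $\mathcal E=\operatorname{eosp}(q)$, then $\operatorname{Der}_K\mathcal E_\infty=\operatorname{ad_{loc}}\mathcal E_\infty\rtimes\{d_{S,0}:S\in\operatorname{End}_A\mathcal R\oplus(\operatorname{Der}_KA)_{\mathcal M}\}$; if moreover $\mathcal M$ has finite rank, then $\operatorname{Der}_K\mathcal E_\infty=\operatorname{ad}\mathcal E_\infty\rtimes\{d_{S,0}:S\in\operatorname{End}_A\mathcal R\oplus(\operatorname{Der}_KA)_{\mathcal M}\}$. * (2) If $\mathcal E=\overline{\operatorname{eosp}(q)}$, then $\operatorname{Der}_K\mathcal E_\infty=\operatorname{ad}\mathcal E_\infty\rtimes\{d_{S,0}:S\in\operatorname{End}_A\mathcal R\oplus(\operatorname{Der}_KA)_{\mathcal M}\}$. * (3) If $\mathcal E=\operatorname{osp}(q)$, then $\operatorname{Der}_K\mathcal E_\infty=\operatorname{ad}\mathcal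 E_\infty\rtimes\{d_{S,0}:S\in(\operatorname{Der}_KA)_{\mathcal M}\}$. -/

import Mathlib

open scoped BigOperators Pointwise

namespace OspDer

universe u v w

/-! ### `ℤ/2`-graded abelian groups and their endomorphisms

A grading is recorded by its two homogeneous projections `π 0`, `π 1`.
Expressions containing parities are extended from homogeneous elements to all
elements by additivity, i.e. by summing over homogeneous components. -/

/-- The sign `(-1)^(ij)`. -/
def kos (i j : ZMod 2) : ℤ := (-1) ^ (i.val * j.val)

/-- The projection onto the homogeneous part of degree `i`. -/
def pr {L : Type*} [AddCommGroup L] (ℒ : ZMod 2 → AddSubgroup L)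
    [DirectSum.Decomposition ℒ] (i : ZMod 2) : AddMonoid.End L :=
  AddMonoidHom.mk' (fun x => (DirectSum.decompose ℒ x i : L)) (by
    intro x y; simp [DirectSum.decompose_add])

/-- A ring graded by `ℤ/2` is supercommutative. -/
def IsSupercommutative {A : Type*} [Ring A] (𝒜 : ZMod 2 → AddSubgroup A) : Prop :=
  ∀ i j a b, a ∈ 𝒜 i → b ∈ 𝒜 j → a * b = kos i j • (b * a)

section EndGrading

variable {L : Type*} [AddCommGroup L]

/-- The component of degree `α` of an additive endomorphism. -/
def endComp (π : ZMod 2 → AddMonoid.End L) (α : ZMod 2) (f : AddMonoid.End L) :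
    AddMonoid.End L :=
  ∑ j, π (α + j) * f * π j

/-- The endomorphism `f` is homogeneous of degree `α`. -/
def HasDegree (π : ZMod 2 → AddMonoid.End L) (α : ZMod 2) (f : AddMonoid.End L) : Prop :=
  ∀ j x, π j x = x → π (α + j) (f x) = f x

/-- The superbracket `[f, g] = f g - (-1)^(|f||g|) g f`, extended biadditively. -/
def sBr (π : ZMod 2 → AddMonoid.End L) (f g : AddMonoid.End L) : AddMonoid.End L :=
  ∑ i, ∑ j, (endComp π i f * endComp π j g - kos i j • (endComp π j g * endComp π i f))

variable {K : Type*}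

/-- `X` is a subalgebra of the Lie superalgebra of endomorphisms of `L`: a graded
`K`-submodule closed under the superbracket, where `l k` is the left action of `k : K` on `L`
and `k f = l k ∘ f`. -/
structure IsLieSubalgebra (π : ZMod 2 → AddMonoid.End L) (l : K → AddMonoid.End L)
    (X : Set (AddMonoid.End L)) : Prop where
  zero_mem : 0 ∈ X
  add_mem : ∀ f ∈ X, ∀ g ∈ X, f + g ∈ X
  neg_mem : ∀ f ∈ X, -f ∈ X
  comp_mem : ∀ α, ∀ f ∈ X, endComp π α f ∈ X
  smul_mem : ∀ k, ∀ f ∈ X, l k * f ∈ X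
  bracket_mem : ∀ f ∈ X, ∀ g ∈ X, sBr π f g ∈ X

/-- `D = I ⋊ B`: `D` is a Lie superalgebra of endomorphisms, the direct sum of its
ideal `I` and its subalgebra `B`. -/
structure IsSemidirect (π : ZMod 2 → AddMonoid.End L) (l : K → AddMonoid.End L)
    (D I B : Set (AddMonoid.End L)) : Prop where
  total : IsLieSubalgebra π l D
  ideal : IsLieSubalgebra π l I
  subalgebra : IsLieSubalgebra π l B
  bracket_mem : ∀ d ∈ D, ∀ x ∈ I, sBr π d x ∈ I
  eq_add : D = I + B
  inter : I ∩ B = {0}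

/-- `φ` restricts to a monomorphism of Lie superalgebras over `K` from the Lie superalgebra `X`
of endomorphisms of `L` to the endomorphisms of `L'` (hence to an isomorphism `X ≅ φ(X)`). -/
structure IsLieMono {L' : Type*} [AddCommGroup L']
    (π : ZMod 2 → AddMonoid.End L) (l : K → AddMonoid.End L)
    (π' : ZMod 2 → AddMonoid.End L') (l' : K → AddMonoid.End L')
    (X : Set (AddMonoid.End L)) (φ : AddMonoid.End L → AddMonoid.End L') : Prop where
  source : IsLieSubalgebra π l X
  injOn : Set.InjOn φ X
  map_add : ∀ f ∈ X, ∀ g ∈ X, φ (f + g) = φ f + φ g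
  map_smul : ∀ k, ∀ f ∈ X, φ (l k * f) = l' k * φ f
  map_comp : ∀ α, ∀ f ∈ X, φ (endComp π α f) = endComp π' α (φ f)
  map_bracket : ∀ f ∈ X, ∀ g ∈ X, φ (sBr π f g) = sBr π' (φ f) (φ g)

/-- The `K`-derivations of degree `α` of a superalgebra `L` with product `mul`;
`r k` is the right action of `k : K`, and `K`-linearity means `d (x k) = d (x) k`. -/
def derHom (π : ZMod 2 → AddMonoid.End L) (r : K → L → L) (mul : L → L → L) (α : ZMod 2) :
    Set (AddMonoid.End L) :=
  {d | HasDegree π α d ∧ (∀ k x, d (r k x) = r k (d x)) ∧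
    ∀ i x y, π i x = x → d (mul x y) = mul (d x) y + kos α i • mul x (d y)}

/-- All `K`-derivations: sums of an even and an odd one. -/
def der (π : ZMod 2 → AddMonoid.End L) (r : K → L → L) (mul : L → L → L) :
    Set (AddMonoid.End L) :=
  derHom π r mul 0 + derHom π r mul 1

end EndGrading

/-! ### Supermodules and quadratic forms

`A` is a supercommutative superring and `M` an `A`-supermodule. The bimodule structure is
determined by the left action. -/

section Supermodule

variable {A : Type u} {M : Type w} [Ring A] [AddCommGroup M] [Module A M]

/-- The endomorphism `a · id`. -/
def lmul (M : Type w) [AddCommGroup M] [Module A M] (a : A) : AddMonoid.End M :=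
  DistribSMul.toAddMonoidHom M a

variable (𝒜 : ZMod 2 → AddSubgroup A) [DirectSum.Decomposition 𝒜]
  (ℳ : ZMod 2 → AddSubgroup M) [DirectSum.Decomposition ℳ]

/-- The right action `m a = (-1)^(|a||m|) a m`. -/
def rsmul (m : M) (a : A) : M :=
  ∑ i, ∑ j, kos i j • (pr 𝒜 i a • pr ℳ j m)

/-- An `A`-quadratic form: a supersymmetric `A`-bilinear map `M × M → A` of degree `0`. -/
structure SuperForm where
  toFun : M →+ M →+ A
  rsmul_left : ∀ m n a, toFun (rsmul 𝒜 ℳ m a) n = toFun m (a • n)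
  rsmul_right : ∀ m n a, toFun m (rsmul 𝒜 ℳ n a) = toFun m n * a
  supersymm : ∀ i j m n, m ∈ ℳ i → n ∈ ℳ j → toFun m n = kos i j • toFun n m
  degree : ∀ i j m n, m ∈ ℳ i → n ∈ ℳ j → toFun m n ∈ 𝒜 (i + j)

/-- `End_A M`. -/
def endA : Set (AddMonoid.End M) :=
  {f | ∀ m (a : A), f (rsmul 𝒜 ℳ m a) = rsmul 𝒜 ℳ (f m) a}

/-- `End_K M`, for `A` a superextension of `K` by `ι : K → A`. -/
def endK {K : Type v} [Ring K] (ι : K →+* A) : Set (AddMonoid.End M) :=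
  {f | ∀ m (k : K), f (rsmul 𝒜 ℳ m (ι k)) = rsmul 𝒜 ℳ (f m) (ι k)}

/-- The `K`-derivations of `A`. -/
def derA {K : Type v} [Ring K] (ι : K →+* A) : Set (AddMonoid.End A) :=
  der (pr 𝒜) (fun k a => a * ι k) (fun a b => a * b)

variable {𝒜 ℳ}

/-- `E_{m,n}(p) = m q(n,p) - (-1)^(|n||p|) q(m,p) n`. -/
def elem (q : SuperForm 𝒜 ℳ) (m n : M) : AddMonoid.End M :=
  AddMonoidHom.mk'
    (fun p => rsmul 𝒜 ℳ m (q.toFun n p)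
      - ∑ i, ∑ j, kos i j • (q.toFun m (pr ℳ j p) • pr ℳ i n)) (by
    intro x y
    simp only [rsmul, map_add, add_smul, smul_add, Finset.sum_add_distrib]
    abel)

/-- The orthosymplectic Lie superalgebra. -/
def osp (q : SuperForm 𝒜 ℳ) : Set (AddMonoid.End M) :=
  {x | x ∈ endA 𝒜 ℳ ∧ ∀ i j m n, m ∈ ℳ i → n ∈ ℳ j →
    q.toFun (x m) n + kos i j • q.toFun (x n) m = 0}

/-- The elementary orthosymplectic Lie superalgebra: the `ℤ`-span of the `E_{m,n}`. -/
def eosp (q : SuperForm 𝒜 ℳ) : AddSubgroup (AddMonoid.End M) :=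
  AddSubgroup.closure {x | ∃ m n, x = elem q m n}

/-- The summable closure of `eosp q`: all pointwise finite sums of families in `eosp q`.
(At most `max |M| ℵ₀` members of such a family are nonzero, so index types in the universe of
`M` suffice.) -/
def eospBar (q : SuperForm 𝒜 ℳ) : Set (AddMonoid.End M) :=
  {x | ∃ (I : Type w) (f : I → AddMonoid.End M), (∀ i, f i ∈ eosp q) ∧
    ∀ m, {i | f i m ≠ 0}.Finite ∧ x m = ∑ᶠ i, f i m}

/-- A `K`-subalgebra `ℰ` of `osp q` containing `eosp q`. -/
structure OspSubalgebra {K : Type v} [Ring K] (ι : K →+* A) (q : SuperForm 𝒜 ℳ) where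
  carrier : AddSubgroup (AddMonoid.End M)
  le_osp : ∀ x ∈ carrier, x ∈ osp q
  eosp_le : eosp q ≤ carrier
  comp_mem : ∀ α, ∀ x ∈ carrier, endComp (pr ℳ) α x ∈ carrier
  smul_mem : ∀ k, ∀ x ∈ carrier, lmul M (ι k) * x ∈ carrier
  mul_smul_mem : ∀ k, ∀ x ∈ carrier, x * lmul M (ι k) ∈ carrier
  bracket_mem : ∀ x ∈ carrier, ∀ y ∈ carrier, sBr (pr ℳ) x y ∈ carrier

theorem elem_mem_eosp (q : SuperForm 𝒜 ℳ) (m n : M) : elem q m n ∈ eosp q :=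
  AddSubgroup.subset_closure ⟨m, n, rfl⟩

/-- `(-1)^(|x||m|) x(m)`. -/
def twApp (ℳ : ZMod 2 → AddSubgroup M) [DirectSum.Decomposition ℳ]
    (x : AddMonoid.End M) (m : M) : M :=
  ∑ i, ∑ j, kos i j • endComp (pr ℳ) i x (pr ℳ j m)

end Supermodule

/-! ### The Lie superalgebra `ℰ_∞` -/

section Infty

variable {A : Type u} {K : Type v} {M : Type w} [Ring A] [Ring K] [AddCommGroup M] [Module A M]
  {𝒜 : ZMod 2 → AddSubgroup A} [DirectSum.Decomposition 𝒜]
  {ℳ : ZMod 2 → AddSubgroup M} [DirectSum.Decomposition ℳ]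
  {ι : K →+* A} {q : SuperForm 𝒜 ℳ}

/-- `ℰ_∞ = {(a, m, n, x)}`. -/
abbrev Infty (E : OspSubalgebra ι q) : Type (max u w) := A × M × M × E.carrier

namespace Infty

variable (E : OspSubalgebra ι q)

/-- The homogeneous projections of `ℰ_∞`. -/
def proj (i : ZMod 2) : AddMonoid.End (Infty E) :=
  AddMonoidHom.mk' (fun y => (pr 𝒜 i y.1, pr ℳ i y.2.1, pr ℳ i y.2.2.1,
      ⟨endComp (pr ℳ) i y.2.2.2, E.comp_mem i _ y.2.2.2.2⟩)) (by
    intro y z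
    ext <;> simp [endComp, mul_add, add_mul, Finset.sum_add_distrib])

/-- The left action of `K` on `ℰ_∞`. -/
def lact (k : K) : AddMonoid.End (Infty E) :=
  AddMonoidHom.mk' (fun y => (ι k * y.1, ι k • y.2.1, ι k • y.2.2.1,
      ⟨lmul M (ι k) * y.2.2.2, E.smul_mem k _ y.2.2.2.2⟩)) (by
    intro y z
    ext <;> simp [mul_add])

/-- The right action of `K` on `ℰ_∞`; on endomorphisms it is `(x k)(m) = x(k m)`. -/
def ract (k : K) (y : Infty E) : Infty E :=
  (y.1 * ι k, rsmul 𝒜 ℳ y.2.1 (ι k), rsmul 𝒜 ℳ y.2.2.1 (ι k),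
    ⟨y.2.2.2 * lmul M (ι k), E.mul_smul_mem k _ y.2.2.2.2⟩)

/-- `[(a,m,n,x),(a',m',n',x')]`, the bracket of `ℰ_∞`, with components
`q(m,n') - q(n,m')`, `a m' + x m' - m a' - (-1)^(|x'||m|) x' m`,
`-a n' + x n' + n a' - (-1)^(|x'||n|) x' n` and `E_{m,n'} + E_{n,m'} + [x,x']`. -/
def bracket (y z : Infty E) : Infty E :=
  (q.toFun y.2.1 z.2.2.1 - q.toFun y.2.2.1 z.2.1,
    y.1 • z.2.1 + (y.2.2.2 : AddMonoid.End M) z.2.1 - rsmul 𝒜 ℳ y.2.1 z.1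
      - twApp ℳ z.2.2.2 y.2.1,
    -(y.1 • z.2.2.1) + (y.2.2.2 : AddMonoid.End M) z.2.2.1 + rsmul 𝒜 ℳ y.2.2.1 z.1
      - twApp ℳ z.2.2.2 y.2.2.1,
    ⟨elem q y.2.1 z.2.2.1 + elem q y.2.2.1 z.2.1 + sBr (pr ℳ) y.2.2.2 z.2.2.2,
      E.carrier.add_mem
        (E.carrier.add_mem (E.eosp_le (elem_mem_eosp q _ _)) (E.eosp_le (elem_mem_eosp q _ _)))
        (E.bracket_mem _ y.2.2.2.2 _ z.2.2.2.2)⟩)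

/-- `Der_K ℰ_∞`. -/
def derivations : Set (AddMonoid.End (Infty E)) :=
  der (proj E) (ract E) (bracket E)

/-- `ad ℰ_∞`. -/
def ad : Set (AddMonoid.End (Infty E)) := {d | ∃ y, ∀ z, d z = bracket E y z}

/-- `ad ℰ`, where `ℰ` is embedded into `ℰ_∞` by `x ↦ (0,0,0,x)`. -/
def adE : Set (AddMonoid.End (Infty E)) :=
  {d | ∃ x : E.carrier, ∀ z, d z = bracket E (0, 0, 0, x) z}

/-- The locally inner derivations of `ℰ_∞`. -/
def adLoc : Set (AddMonoid.End (Infty E)) :=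
  {d | d ∈ derivations E ∧ ∀ s : Finset (Infty E), ∃ y, ∀ z ∈ s, d z = bracket E y z}

end Infty

/-! ### The superalgebras `𝒮`, `𝒯` and the maps `d_{S,T}` -/

variable (E : OspSubalgebra ι q)

/-- `𝒮_α`: the `K`-linear `S` of degree `α` with (S1) `[S, A·id] ⊆ A·id`,
(S2) `[S, q(m,n)·id] = (q(S m, n) + (-1)^(|m||n|) q(S n, m))·id`, (S3) `[S, ℰ] ⊆ ℰ`. -/
def sHom (α : ZMod 2) : Set (AddMonoid.End M) :=
  {S | S ∈ endK 𝒜 ℳ ι ∧ HasDegree (pr ℳ) α S ∧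
    (∀ a : A, ∃ b : A, sBr (pr ℳ) S (lmul M a) = lmul M b) ∧
    (∀ i j m n, m ∈ ℳ i → n ∈ ℳ j → sBr (pr ℳ) S (lmul M (q.toFun m n)) =
      lmul M (q.toFun (S m) n + kos i j • q.toFun (S n) m)) ∧
    ∀ x ∈ E.carrier, sBr (pr ℳ) S x ∈ E.carrier}

/-- `𝒮 = 𝒮_0 ⊕ 𝒮_1`. -/
def sAlg : Set (AddMonoid.End M) := sHom E 0 + sHom E 1

/-- `𝒯_α`: the `K`-linear `T` of degree `α` with (T1) `[T, A·id] ⊆ ℰ`,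
(T2) `[T, q(m,n)·id] = E_{T m, n} + (-1)^(|m||n|) E_{T n, m}`, (T3) `[T, ℰ] ⊆ A·id`. -/
def tHom (α : ZMod 2) : Set (AddMonoid.End M) :=
  {T | T ∈ endK 𝒜 ℳ ι ∧ HasDegree (pr ℳ) α T ∧
    (∀ a : A, sBr (pr ℳ) T (lmul M a) ∈ E.carrier) ∧
    (∀ i j m n, m ∈ ℳ i → n ∈ ℳ j → sBr (pr ℳ) T (lmul M (q.toFun m n)) =
      elem q (T m) n + kos i j • elem q (T n) m) ∧
    ∀ x ∈ E.carrier, ∃ b : A, sBr (pr ℳ) T x = lmul M b}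

/-- `𝒯 = 𝒯_0 ⊕ 𝒯_1`. -/
def tMod : Set (AddMonoid.End M) := tHom E 0 + tHom E 1

/-- `d = d_{S,T}`, that is,
`d(a,m,n,x) = ([S,a·id] + [T,x], (S+T)(m), (S-T)(n), [T,a·id] + [S,x])`,
where `A` is identified with `A·id`. -/
def IsD (S T : AddMonoid.End M) (d : AddMonoid.End (Infty E)) : Prop :=
  ∀ (a : A) (m n : M) (x : E.carrier),
    lmul M (d (a, m, n, x)).1 = sBr (pr ℳ) S (lmul M a) + sBr (pr ℳ) T x ∧
    (d (a, m, n, x)).2.1 = (S + T) m ∧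
    (d (a, m, n, x)).2.2.1 = (S - T) n ∧
    ((d (a, m, n, x)).2.2.2 : AddMonoid.End M) = sBr (pr ℳ) T (lmul M a) + sBr (pr ℳ) S x

/-- `𝒟 = {d_{S,T} | S ∈ 𝒮, T ∈ 𝒯}`. -/
def dAlg : Set (AddMonoid.End (Infty E)) := {d | ∃ S ∈ sAlg E, ∃ T ∈ tMod E, IsD E S T d}

/-- `{d_{S,0} ∈ 𝒟 | S ∈ X}`. -/
def dSet (X : Set (AddMonoid.End M)) : Set (AddMonoid.End (Infty E)) :=
  {d | d ∈ dAlg E ∧ ∃ S ∈ X, IsD E S 0 d}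

/-- `{S ∈ X | [S, ℰ] ⊆ ℰ}`. -/
def normIn (X : Set (AddMonoid.End M)) : Set (AddMonoid.End M) :=
  {S | S ∈ X ∧ ∀ x ∈ E.carrier, sBr (pr ℳ) S x ∈ E.carrier}

end Infty

/-! ### The quadratic form `q = q_N ⊕ q_R` -/

section Split

variable {A : Type u} {M : Type w} [Ring A] [AddCommGroup M] [Module A M]
  {𝒜 : ZMod 2 → AddSubgroup A} [DirectSum.Decomposition 𝒜]
  {ℳ : ZMod 2 → AddSubgroup M} [DirectSum.Decomposition ℳ]

/-- `q` is almost diagonal on the family `n`, with involution `i ↦ bar i`: `q(n_i, n_{bar i})` is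
homogeneous and invertible, and `q(n_i, n_j) = 0` for `j ≠ bar i`. -/
def IsAlmostDiagonal {I : Type*} (q : SuperForm 𝒜 ℳ) (n : I → M) (bar : I → I) : Prop :=
  ∀ i, (IsUnit (q.toFun (n i) (n (bar i))) ∧ ∃ α, q.toFun (n i) (n (bar i)) ∈ 𝒜 α) ∧
    ∀ j, j ≠ bar i → q.toFun (n i) (n j) = 0

/-- Invertibly diagonal: almost diagonal with `bar i = i`. -/
def IsInvertiblyDiagonal {I : Type*} (q : SuperForm 𝒜 ℳ) (n : I → M) : Prop :=
  IsAlmostDiagonal q n id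

/-- `M = N ⊕ R` and `N = N₁ ⊕ N₂` are orthogonal sums of free supermodules with homogeneous bases
indexed by `J` (for `R`), `I` (for `N₁`) and `Fin 2` (for `N₂`), where `q` is almost diagonal on
`N₁`, invertibly diagonal on `N₂` and zero on `R`. -/
structure IsSplit {I J : Type*} (q : SuperForm 𝒜 ℳ) (b : Module.Basis ((I ⊕ Fin 2) ⊕ J) A M)
    (bar : I → I) : Prop where
  homogeneous : ∀ s, ∃ α, b s ∈ ℳ α
  almostDiagonal : IsAlmostDiagonal q (fun i => b (.inl (.inl i))) bar
  invertiblyDiagonal : IsInvertiblyDiagonal q (fun i => b (.inl (.inr i)))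
  orthogonal_N : ∀ i s, q.toFun (b (.inl (.inl i))) (b (.inl (.inr s))) = 0
  orthogonal : ∀ s j, q.toFun (b (.inl s)) (b (.inr j)) = 0
  zero_R : ∀ j j', q.toFun (b (.inr j)) (b (.inr j')) = 0

/-- For a basis `n_i` (`i : I`), `r_j` (`j : J`) of `M`:
`Δ_M(∑ a_i n_i + ∑ b_j r_j) = ∑ (½ Δ(q(n_i,n_ī)) q(n_i,n_ī)⁻¹ a_i + Δ(a_i)) n_i + ∑ Δ(b_j) r_j`. -/
noncomputable def deltaM {I J : Type*} (q : SuperForm 𝒜 ℳ) (b : Module.Basis (I ⊕ J) A M)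
    (bar : I → I) (Δ : AddMonoid.End A) : AddMonoid.End M :=
  AddMonoidHom.mk'
    (fun m => (b.repr m).sum fun s c => (Sum.elim
        (fun i => Ring.inverse (2 : A) * Δ (q.toFun (b (.inl i)) (b (.inl (bar i)))) *
          Ring.inverse (q.toFun (b (.inl i)) (b (.inl (bar i)))) * c + Δ c)
        (fun _ => Δ c) s) • b s) (by
    intro x y
    rw [map_add]
    refine Finsupp.sum_add_index' ?_ ?_
    · rintro (i | j) <;> simp
    · rintro (i | j) c c'
      · simp only [Sum.elim_inl, map_add, mul_add, add_smul]; abel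
      · simp [add_smul])

/-- `Δ_M` for `q = q_N ⊕ q_R`. -/
noncomputable def deltaSplit {I J : Type*} (q : SuperForm 𝒜 ℳ)
    (b : Module.Basis ((I ⊕ Fin 2) ⊕ J) A M) (bar : I → I) (Δ : AddMonoid.End A) :
    AddMonoid.End M :=
  deltaM q b (Sum.map bar id) Δ

/-- `(Der_K A)_M = {Δ_M | Δ ∈ Der_K A}`. -/
def derAM {I J : Type*} {K : Type v} [Ring K] (ι : K →+* A) (q : SuperForm 𝒜 ℳ)
    (b : Module.Basis ((I ⊕ Fin 2) ⊕ J) A M) (bar : I → I) : Set (AddMonoid.End M) :=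
  deltaSplit q b bar '' derA 𝒜 ι

/-- `End_A R`, extended by zero on `N`. -/
def endR {N J : Type*} (𝒜 : ZMod 2 → AddSubgroup A) [DirectSum.Decomposition 𝒜]
    (ℳ : ZMod 2 → AddSubgroup M) [DirectSum.Decomposition ℳ] (b : Module.Basis (N ⊕ J) A M) :
    Set (AddMonoid.End M) :=
  {f | f ∈ endA 𝒜 ℳ ∧
    (∀ m ∈ Submodule.span A (Set.range fun s => b (.inl s)), f m = 0) ∧
    ∀ m, f m ∈ Submodule.span A (Set.range fun j => b (.inr j))}

end Split

end OspDer

/-!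
The grading element `e = (1,0,0,0)` of `ℰ_∞` acts as `0` on `A ⊕ ℰ`, as `1` on the first and as `-1`
on the second copy of `M`. A derivation `d` becomes, after subtraction of the inner derivation given
by the components of `d(e)` in the two copies of `M`, a derivation mapping `e` into `A ⊕ ℰ`, and such
a derivation preserves the decomposition `A ⊕ ℰ`, `M`, `M` (`Infty.preserves_of_unit`). If `P` and
`Q` are its restrictions to the copies of `M`, it equals `d_{S,T}` for `S = ½ (P + Q)`,
`T = ½ (P - Q)`, and the derivation rule is the conditions `S ∈ 𝒮`, `T ∈ 𝒯`
(`Infty.exists_isD_of_preserves`).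

Three orthogonal basis vectors, two of them anisotropic, force each `T ∈ 𝒯` to be multiplication by
some `c ∈ A` (`IsFrame.exists_scalar`, `eq_lmul_of_mem_tHom`; this uses the rank condition), and then
`d_{0,T}` is the inner derivation of `(c,0,0,0)`. So `Der_K ℰ_∞ = ad ℰ_∞ + {d_{S,0} | S ∈ 𝒮}`
(`Infty.derivations_eq`). Evaluation at `e` and at the elements `(0,m,m,0)` shows that `d_{S,0}` is
inner only for `S ∈ ℰ` (`Infty.eq_of_adEnd_eq_dMap`), whence a splitting `𝒮 = ℰ ⋊ 𝒮₀` yields a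
splitting of `Der_K ℰ_∞` (`Infty.isSemidirect_ad`). That inner maps are derivations at all is the
Jacobi identity of `ℰ_∞`. It is checked on `A ⊕ M ⊕ M`; entries in `ℰ` reduce to the fact that
`d_{x,0}` is a derivation (`Infty.jacobi`).

An endomorphism `S` satisfying the first two conditions of `𝒮` is a superderivation of the quadratic
module `(M, q)` along some derivation `Δ` of `A` (`IsAlong`). So is `Δ_M`, and the difference of two
such endomorphisms along the same `Δ` is in `osp(q)`; hence `𝒮` is the normalizer of `ℰ` in
`osp(q) ⊕ (Der_K A)_M` (`sAlg_eq_normIn`). An element of the latter sum that lies in `(Der_K A)_M` and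
is `A`-linear is zero, because the coefficients of the `n_i` recover `Δ`.

For the three special cases, `R` is the radical of the form, and `osp(q)` is the direct sum of
`End_A R` and the ideal `ospN` of the elements vanishing on `R` (`osp_eq_add`). For `x ∈ osp(q)` let
`F_i = E_{v_i, n_{bar i}}`, where `v_i` is `x(q(n_{bar i}, n_i)⁻¹ n_i)` with its component in `N`
halved. Then `F_i` is, up to the component in `R`, the sum of half of `x ∘ (component along n_i)` and
half of `(component along n_{bar i}) ∘ x` (`elemOf_apply`), so that for `x ∈ ospN` the `F_i` sum up to
`x` (`finsum_elemOf`). Thus `ospN` is the summable closure of `eosp(q)`, it equals `eosp(q)` in finite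
rank, and each of its elements agrees on any finite set with an element of `eosp(q)`. The last
property gives the locally inner derivations for `ℰ = eosp(q)` (`Infty.isSemidirect_adLoc`).
-/

namespace OspDer

universe u v w

/-! ### Signs and gradings -/

theorem kos_comm (i j : ZMod 2) : kos i j = kos j i := by revert i j; decide

theorem kos_add_left (i j k : ZMod 2) : kos (i + j) k = kos i k * kos j k := by
  revert i j k; decide

theorem kos_add_right (i j k : ZMod 2) : kos i (j + k) = kos i j * kos i k := by
  revert i j k; decide

theorem kos_mul_self (i j : ZMod 2) : kos i j * kos i j = 1 := by revert i j; decide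

@[simp] theorem kos_zero_left (j : ZMod 2) : kos 0 j = 1 := by revert j; decide

@[simp] theorem kos_zero_right (j : ZMod 2) : kos j 0 = 1 := by revert j; decide

@[simp] theorem kos_one_one : kos 1 1 = -1 := by decide

theorem kos_eq_or (i j : ZMod 2) : kos i j = 1 ∨ kos i j = -1 := by revert i j; decide

theorem kos_smul_smul {L : Type*} [AddCommGroup L] (i j : ZMod 2) (x : L) :
    kos i j • kos i j • x = x := by
  rw [smul_smul, kos_mul_self, one_smul]

theorem zmod_two_cases (i : ZMod 2) : i = 0 ∨ i = 1 := by revert i; decide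

theorem zmod_two_one_add_one : (1 + 1 : ZMod 2) = 0 := by decide

section EndApply

variable {L : Type*} [AddCommGroup L] (f g : AddMonoid.End L) (x : L)

@[simp] theorem end_add_apply : (f + g) x = f x + g x := rfl

@[simp] theorem end_sub_apply : (f - g) x = f x - g x := rfl

@[simp] theorem end_neg_apply : (-f) x = -f x := rfl

@[simp] theorem end_zsmul_apply (z : ℤ) : (z • f) x = z • f x := rfl

@[simp] theorem end_mul_apply : (f * g) x = f (g x) := rfl

@[simp] theorem end_zero_apply : (0 : AddMonoid.End L) x = 0 := rfl

theorem end_zsmul_add (z : ℤ) : z • (f + g) = z • f + z • g := zsmul_add f g z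

theorem end_zsmul_sub (z : ℤ) : z • (f - g) = z • f - z • g := zsmul_sub f g z

end EndApply

/-- `π 0`, `π 1` are the homogeneous projections of a `ℤ/2`-grading. -/
structure IsGrading {L : Type*} [AddCommGroup L] (π : ZMod 2 → AddMonoid.End L) : Prop where
  idem : ∀ i x, π i (π i x) = π i x
  orth : ∀ i j x, i ≠ j → π i (π j x) = 0
  add_eq : ∀ x, π 0 x + π 1 x = x

section Grading

variable {L : Type*} [AddCommGroup L] {π : ZMod 2 → AddMonoid.End L}

theorem IsGrading.apply_of_ne (h : IsGrading π) {i j : ZMod 2} {x : L} (hx : π j x = x)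
    (hij : i ≠ j) : π i x = 0 := by rw [← hx]; exact h.orth i j x hij

/-- An element vanishes when all its homogeneous components do; in this form, two additive
maps agree when they agree on homogeneous elements. -/
theorem IsGrading.hom_ext (h : IsGrading π) {L' : Type*} [AddCommGroup L'] {f g : L →+ L'}
    (H : ∀ i x, π i x = x → f x = g x) : f = g := by
  ext x
  rw [← h.add_eq x, map_add, map_add, H 0 _ (h.idem 0 x), H 1 _ (h.idem 1 x)]

theorem IsGrading.end_ext (h : IsGrading π) {f g : AddMonoid.End L}
    (H : ∀ i x, π i x = x → f x = g x) : f = g :=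
  h.hom_ext H

theorem HasDegree.zero (α : ZMod 2) : HasDegree π α 0 := by intro j x _; simp

theorem HasDegree.add {α : ZMod 2} {f g : AddMonoid.End L} (hf : HasDegree π α f)
    (hg : HasDegree π α g) : HasDegree π α (f + g) := by
  intro j x hx
  simp [hf j x hx, hg j x hx]

theorem HasDegree.neg {α : ZMod 2} {f : AddMonoid.End L} (hf : HasDegree π α f) :
    HasDegree π α (-f) := by
  intro j x hx
  simp [hf j x hx]

theorem HasDegree.sub {α : ZMod 2} {f g : AddMonoid.End L} (hf : HasDegree π α f)
    (hg : HasDegree π α g) : HasDegree π α (f - g) := by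
  rw [sub_eq_add_neg]; exact hf.add hg.neg

theorem HasDegree.zsmul {α : ZMod 2} {f : AddMonoid.End L} (hf : HasDegree π α f) (z : ℤ) :
    HasDegree π α (z • f) := by
  intro j x hx
  have := hf j x hx
  simp [this]

theorem HasDegree.mul {α β : ZMod 2} {f g : AddMonoid.End L} (hf : HasDegree π α f)
    (hg : HasDegree π β g) : HasDegree π (α + β) (f * g) := by
  intro j x hx
  have := hf _ _ (hg j x hx)
  rwa [← add_assoc] at this

theorem endComp_apply (h : IsGrading π) (α : ZMod 2) (f : AddMonoid.End L) {j : ZMod 2} {x : L}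
    (hx : π j x = x) : endComp π α f x = π (α + j) (f x) := by
  have h2 : endComp π α f x = π (α + 0) (f (π 0 x)) + π (α + 1) (f (π 1 x)) := by
    simp only [endComp]
    rw [show (Finset.univ : Finset (ZMod 2)) = {0, 1} from by decide,
      Finset.sum_pair (by decide)]
    rfl
  rw [h2]
  rcases zmod_two_cases j with rfl | rfl
  · rw [hx, h.apply_of_ne hx (by decide : (1 : ZMod 2) ≠ 0)]; simp
  · rw [hx, h.apply_of_ne hx (by decide : (0 : ZMod 2) ≠ 1)]; simp

theorem endComp_add (α : ZMod 2) (f g : AddMonoid.End L) :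
    endComp π α (f + g) = endComp π α f + endComp π α g := by
  simp [endComp, mul_add, add_mul, Finset.sum_add_distrib]

theorem endComp_zero (α : ZMod 2) : endComp π α 0 = 0 := by simp [endComp]

theorem hasDegree_endComp (h : IsGrading π) (α : ZMod 2) (f : AddMonoid.End L) :
    HasDegree π α (endComp π α f) := by
  intro j x hx
  rw [endComp_apply h α f hx, h.idem]

theorem endComp_add_endComp (h : IsGrading π) (f : AddMonoid.End L) :
    endComp π 0 f + endComp π 1 f = f := by
  refine h.end_ext fun j x hx => ?_
  rw [end_add_apply, endComp_apply h _ f hx, endComp_apply h _ f hx]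
  rcases zmod_two_cases j with rfl | rfl
  · exact h.add_eq _
  · rw [zmod_two_one_add_one, zero_add, add_comm]; exact h.add_eq _

theorem endComp_of_hasDegree (h : IsGrading π) {α : ZMod 2} {f : AddMonoid.End L}
    (hf : HasDegree π α f) : endComp π α f = f := by
  refine h.end_ext fun j x hx => ?_
  rw [endComp_apply h _ f hx, hf j x hx]

theorem endComp_of_ne (h : IsGrading π) {α β : ZMod 2} {f : AddMonoid.End L}
    (hf : HasDegree π α f) (hne : β ≠ α) : endComp π β f = 0 := by
  refine h.end_ext fun j x hx => ?_
  rw [endComp_apply h _ f hx]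
  exact h.apply_of_ne (hf j x hx) (by simpa using hne)

theorem sBr_add_left (f f' g : AddMonoid.End L) :
    sBr π (f + f') g = sBr π f g + sBr π f' g := by
  simp only [sBr, endComp_add, add_mul, mul_add, end_zsmul_add, ← Finset.sum_add_distrib]
  refine Finset.sum_congr rfl fun i _ => Finset.sum_congr rfl fun j _ => ?_
  abel

theorem sBr_add_right (f g g' : AddMonoid.End L) :
    sBr π f (g + g') = sBr π f g + sBr π f g' := by
  simp only [sBr, endComp_add, add_mul, mul_add, end_zsmul_add, ← Finset.sum_add_distrib]
  refine Finset.sum_congr rfl fun i _ => Finset.sum_congr rfl fun j _ => ?_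
  abel

/-- The superbracket as a biadditive map. -/
def sBrHom (π : ZMod 2 → AddMonoid.End L) :
    AddMonoid.End L →+ AddMonoid.End L →+ AddMonoid.End L :=
  AddMonoidHom.mk' (fun f => AddMonoidHom.mk' (sBr π f) (sBr_add_right f))
    (fun f f' => AddMonoidHom.ext fun g => sBr_add_left f f' g)

theorem sBr_zero_left (g : AddMonoid.End L) : sBr π 0 g = 0 := by simp [sBr, endComp_zero]

theorem sBr_zero_right (g : AddMonoid.End L) : sBr π g 0 = 0 := by simp [sBr, endComp_zero]

theorem sBr_neg_left (f g : AddMonoid.End L) : sBr π (-f) g = -sBr π f g :=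
  congrArg (· g) (map_neg (sBrHom π) f)

theorem sBr_neg_right (f g : AddMonoid.End L) : sBr π f (-g) = -sBr π f g :=
  map_neg (sBrHom π f) g

theorem sBr_sub_left (f f' g : AddMonoid.End L) :
    sBr π (f - f') g = sBr π f g - sBr π f' g :=
  congrArg (· g) (map_sub (sBrHom π) f f')

theorem sBr_of_hasDegree (h : IsGrading π) {α β : ZMod 2} {f g : AddMonoid.End L}
    (hf : HasDegree π α f) (hg : HasDegree π β g) :
    sBr π f g = f * g - kos α β • (g * f) := by
  rw [sBr, Finset.sum_eq_single α, Finset.sum_eq_single β, endComp_of_hasDegree h hf,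
    endComp_of_hasDegree h hg]
  · intro j _ hj
    simp [endComp_of_ne h hg hj]
  · simp
  · intro i _ hi
    simp [endComp_of_ne h hf hi]
  · simp

theorem hasDegree_sBr (h : IsGrading π) {α β : ZMod 2} {f g : AddMonoid.End L}
    (hf : HasDegree π α f) (hg : HasDegree π β g) : HasDegree π (α + β) (sBr π f g) := by
  rw [sBr_of_hasDegree h hf hg]
  refine (hf.mul hg).sub (HasDegree.zsmul ?_ _)
  rw [add_comm]
  exact hg.mul hf

theorem sBr_skew (h : IsGrading π) {α β : ZMod 2} {f g : AddMonoid.End L}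
    (hf : HasDegree π α f) (hg : HasDegree π β g) : sBr π f g = -(kos α β • sBr π g f) := by
  rw [sBr_of_hasDegree h hf hg, sBr_of_hasDegree h hg hf, kos_comm β α, end_zsmul_sub]
  ext x
  simp only [end_sub_apply, end_neg_apply, end_zsmul_apply, kos_smul_smul]
  abel

theorem sBr_jacobi (h : IsGrading π) {α β γ : ZMod 2} {f g k : AddMonoid.End L}
    (hf : HasDegree π α f) (hg : HasDegree π β g) (hk : HasDegree π γ k) :
    sBr π f (sBr π g k) = sBr π (sBr π f g) k + kos α β • sBr π g (sBr π f k) := by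
  rw [sBr_of_hasDegree h hf (hasDegree_sBr h hg hk), sBr_of_hasDegree h (hasDegree_sBr h hf hg) hk,
    sBr_of_hasDegree h hg (hasDegree_sBr h hf hk), sBr_of_hasDegree h hf hg,
    sBr_of_hasDegree h hg hk, sBr_of_hasDegree h hf hk, kos_add_left, kos_add_right, kos_add_right,
    kos_comm β α]
  ext x
  simp only [end_sub_apply, end_add_apply, end_zsmul_apply, end_mul_apply, map_sub, map_zsmul]
  rcases kos_eq_or α β with h1 | h1 <;> rcases kos_eq_or α γ with h2 | h2 <;>
    rcases kos_eq_or β γ with h3 | h3 <;> simp only [h1, h2, h3] <;> abel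

/-- The superbracket with `f` is the sum over the components of `f` and `g`. -/
theorem sBr_comp_comp (h : IsGrading π) (f g : AddMonoid.End L) :
    sBr π f g = ∑ i, ∑ j, sBr π (endComp π i f) (endComp π j g) := by
  rw [sBr]
  refine Finset.sum_congr rfl fun i _ => Finset.sum_congr rfl fun j _ => ?_
  rw [sBr_of_hasDegree h (hasDegree_endComp h i f) (hasDegree_endComp h j g)]

/-- Membership of a superbracket in an additive subgroup can be tested on homogeneous
components. -/
theorem sBr_mem_of_comp (h : IsGrading π) (Y : AddSubgroup (AddMonoid.End L))
    (f g : AddMonoid.End L)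
    (H : ∀ i j, sBr π (endComp π i f) (endComp π j g) ∈ Y) : sBr π f g ∈ Y := by
  rw [sBr_comp_comp h]
  exact Y.sum_mem fun i _ => Y.sum_mem fun j _ => H i j

end Grading

section Pr

variable {G : Type*} [AddCommGroup G] (𝒢 : ZMod 2 → AddSubgroup G) [DirectSum.Decomposition 𝒢]

theorem pr_mem (i : ZMod 2) (x : G) : pr 𝒢 i x ∈ 𝒢 i := (DirectSum.decompose 𝒢 x i).2

variable {𝒢}

theorem pr_of_mem {i : ZMod 2} {x : G} (hx : x ∈ 𝒢 i) : pr 𝒢 i x = x :=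
  DirectSum.decompose_of_mem_same 𝒢 hx

theorem pr_of_mem_ne {i j : ZMod 2} {x : G} (hx : x ∈ 𝒢 i) (hij : i ≠ j) : pr 𝒢 j x = 0 :=
  DirectSum.decompose_of_mem_ne 𝒢 hx hij

theorem pr_eq_iff {i : ZMod 2} {x : G} : pr 𝒢 i x = x ↔ x ∈ 𝒢 i :=
  ⟨fun h => h ▸ pr_mem 𝒢 i x, pr_of_mem⟩

variable (𝒢)

theorem pr_add_pr (x : G) : pr 𝒢 0 x + pr 𝒢 1 x = x := by
  refine DirectSum.Decomposition.inductionOn (motive := fun x => pr 𝒢 0 x + pr 𝒢 1 x = x) 𝒢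
    (by simp) ?_ ?_ x
  · intro i m
    rcases zmod_two_cases i with rfl | rfl
    · rw [pr_of_mem m.2, pr_of_mem_ne m.2 (by decide), add_zero]
    · rw [pr_of_mem m.2, pr_of_mem_ne m.2 (by decide), zero_add]
  · intro m n hm hn
    rw [map_add, map_add, add_add_add_comm, hm, hn]

theorem isGrading_pr : IsGrading (pr 𝒢) where
  idem i x := pr_of_mem (pr_mem 𝒢 i x)
  orth i j x hij := pr_of_mem_ne (pr_mem 𝒢 j x) hij.symm
  add_eq := pr_add_pr 𝒢

variable {𝒢}

theorem HasDegree.mem {α j : ZMod 2} {f : AddMonoid.End G} (hf : HasDegree (pr 𝒢) α f) {x : G}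
    (hx : x ∈ 𝒢 j) : f x ∈ 𝒢 (α + j) :=
  pr_eq_iff.1 (hf j x (pr_of_mem hx))

theorem hasDegree_pr_iff {α : ZMod 2} {f : AddMonoid.End G} :
    HasDegree (pr 𝒢) α f ↔ ∀ j, ∀ x ∈ 𝒢 j, f x ∈ 𝒢 (α + j) :=
  ⟨fun h _ _ hx => h.mem hx, fun h j x hx => pr_of_mem (h j x (pr_eq_iff.1 hx))⟩

theorem hom_ext_of_mem {L' : Type*} [AddCommGroup L'] {f g : G →+ L'}
    (H : ∀ i, ∀ x ∈ 𝒢 i, f x = g x) : f = g :=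
  (isGrading_pr 𝒢).hom_ext fun i x hx => H i x (pr_eq_iff.1 hx)

end Pr

/-! ### Lie superalgebras of endomorphisms and derivations -/

section Parts

variable {L : Type*} [AddCommGroup L] {π : ZMod 2 → AddMonoid.End L}

/-- The sum of a subgroup of even and a subgroup of odd endomorphisms consists of the
endomorphisms whose components lie in these subgroups. -/
theorem mem_add_parts (h : IsGrading π) {X : ZMod 2 → AddSubgroup (AddMonoid.End L)}
    (hdeg : ∀ α, ∀ f ∈ X α, HasDegree π α f) {f : AddMonoid.End L} :
    f ∈ (X 0 : Set (AddMonoid.End L)) + X 1 ↔ ∀ α, endComp π α f ∈ X α := by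
  constructor
  · rintro ⟨g, hg, k, hk, rfl⟩ α
    show endComp π α (g + k) ∈ X α
    have hg' := hdeg 0 g hg
    have hk' := hdeg 1 k hk
    rw [endComp_add]
    rcases zmod_two_cases α with rfl | rfl
    · rw [endComp_of_hasDegree h hg', endComp_of_ne h hk' (by decide), add_zero]; exact hg
    · rw [endComp_of_hasDegree h hk', endComp_of_ne h hg' (by decide), zero_add]; exact hk
  · intro H
    exact ⟨_, H 0, _, H 1, endComp_add_endComp h f⟩

theorem mem_add_parts_of_mem (h : IsGrading π) {X : ZMod 2 → AddSubgroup (AddMonoid.End L)}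
    (hdeg : ∀ α, ∀ f ∈ X α, HasDegree π α f) {α : ZMod 2} {f : AddMonoid.End L} (hf : f ∈ X α) :
    f ∈ (X 0 : Set (AddMonoid.End L)) + X 1 := by
  rw [mem_add_parts h hdeg]
  intro β
  by_cases hβ : β = α
  · rw [hβ, endComp_of_hasDegree h (hdeg α f hf)]; exact hf
  · rw [endComp_of_ne h (hdeg α f hf) hβ]; exact (X β).zero_mem

variable {K : Type*} [Ring K] (𝒦 : ZMod 2 → AddSubgroup K) [DirectSum.Decomposition 𝒦]

/-- Homogeneous parts `X 0` and `X 1` closed under the action of homogeneous scalars and under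
the superbracket add up to a Lie superalgebra. -/
theorem isLieSubalgebra_parts (h : IsGrading π) {l : K → AddMonoid.End L}
    (l_add : ∀ k k', l (k + k') = l k + l k')
    {X : ZMod 2 → AddSubgroup (AddMonoid.End L)}
    (hdeg : ∀ α, ∀ f ∈ X α, HasDegree π α f)
    (hsmul : ∀ κ, ∀ k ∈ 𝒦 κ, ∀ α, ∀ f ∈ X α, l k * f ∈ X (κ + α))
    (hbr : ∀ α, ∀ f ∈ X α, ∀ β, ∀ g ∈ X β, sBr π f g ∈ X (α + β)) :
    IsLieSubalgebra π l ((X 0 : Set (AddMonoid.End L)) + X 1) := by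
  have key : (X 0 : Set (AddMonoid.End L)) + X 1 = (X 0 ⊔ X 1 : AddSubgroup _) := by
    ext f
    rw [SetLike.mem_coe, AddSubgroup.mem_sup]
    rfl
  have of_mem : ∀ α, ∀ f ∈ X α, f ∈ X 0 ⊔ X 1 := by
    intro α f hf
    have := mem_add_parts_of_mem h hdeg hf
    rwa [key] at this
  have comp : ∀ f ∈ X 0 ⊔ X 1, ∀ α, endComp π α f ∈ X α := by
    intro f hf
    rw [← SetLike.mem_coe, ← key, mem_add_parts h hdeg] at hf
    exact hf
  rw [key]
  refine ⟨AddSubgroup.zero_mem _, fun f hf g hg => AddSubgroup.add_mem _ hf hg,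
    fun f hf => AddSubgroup.neg_mem _ hf, ?_, ?_, ?_⟩
  · exact fun α f hf => of_mem α _ (comp f hf α)
  · intro k f hf
    have hc := comp f hf
    rw [← endComp_add_endComp h f, ← pr_add_pr 𝒦 k, l_add]
    simp only [mul_add, add_mul]
    refine AddSubgroup.add_mem _ (AddSubgroup.add_mem _ ?_ ?_) (AddSubgroup.add_mem _ ?_ ?_)
    all_goals exact of_mem _ _ (hsmul _ _ (pr_mem 𝒦 _ k) _ _ (hc _))
  · intro f hf g hg
    exact sBr_mem_of_comp h _ f g fun i j =>
      of_mem _ _ (hbr _ _ (comp f hf i) _ _ (comp g hg j))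

/-- A superalgebra over `K` with homogeneous projections `π`, left action `l` and right action
`r` of `K`, and product `mul`, not assumed associative. -/
structure IsSuperAlgebra (π : ZMod 2 → AddMonoid.End L) (l : K → AddMonoid.End L)
    (r : K → L → L) (mul : L → L → L) : Prop where
  grading : IsGrading π
  mul_add : ∀ x y z, mul x (y + z) = mul x y + mul x z
  add_mul : ∀ x y z, mul (x + y) z = mul x z + mul y z
  mul_deg : ∀ i j x y, π i x = x → π j y = y → π (i + j) (mul x y) = mul x y
  l_add : ∀ k k', l (k + k') = l k + l k'
  l_deg : ∀ κ, ∀ k ∈ 𝒦 κ, HasDegree π κ (l k)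
  l_r : ∀ k k' x, l k (r k' x) = r k' (l k x)
  r_add : ∀ k x y, r k (x + y) = r k x + r k y
  l_mul : ∀ k x y, mul (l k x) y = l k (mul x y)
  mul_l : ∀ κ, ∀ k ∈ 𝒦 κ, ∀ i x y, π i x = x → mul x (l k y) = kos κ i • l k (mul x y)

namespace IsSuperAlgebra

variable {𝒦} {l : K → AddMonoid.End L} {r : K → L → L} {mul : L → L → L}

/-- Multiplication as a biadditive map. -/
def mulHom (H : IsSuperAlgebra 𝒦 π l r mul) : L →+ L →+ L :=
  AddMonoidHom.mk' (fun x => AddMonoidHom.mk' (mul x) (H.mul_add x))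
    (fun x y => AddMonoidHom.ext fun z => H.add_mul x y z)

/-- Multiplication by `x` from the left. -/
def ad (H : IsSuperAlgebra 𝒦 π l r mul) (x : L) : AddMonoid.End L := H.mulHom x

theorem ad_apply (H : IsSuperAlgebra 𝒦 π l r mul) (x y : L) : H.ad x y = mul x y := rfl

theorem zero_mul (H : IsSuperAlgebra 𝒦 π l r mul) (x : L) : mul 0 x = 0 :=
  DFunLike.congr_fun (map_zero H.mulHom) x

theorem mul_zero (H : IsSuperAlgebra 𝒦 π l r mul) (x : L) : mul x 0 = 0 :=
  map_zero (H.mulHom x)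

theorem neg_mul (H : IsSuperAlgebra 𝒦 π l r mul) (x y : L) : mul (-x) y = -mul x y :=
  DFunLike.congr_fun (map_neg H.mulHom x) y

theorem mul_neg (H : IsSuperAlgebra 𝒦 π l r mul) (x y : L) : mul x (-y) = -mul x y :=
  map_neg (H.mulHom x) y

theorem sub_mul (H : IsSuperAlgebra 𝒦 π l r mul) (x y z : L) :
    mul (x - y) z = mul x z - mul y z :=
  DFunLike.congr_fun (map_sub H.mulHom x y) z

theorem mul_sub (H : IsSuperAlgebra 𝒦 π l r mul) (x y z : L) :
    mul x (y - z) = mul x y - mul x z :=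
  map_sub (H.mulHom x) y z

theorem zsmul_mul (H : IsSuperAlgebra 𝒦 π l r mul) (z : ℤ) (x y : L) :
    mul (z • x) y = z • mul x y :=
  DFunLike.congr_fun (map_zsmul H.mulHom z x) y

theorem mul_zsmul (H : IsSuperAlgebra 𝒦 π l r mul) (z : ℤ) (x y : L) :
    mul x (z • y) = z • mul x y :=
  map_zsmul (H.mulHom x) z y

theorem r_zsmul (H : IsSuperAlgebra 𝒦 π l r mul) (k : K) (z : ℤ) (x : L) :
    r k (z • x) = z • r k x :=
  map_zsmul (AddMonoidHom.mk' (r k) (H.r_add k)) z x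

theorem r_sub (H : IsSuperAlgebra 𝒦 π l r mul) (k : K) (x y : L) :
    r k (x - y) = r k x - r k y :=
  map_sub (AddMonoidHom.mk' (r k) (H.r_add k)) x y

theorem r_neg (H : IsSuperAlgebra 𝒦 π l r mul) (k : K) (x : L) : r k (-x) = -r k x :=
  map_neg (AddMonoidHom.mk' (r k) (H.r_add k)) x

/-- The additive group of derivations of degree `α`. -/
def derPart (H : IsSuperAlgebra 𝒦 π l r mul) (α : ZMod 2) : AddSubgroup (AddMonoid.End L) where
  carrier := derHom π r mul α
  zero_mem' := by
    refine ⟨HasDegree.zero α, fun k x => ?_, fun i x y _ => ?_⟩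
    · exact (map_zero (AddMonoidHom.mk' (r k) (H.r_add k))).symm
    · simp [H.zero_mul, H.mul_zero]
  add_mem' := by
    rintro f g ⟨hf, hf1, hf2⟩ ⟨hg, hg1, hg2⟩
    refine ⟨hf.add hg, fun k x => ?_, fun i x y hx => ?_⟩
    · simp [hf1, hg1, H.r_add]
    · simp only [end_add_apply, hf2 i x y hx, hg2 i x y hx, H.add_mul, H.mul_add, smul_add]
      abel
  neg_mem' := by
    rintro f ⟨hf, hf1, hf2⟩
    refine ⟨hf.neg, fun k x => ?_, fun i x y hx => ?_⟩
    · simp [hf1, H.r_neg]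
    · simp only [end_neg_apply, hf2 i x y hx, H.neg_mul, H.mul_neg, smul_neg]
      abel

theorem derPart_deg (H : IsSuperAlgebra 𝒦 π l r mul) :
    ∀ α, ∀ f ∈ H.derPart α, HasDegree π α f := fun _ _ hf => hf.1

theorem der_eq (H : IsSuperAlgebra 𝒦 π l r mul) :
    der π r mul = (H.derPart 0 : Set (AddMonoid.End L)) + H.derPart 1 := rfl

theorem mem_der (H : IsSuperAlgebra 𝒦 π l r mul) {d : AddMonoid.End L} :
    d ∈ der π r mul ↔ ∀ α, endComp π α d ∈ derHom π r mul α := by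
  rw [H.der_eq]; exact mem_add_parts H.grading H.derPart_deg

theorem derHom_subset_der (H : IsSuperAlgebra 𝒦 π l r mul) (α : ZMod 2) :
    derHom π r mul α ⊆ der π r mul := fun _ hd =>
  mem_add_parts_of_mem H.grading H.derPart_deg (α := α) hd

theorem sBr_mem_derHom (H : IsSuperAlgebra 𝒦 π l r mul) {α β : ZMod 2} {f g : AddMonoid.End L}
    (hf : f ∈ derHom π r mul α) (hg : g ∈ derHom π r mul β) :
    sBr π f g ∈ derHom π r mul (α + β) := by
  obtain ⟨hf, hf1, hf2⟩ := hf
  obtain ⟨hg, hg1, hg2⟩ := hg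
  refine ⟨hasDegree_sBr H.grading hf hg, fun k x => ?_, fun i x y hx => ?_⟩
  · rw [sBr_of_hasDegree H.grading hf hg]
    simp only [end_sub_apply, end_zsmul_apply, end_mul_apply, hf1, hg1]
    rw [H.r_sub, H.r_zsmul]
  · rw [sBr_of_hasDegree H.grading hf hg]
    simp only [end_sub_apply, end_zsmul_apply, end_mul_apply, hf2 i x _ hx, hg2 i x _ hx, map_add,
      map_zsmul, hf2 _ _ _ (hg i x hx), hg2 _ _ _ (hf i x hx), kos_add_left, kos_add_right,
      H.sub_mul, H.mul_sub, H.zsmul_mul, H.mul_zsmul, kos_comm β α]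
    rcases kos_eq_or α β with h1 | h1 <;> rcases kos_eq_or α i with h2 | h2 <;>
      rcases kos_eq_or β i with h3 | h3 <;> simp only [h1, h2, h3] <;> abel

/-- The derivations of a superalgebra form a Lie superalgebra. -/
theorem isLieSubalgebra_der (H : IsSuperAlgebra 𝒦 π l r mul) :
    IsLieSubalgebra π l (der π r mul) := by
  rw [H.der_eq]
  refine isLieSubalgebra_parts 𝒦 H.grading H.l_add H.derPart_deg ?_ ?_
  · rintro κ k hk α f ⟨hf, hf1, hf2⟩
    refine ⟨(H.l_deg κ k hk).mul hf, fun k' x => ?_, fun i x y hx => ?_⟩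
    · simp only [end_mul_apply, hf1, H.l_r]
    · simp only [end_mul_apply, hf2 i x y hx, map_add, map_zsmul, H.l_mul, H.mul_l κ k hk i _ _ hx,
        kos_add_left, smul_smul]
      rw [mul_right_comm, kos_mul_self, one_mul]
  · intro α f hf β g hg
    exact H.sBr_mem_derHom hf hg

end IsSuperAlgebra

end Parts

section Lie

variable {L : Type*} [AddCommGroup L] {π : ZMod 2 → AddMonoid.End L}
variable {K : Type*} [Ring K] {𝒦 : ZMod 2 → AddSubgroup K} [DirectSum.Decomposition 𝒦]
  {l : K → AddMonoid.End L} {r : K → L → L} {mul : L → L → L}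

/-- The derivations that agree on each set with the property `P` with an inner derivation. For
`P` always true these are the inner derivations, for `P` finiteness the locally inner ones. -/
def innerOn (π : ZMod 2 → AddMonoid.End L) (r : K → L → L) (mul : L → L → L)
    (P : Set L → Prop) : Set (AddMonoid.End L) :=
  {d | d ∈ der π r mul ∧ ∀ s, P s → ∃ y, ∀ z ∈ s, d z = mul y z}

namespace IsSuperAlgebra

theorem endComp_ad (H : IsSuperAlgebra 𝒦 π l r mul) (α : ZMod 2) (y : L) :
    endComp π α (H.ad y) = H.ad (π α y) := by
  refine H.grading.end_ext fun j x hx => ?_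
  rw [endComp_apply H.grading _ _ hx, H.ad_apply, H.ad_apply]
  have hy := H.grading.add_eq y
  have key : ∀ β, π (α + j) (mul (π β y) x) = if β = α then mul (π α y) x else 0 := by
    intro β
    have := H.mul_deg β j _ x (H.grading.idem β y) hx
    split_ifs with hβ
    · rw [hβ] at this ⊢; exact this
    · exact H.grading.apply_of_ne this (fun e => hβ (add_right_cancel e).symm)
  conv_lhs => rw [← hy, H.add_mul, map_add, key, key]
  rcases zmod_two_cases α with rfl | rfl <;> simp

variable {P : Set L → Prop}

/-- Derivations agreeing with inner ones on the sets of a suitable family have the same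
property componentwise. -/
theorem endComp_innerOn (H : IsSuperAlgebra 𝒦 π l r mul)
    (hunion : ∀ s t, P s → P t → P (s ∪ t))
    (himage : ∀ (f : L → L) s, P s → P (f '' s)) {d : AddMonoid.End L}
    (hd : d ∈ innerOn π r mul P) (α : ZMod 2) {s : Set L} (hs : P s) :
    ∃ y, π α y = y ∧ ∀ z ∈ s, endComp π α d z = mul y z := by
  obtain ⟨y, hy⟩ := hd.2 (π 0 '' s ∪ π 1 '' s) (hunion _ _ (himage _ s hs) (himage _ s hs))
  refine ⟨π α y, H.grading.idem α y, fun z hz => ?_⟩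
  rw [← H.ad_apply, ← H.endComp_ad]
  conv_lhs => rw [← H.grading.add_eq z]
  conv_rhs => rw [← H.grading.add_eq z]
  rw [map_add, map_add, endComp_apply H.grading _ _ (H.grading.idem 0 z),
    endComp_apply H.grading _ _ (H.grading.idem 1 z),
    endComp_apply H.grading _ _ (H.grading.idem 0 z),
    endComp_apply H.grading _ _ (H.grading.idem 1 z), hy _ (Or.inl ⟨z, hz, rfl⟩),
    hy _ (Or.inr ⟨z, hz, rfl⟩)]
  rfl

theorem add_mem_innerOn (H : IsSuperAlgebra 𝒦 π l r mul) {f g : AddMonoid.End L}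
    (hf : f ∈ innerOn π r mul P) (hg : g ∈ innerOn π r mul P) : f + g ∈ innerOn π r mul P := by
  refine ⟨H.isLieSubalgebra_der.add_mem f hf.1 g hg.1, fun s hs => ?_⟩
  obtain ⟨y, hy⟩ := hf.2 s hs
  obtain ⟨y', hy'⟩ := hg.2 s hs
  exact ⟨y + y', fun z hz => by rw [H.add_mul, end_add_apply, hy z hz, hy' z hz]⟩

/-- The bracket of a derivation and a derivation that is inner on a family of sets is inner
on these sets. -/
theorem sBr_mem_innerOn (H : IsSuperAlgebra 𝒦 π l r mul)
    (hunion : ∀ s t, P s → P t → P (s ∪ t))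
    (himage : ∀ (f : L → L) s, P s → P (f '' s)) {D d : AddMonoid.End L}
    (hD : D ∈ der π r mul) (hd : d ∈ innerOn π r mul P) : sBr π D d ∈ innerOn π r mul P := by
  refine ⟨H.isLieSubalgebra_der.bracket_mem _ hD _ hd.1, fun s hs => ?_⟩
  have key : ∀ α β, ∃ y, ∀ z ∈ s, sBr π (endComp π α D) (endComp π β d) z = mul y z := by
    intro α β
    obtain ⟨y, hyβ, hy⟩ := H.endComp_innerOn hunion himage hd β
      (hunion _ _ hs (himage (endComp π α D) s hs))
    obtain ⟨-, -, hα2⟩ := H.mem_der.1 hD α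
    refine ⟨endComp π α D y, fun z hz => ?_⟩
    rw [sBr_of_hasDegree H.grading (hasDegree_endComp H.grading _ _)
      (hasDegree_endComp H.grading _ _), end_sub_apply, end_zsmul_apply, end_mul_apply,
      end_mul_apply, hy z (Or.inl hz), hy _ (Or.inr ⟨z, hz, rfl⟩), hα2 β y z hyβ]
    abel
  choose y hy using key
  refine ⟨∑ i, ∑ j, y i j, fun z hz => ?_⟩
  rw [sBr_comp_comp H.grading]
  have e := map_sum (AddMonoidHom.eval z : AddMonoid.End L →+ L)
    (fun p : ZMod 2 × ZMod 2 => sBr π (endComp π p.1 D) (endComp π p.2 d)) Finset.univ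
  have e' := map_sum ((AddMonoidHom.eval z : (L →+ L) →+ L).comp H.mulHom)
    (fun p : ZMod 2 × ZMod 2 => y p.1 p.2) Finset.univ
  rw [Fintype.sum_prod_type] at e e'
  refine e.trans (Eq.trans ?_ e'.symm)
  exact Finset.sum_congr rfl fun p _ => hy p.1 p.2 z hz

theorem isLieSubalgebra_innerOn (H : IsSuperAlgebra 𝒦 π l r mul)
    (hunion : ∀ s t, P s → P t → P (s ∪ t))
    (himage : ∀ (f : L → L) s, P s → P (f '' s)) : IsLieSubalgebra π l (innerOn π r mul P) where
  zero_mem := ⟨H.isLieSubalgebra_der.zero_mem, fun _ _ => ⟨0, fun z _ => by simp [H.zero_mul]⟩⟩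
  add_mem _ hf _ hg := H.add_mem_innerOn hf hg
  neg_mem f hf := by
    refine ⟨H.isLieSubalgebra_der.neg_mem f hf.1, fun s hs => ?_⟩
    obtain ⟨y, hy⟩ := hf.2 s hs
    exact ⟨-y, fun z hz => by rw [H.neg_mul, end_neg_apply, hy z hz]⟩
  comp_mem α f hf := by
    refine ⟨H.isLieSubalgebra_der.comp_mem α f hf.1, fun s hs => ?_⟩
    obtain ⟨y, -, hy⟩ := H.endComp_innerOn hunion himage hf α hs
    exact ⟨y, hy⟩
  smul_mem k f hf := by
    refine ⟨H.isLieSubalgebra_der.smul_mem k f hf.1, fun s hs => ?_⟩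
    obtain ⟨y, hy⟩ := hf.2 s hs
    exact ⟨l k y, fun z hz => by rw [H.l_mul, end_mul_apply, hy z hz]⟩
  bracket_mem f hf g hg := H.sBr_mem_innerOn hunion himage hf.1 hg

end IsSuperAlgebra

end Lie

/-! ### Calculus in supermodules -/

section Calculus

variable {A : Type u} {M : Type w} [Ring A] [AddCommGroup M] [Module A M]

theorem lmul_apply (a : A) (m : M) : lmul M a m = a • m := rfl

theorem lmul_add (a b : A) : lmul M (a + b) = lmul M a + lmul M b := by
  ext m; simp [lmul_apply, add_smul]

theorem lmul_mul (a b : A) : lmul M (a * b) = lmul M a * lmul M b := by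
  ext m; simp [lmul_apply, mul_smul]

theorem lmul_zero : lmul M (0 : A) = 0 := by
  ext m; simp [lmul_apply]

/-- `a ↦ a · id` as an additive map. -/
def lmulHom (A : Type u) (M : Type w) [Ring A] [AddCommGroup M] [Module A M] :
    A →+ AddMonoid.End M :=
  AddMonoidHom.mk' (lmul M) lmul_add

theorem lmul_sub (a b : A) : lmul M (a - b) = lmul M a - lmul M b :=
  map_sub (lmulHom A M) a b

theorem lmul_zsmul (z : ℤ) (a : A) : lmul M (z • a) = z • lmul M a :=
  map_zsmul (lmulHom A M) z a

theorem lmul_neg (a : A) : lmul M (-a) = -lmul M a :=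
  map_neg (lmulHom A M) a

variable {𝒜 : ZMod 2 → AddSubgroup A} [GradedRing 𝒜]
  {ℳ : ZMod 2 → AddSubgroup M} [DirectSum.Decomposition ℳ]

/-- The right action as a biadditive map. -/
def rsmulHom (𝒜 : ZMod 2 → AddSubgroup A) [GradedRing 𝒜]
    (ℳ : ZMod 2 → AddSubgroup M) [DirectSum.Decomposition ℳ] : M →+ A →+ M :=
  AddMonoidHom.mk' (fun m => AddMonoidHom.mk' (rsmul 𝒜 ℳ m) (by
    intro a b
    simp only [rsmul, map_add, add_smul, smul_add, Finset.sum_add_distrib])) (by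
    intro m n
    ext a
    show rsmul 𝒜 ℳ (m + n) a = rsmul 𝒜 ℳ m a + rsmul 𝒜 ℳ n a
    simp only [rsmul, map_add, smul_add, Finset.sum_add_distrib])

theorem rsmul_add_left (m n : M) (a : A) :
    rsmul 𝒜 ℳ (m + n) a = rsmul 𝒜 ℳ m a + rsmul 𝒜 ℳ n a :=
  DFunLike.congr_fun (map_add (rsmulHom 𝒜 ℳ) m n) a

theorem rsmul_add_right (m : M) (a b : A) :
    rsmul 𝒜 ℳ m (a + b) = rsmul 𝒜 ℳ m a + rsmul 𝒜 ℳ m b :=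
  map_add (rsmulHom 𝒜 ℳ m) a b

theorem rsmul_neg_left (m : M) (a : A) : rsmul 𝒜 ℳ (-m) a = -rsmul 𝒜 ℳ m a :=
  DFunLike.congr_fun (map_neg (rsmulHom 𝒜 ℳ) m) a

@[simp] theorem rsmul_zero_left (a : A) : rsmul 𝒜 ℳ 0 a = 0 :=
  DFunLike.congr_fun (map_zero (rsmulHom 𝒜 ℳ)) a

@[simp] theorem rsmul_zero_right (m : M) : rsmul 𝒜 ℳ m 0 = 0 :=
  map_zero (rsmulHom 𝒜 ℳ m)

theorem rsmul_of_mem {i j : ZMod 2} {a : A} {m : M} (ha : a ∈ 𝒜 i) (hm : m ∈ ℳ j) :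
    rsmul 𝒜 ℳ m a = kos i j • (a • m) := by
  rw [rsmul, Finset.sum_eq_single i, Finset.sum_eq_single j, pr_of_mem ha, pr_of_mem hm]
  · intro k _ hk; rw [pr_of_mem_ne hm hk.symm]; simp
  · simp
  · intro k _ hk
    simp [pr_of_mem_ne ha hk.symm]
  · simp

theorem rsmul_even {a : A} (ha : a ∈ 𝒜 0) (m : M) : rsmul 𝒜 ℳ m a = a • m := by
  rw [← pr_add_pr ℳ m, rsmul_add_left, rsmul_of_mem ha (pr_mem ℳ 0 m),
    rsmul_of_mem ha (pr_mem ℳ 1 m), smul_add]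
  simp

theorem rsmul_of_even {m : M} (hm : m ∈ ℳ 0) (a : A) : rsmul 𝒜 ℳ m a = a • m := by
  rw [← pr_add_pr 𝒜 a, rsmul_add_right, rsmul_of_mem (pr_mem 𝒜 0 a) hm,
    rsmul_of_mem (pr_mem 𝒜 1 a) hm, add_smul]
  simp

theorem rsmul_one (m : M) : rsmul 𝒜 ℳ m 1 = m := by
  rw [rsmul_even SetLike.GradedOne.one_mem, one_smul]

variable [SetLike.GradedSMul 𝒜 ℳ]

theorem smul_mem_deg {i j : ZMod 2} {a : A} {m : M} (ha : a ∈ 𝒜 i) (hm : m ∈ ℳ j) :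
    a • m ∈ ℳ (i + j) :=
  SetLike.GradedSMul.smul_mem ha hm

theorem hasDegree_lmul {i : ZMod 2} {a : A} (ha : a ∈ 𝒜 i) : HasDegree (pr ℳ) i (lmul M a) :=
  hasDegree_pr_iff.2 fun _ _ hx => smul_mem_deg ha hx

theorem endComp_lmul (i : ZMod 2) (a : A) :
    endComp (pr ℳ) i (lmul M a) = lmul M (pr 𝒜 i a) := by
  have key : ∀ j, endComp (pr ℳ) i (lmul M (pr 𝒜 j a)) =
      if j = i then lmul M (pr 𝒜 i a) else 0 := by
    intro j
    have := hasDegree_lmul (ℳ := ℳ) (pr_mem 𝒜 j a)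
    split_ifs with hj
    · rw [hj] at this ⊢; exact endComp_of_hasDegree (isGrading_pr ℳ) this
    · exact endComp_of_ne (isGrading_pr ℳ) this (Ne.symm hj)
  conv_lhs => rw [← pr_add_pr 𝒜 a, lmul_add, endComp_add, key, key]
  rcases zmod_two_cases i with rfl | rfl <;> simp

theorem mul_mem_deg {i j : ZMod 2} {a b : A} (ha : a ∈ 𝒜 i) (hb : b ∈ 𝒜 j) :
    a * b ∈ 𝒜 (i + j) :=
  SetLike.GradedMul.mul_mem ha hb

/-! ### Endomorphisms over `A` and over `K` -/

/-- A homogeneous endomorphism commuting with the right action of `a` commutes with the left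
action of `a` up to sign. -/
theorem map_smul_of_map_rsmul {f : AddMonoid.End M} {ξ i : ZMod 2} (hd : HasDegree (pr ℳ) ξ f)
    {a : A} (ha : a ∈ 𝒜 i) (H : ∀ m, f (rsmul 𝒜 ℳ m a) = rsmul 𝒜 ℳ (f m) a) (m : M) :
    f (a • m) = kos ξ i • (a • f m) := by
  have key : ∀ j, f (a • pr ℳ j m) = kos ξ i • (a • f (pr ℳ j m)) := by
    intro j
    have hm := pr_mem ℳ j m
    have h1 := H (pr ℳ j m)
    rw [rsmul_of_mem ha hm, rsmul_of_mem ha (hd.mem hm), map_zsmul, kos_add_right,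
      kos_comm i ξ] at h1
    rcases kos_eq_or i j with h | h <;> rw [h] at h1 <;> simpa using h1
  rw [← pr_add_pr ℳ m, smul_add, map_add, map_add, key, key, smul_add, smul_add]

theorem map_rsmul_of_map_smul {f : AddMonoid.End M} {ξ i : ZMod 2} (hd : HasDegree (pr ℳ) ξ f)
    {a : A} (ha : a ∈ 𝒜 i) (H : ∀ j, ∀ m ∈ ℳ j, f (a • m) = kos ξ i • (a • f m)) (m : M) :
    f (rsmul 𝒜 ℳ m a) = rsmul 𝒜 ℳ (f m) a := by
  have aux : ∀ j, ∀ m ∈ ℳ j, f (rsmul 𝒜 ℳ m a) = rsmul 𝒜 ℳ (f m) a := by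
    intro j m hm
    rw [rsmul_of_mem ha hm, rsmul_of_mem ha (hd.mem hm), map_zsmul, H j m hm,
      kos_add_right, kos_comm i ξ, smul_smul, mul_comm]
  rw [← pr_add_pr ℳ m, rsmul_add_left, map_add, map_add, rsmul_add_left,
    aux _ _ (pr_mem ℳ 0 m), aux _ _ (pr_mem ℳ 1 m)]

theorem endA_map_smul {f : AddMonoid.End M} (hf : f ∈ endA 𝒜 ℳ) {ξ i : ZMod 2}
    (hd : HasDegree (pr ℳ) ξ f) {a : A} (ha : a ∈ 𝒜 i) (m : M) :
    f (a • m) = kos ξ i • (a • f m) :=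
  map_smul_of_map_rsmul hd ha (fun m => hf m a) m

theorem mem_endA_of_map_smul {f : AddMonoid.End M} {ξ : ZMod 2} (hd : HasDegree (pr ℳ) ξ f)
    (H : ∀ i, ∀ a ∈ 𝒜 i, ∀ j, ∀ m ∈ ℳ j, f (a • m) = kos ξ i • (a • f m)) :
    f ∈ endA 𝒜 ℳ := by
  intro m a
  have h0 := map_rsmul_of_map_smul hd (pr_mem 𝒜 0 a) (H _ _ (pr_mem 𝒜 0 a)) m
  have h1 := map_rsmul_of_map_smul hd (pr_mem 𝒜 1 a) (H _ _ (pr_mem 𝒜 1 a)) m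
  rw [← pr_add_pr 𝒜 a, rsmul_add_right, rsmul_add_right, map_add, h0, h1]

/-- `End_A M` as an additive group. -/
def endASubgroup (𝒜 : ZMod 2 → AddSubgroup A) [GradedRing 𝒜]
    (ℳ : ZMod 2 → AddSubgroup M) [DirectSum.Decomposition ℳ] :
    AddSubgroup (AddMonoid.End M) where
  carrier := endA 𝒜 ℳ
  zero_mem' := fun m a => by simp
  add_mem' := fun {f g} hf hg m a => by
    simp [rsmul_add_left, hf m a, hg m a]
  neg_mem' := fun {f} hf m a => by
    simp [rsmul_neg_left, hf m a]

theorem endComp_mem_endA {f : AddMonoid.End M} (hf : f ∈ endA 𝒜 ℳ) (α : ZMod 2) :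
    endComp (pr ℳ) α f ∈ endA 𝒜 ℳ := by
  refine mem_endA_of_map_smul (hasDegree_endComp (isGrading_pr ℳ) α f) fun i a ha j m hm => ?_
  rw [endComp_apply (isGrading_pr ℳ) α f (pr_of_mem (smul_mem_deg ha hm)),
    endComp_apply (isGrading_pr ℳ) α f (pr_of_mem hm)]
  have h1 := hf m a
  rw [rsmul_of_mem ha hm, map_zsmul] at h1
  have h2 : f (a • m) = kos i j • rsmul 𝒜 ℳ (f m) a := by rw [← h1, kos_smul_smul]
  have key : ∀ k, pr ℳ (α + (i + j)) (rsmul 𝒜 ℳ (pr ℳ k (f m)) a) =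
      if k = α + j then kos i (α + j) • (a • pr ℳ (α + j) (f m)) else 0 := by
    intro k
    have h3 := smul_mem_deg ha (pr_mem ℳ k (f m))
    rw [rsmul_of_mem ha (pr_mem ℳ k (f m)), map_zsmul]
    split_ifs with hk
    · rw [hk] at h3 ⊢; rw [add_left_comm, pr_of_mem h3]
    · rw [pr_of_mem_ne h3, smul_zero]
      rw [add_left_comm]
      exact fun e => hk (add_left_cancel e)
  rw [h2, map_zsmul, ← pr_add_pr ℳ (f m), rsmul_add_left, map_add, key, key, pr_add_pr]
  have e : (if (0 : ZMod 2) = α + j then kos i (α + j) • (a • pr ℳ (α + j) (f m)) else 0) +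
      (if (1 : ZMod 2) = α + j then kos i (α + j) • (a • pr ℳ (α + j) (f m)) else 0) =
        kos i (α + j) • (a • pr ℳ (α + j) (f m)) := by
    rcases zmod_two_cases (α + j) with h | h <;> rw [h] <;> simp
  rw [e, smul_smul, kos_add_right, mul_left_comm, kos_mul_self, mul_one, kos_comm]

theorem mul_mem_endA {f g : AddMonoid.End M} (hf : f ∈ endA 𝒜 ℳ) (hg : g ∈ endA 𝒜 ℳ) :
    f * g ∈ endA 𝒜 ℳ := fun m a => by
  rw [end_mul_apply, end_mul_apply, hg, hf]

theorem sBr_mem_endA {f g : AddMonoid.End M} (hf : f ∈ endA 𝒜 ℳ) (hg : g ∈ endA 𝒜 ℳ) :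
    sBr (pr ℳ) f g ∈ endA 𝒜 ℳ := by
  refine sBr_mem_of_comp (isGrading_pr ℳ) (endASubgroup 𝒜 ℳ) f g fun i j => ?_
  rw [sBr_of_hasDegree (isGrading_pr ℳ) (hasDegree_endComp (isGrading_pr ℳ) _ _)
    (hasDegree_endComp (isGrading_pr ℳ) _ _)]
  have hf' := endComp_mem_endA hf i
  have hg' := endComp_mem_endA hg j
  exact (endASubgroup 𝒜 ℳ).sub_mem (mul_mem_endA hf' hg')
    ((endASubgroup 𝒜 ℳ).zsmul_mem (mul_mem_endA hg' hf') _)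

theorem lmul_rsmul (hA : IsSupercommutative 𝒜) (a b : A) (m : M) :
    a • rsmul 𝒜 ℳ m b = rsmul 𝒜 ℳ (a • m) b := by
  have key : (AddMonoidHom.compHom.flip (rsmulHom 𝒜 ℳ m)).comp (lmulHom A M) =
      (rsmulHom 𝒜 ℳ).comp ((AddMonoidHom.eval m : AddMonoid.End M →+ M).comp (lmulHom A M)) := by
    refine hom_ext_of_mem (𝒢 := 𝒜) fun i a ha => hom_ext_of_mem (𝒢 := 𝒜) fun j b hb => ?_
    show a • rsmul 𝒜 ℳ m b = rsmul 𝒜 ℳ (a • m) b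
    have aux : ∀ k, ∀ m ∈ ℳ k, a • rsmul 𝒜 ℳ m b = rsmul 𝒜 ℳ (a • m) b := by
      intro k m hm
      rw [rsmul_of_mem hb hm, rsmul_of_mem hb (smul_mem_deg ha hm), smul_comm a, smul_smul,
        smul_smul, hA i j a b ha hb, kos_add_right, kos_comm j i, smul_assoc, mul_smul,
        smul_smul, mul_comm (kos j k)]
    rw [← pr_add_pr ℳ m, rsmul_add_left, smul_add, smul_add, rsmul_add_left,
      aux _ _ (pr_mem ℳ 0 m), aux _ _ (pr_mem ℳ 1 m)]
  exact DFunLike.congr_fun (DFunLike.congr_fun key a) b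

theorem lmul_mem_endA (hA : IsSupercommutative 𝒜) (a : A) : lmul M a ∈ endA 𝒜 ℳ :=
  fun m b => lmul_rsmul hA a b m

/-- Elements of `End_A M` supercommute with multiplications by elements of `A`. -/
theorem sBr_endA_lmul {f : AddMonoid.End M} (hf : f ∈ endA 𝒜 ℳ) (a : A) :
    sBr (pr ℳ) f (lmul M a) = 0 := by
  have : sBr (pr ℳ) f (lmul M a) ∈ (⊥ : AddSubgroup (AddMonoid.End M)) := by
    refine sBr_mem_of_comp (isGrading_pr ℳ) _ f _ fun i j => ?_
    have hd := hasDegree_endComp (isGrading_pr ℳ) i f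
    rw [endComp_lmul (𝒜 := 𝒜), sBr_of_hasDegree (isGrading_pr ℳ) hd
      (hasDegree_lmul (pr_mem 𝒜 j a)), AddSubgroup.mem_bot]
    ext m
    rw [end_sub_apply, end_zsmul_apply, end_mul_apply, end_mul_apply, lmul_apply, lmul_apply,
      endA_map_smul (endComp_mem_endA hf i) hd (pr_mem 𝒜 j a), sub_self, end_zero_apply]
  exact this

theorem mem_endA_of_sBr_lmul {ξ : ZMod 2} {f : AddMonoid.End M} (hd : HasDegree (pr ℳ) ξ f)
    (H : ∀ a : A, sBr (pr ℳ) f (lmul M a) = 0) : f ∈ endA 𝒜 ℳ := by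
  refine mem_endA_of_map_smul hd fun i a ha j m _ => ?_
  have := DFunLike.congr_fun (H a) m
  rw [sBr_of_hasDegree (isGrading_pr ℳ) hd (hasDegree_lmul ha)] at this
  exact sub_eq_zero.1 this

end Calculus

/-! ### Quadratic forms and orthosymplectic superalgebras -/

section Form

variable {A : Type u} {M : Type w} [Ring A] [AddCommGroup M] [Module A M]
  {𝒜 : ZMod 2 → AddSubgroup A} [GradedRing 𝒜]
  {ℳ : ZMod 2 → AddSubgroup M} [DirectSum.Decomposition ℳ]

theorem induction_deg {G : Type*} [AddCommGroup G] (𝒢 : ZMod 2 → AddSubgroup G)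
    [DirectSum.Decomposition 𝒢] {P : G → Prop} (hadd : ∀ x y, P x → P y → P (x + y))
    (hdeg : ∀ i, ∀ x ∈ 𝒢 i, P x) (x : G) : P x := by
  rw [← pr_add_pr 𝒢 x]
  exact hadd _ _ (hdeg 0 _ (pr_mem 𝒢 0 x)) (hdeg 1 _ (pr_mem 𝒢 1 x))

/-- Homogeneous elements of `A` supercommute with all elements. -/
theorem IsSupercommutative.even_comm (hA : IsSupercommutative 𝒜) {a : A} (ha : a ∈ 𝒜 0) (b : A) :
    a * b = b * a := by
  refine induction_deg 𝒜 (P := fun b => a * b = b * a) (fun x y hx hy => ?_) (fun i x hx => ?_) b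
  · rw [mul_add, add_mul, hx, hy]
  · rw [hA 0 i a x ha hx]; simp

section SMul

variable [SetLike.GradedSMul 𝒜 ℳ]

theorem SuperForm.smul_left (hA : IsSupercommutative 𝒜) (q : SuperForm 𝒜 ℳ) (a : A) (m n : M) :
    q.toFun (a • m) n = a * q.toFun m n := by
  refine induction_deg 𝒜 (P := fun a => q.toFun (a • m) n = a * q.toFun m n)
    (fun x y hx hy => ?_) (fun k a ha => ?_) a
  · rw [add_smul, map_add, AddMonoidHom.add_apply, hx, hy, add_mul]
  refine induction_deg ℳ (P := fun m => q.toFun (a • m) n = a * q.toFun m n)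
    (fun x y hx hy => ?_) (fun i m hm => ?_) m
  · simp only [smul_add, map_add, AddMonoidHom.add_apply, hx, hy, mul_add]
  refine induction_deg ℳ (P := fun n => q.toFun (a • m) n = a * q.toFun m n)
    (fun x y hx hy => ?_) (fun j n hn => ?_) n
  · simp only [map_add, hx, hy, mul_add]
  have h1 := q.rsmul_left m n a
  have h2 := q.rsmul_right m n a
  rw [rsmul_of_mem ha hm, map_zsmul, AddMonoidHom.coe_smul, Pi.smul_apply] at h1
  rw [rsmul_of_mem ha hn, map_zsmul, ← h1,
    hA _ _ _ _ (q.degree i j m n hm hn) ha, kos_add_left, kos_comm i k, kos_comm j k] at h2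
  rcases kos_eq_or k i with h | h <;> rcases kos_eq_or k j with h' | h' <;>
    rw [h, h'] at h2 <;> simpa using h2

theorem SuperForm.smul_right (hA : IsSupercommutative 𝒜) (q : SuperForm 𝒜 ℳ) {k i : ZMod 2}
    {a : A} (ha : a ∈ 𝒜 k) {m : M} (hm : m ∈ ℳ i) (n : M) :
    q.toFun m (a • n) = kos k i • (a * q.toFun m n) := by
  rw [← q.rsmul_left, rsmul_of_mem ha hm, map_zsmul, AddMonoidHom.coe_smul, Pi.smul_apply,
    q.smul_left hA]

end SMul

theorem SuperForm.pr_toFun_left (q : SuperForm 𝒜 ℳ) {i j : ZMod 2} (m n : M) (hn : n ∈ ℳ j) :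
    pr 𝒜 (i + j) (q.toFun m n) = q.toFun (pr ℳ i m) n := by
  have key : ∀ k, pr 𝒜 (i + j) (q.toFun (pr ℳ k m) n) =
      if k = i then q.toFun (pr ℳ i m) n else 0 := by
    intro k
    have := q.degree k j _ n (pr_mem ℳ k m) hn
    split_ifs with hk
    · rw [hk] at this ⊢; exact pr_of_mem this
    · exact pr_of_mem_ne this (fun e => hk (add_right_cancel e))
  conv_lhs => rw [← pr_add_pr ℳ m, map_add, AddMonoidHom.add_apply, map_add, key, key]
  rcases zmod_two_cases i with rfl | rfl <;> simp

/-! ### The elementary endomorphisms -/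

theorem elem_apply_of_mem (q : SuperForm 𝒜 ℳ) {j k : ZMod 2} (m : M) {n p : M} (hn : n ∈ ℳ j)
    (hp : p ∈ ℳ k) :
    elem q m n p = rsmul 𝒜 ℳ m (q.toFun n p) - kos j k • (q.toFun m p • n) := by
  show rsmul 𝒜 ℳ m (q.toFun n p)
      - ∑ i, ∑ j, kos i j • (q.toFun m (pr ℳ j p) • pr ℳ i n) = _
  rw [Finset.sum_eq_single j, Finset.sum_eq_single k, pr_of_mem hn, pr_of_mem hp]
  · intro l _ hl; rw [pr_of_mem_ne hp hl.symm]; simp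
  · simp
  · intro l _ hl; simp [pr_of_mem_ne hn hl.symm]
  · simp

theorem elem_apply (q : SuperForm 𝒜 ℳ) {i j k : ZMod 2} {m n p : M} (hm : m ∈ ℳ i)
    (hn : n ∈ ℳ j) (hp : p ∈ ℳ k) :
    elem q m n p = (kos i j * kos i k) • (q.toFun n p • m) - kos j k • (q.toFun m p • n) := by
  rw [elem_apply_of_mem q m hn hp, rsmul_of_mem (q.degree j k n p hn hp) hm, kos_comm,
    kos_add_right]

/-- `E_{m,n}` is biadditive in `m` and `n`. -/
theorem elem_add_left (q : SuperForm 𝒜 ℳ) (m m' n : M) :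
    elem q (m + m') n = elem q m n + elem q m' n := by
  ext p
  show rsmul 𝒜 ℳ _ _ - ∑ i, ∑ j, _ =
    (rsmul 𝒜 ℳ _ _ - ∑ i, ∑ j, _) + (rsmul 𝒜 ℳ _ _ - ∑ i, ∑ j, _)
  simp only [rsmul_add_left, map_add, AddMonoidHom.add_apply, add_smul, smul_add,
    Finset.sum_add_distrib]
  abel

theorem elem_add_right (q : SuperForm 𝒜 ℳ) (m n n' : M) :
    elem q m (n + n') = elem q m n + elem q m n' := by
  ext p
  show rsmul 𝒜 ℳ _ _ - ∑ i, ∑ j, _ =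
    (rsmul 𝒜 ℳ _ _ - ∑ i, ∑ j, _) + (rsmul 𝒜 ℳ _ _ - ∑ i, ∑ j, _)
  simp only [rsmul_add_right, map_add, AddMonoidHom.add_apply, smul_add,
    Finset.sum_add_distrib]
  abel

/-- `E` as a biadditive map. -/
def elemHom (q : SuperForm 𝒜 ℳ) : M →+ M →+ AddMonoid.End M :=
  AddMonoidHom.mk' (fun m => AddMonoidHom.mk' (elem q m) (elem_add_right q m))
    (fun m m' => AddMonoidHom.ext fun n => elem_add_left q m m' n)

theorem elem_zero_left (q : SuperForm 𝒜 ℳ) (n : M) : elem q 0 n = 0 :=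
  DFunLike.congr_fun (map_zero (elemHom q)) n

theorem elem_zero_right (q : SuperForm 𝒜 ℳ) (m : M) : elem q m 0 = 0 :=
  map_zero (elemHom q m)

theorem elem_neg_left (q : SuperForm 𝒜 ℳ) (m n : M) : elem q (-m) n = -elem q m n :=
  DFunLike.congr_fun (map_neg (elemHom q) m) n

theorem elem_neg_right (q : SuperForm 𝒜 ℳ) (m n : M) : elem q m (-n) = -elem q m n :=
  map_neg (elemHom q m) n

theorem elem_sub_left (q : SuperForm 𝒜 ℳ) (m m' n : M) :
    elem q (m - m') n = elem q m n - elem q m' n :=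
  DFunLike.congr_fun (map_sub (elemHom q) m m') n

theorem elem_sub_right (q : SuperForm 𝒜 ℳ) (m n n' : M) :
    elem q m (n - n') = elem q m n - elem q m n' :=
  map_sub (elemHom q m) n n'

theorem elem_zsmul_left (q : SuperForm 𝒜 ℳ) (z : ℤ) (m n : M) :
    elem q (z • m) n = z • elem q m n :=
  DFunLike.congr_fun (map_zsmul (elemHom q) z m) n

theorem elem_zsmul_right (q : SuperForm 𝒜 ℳ) (z : ℤ) (m n : M) :
    elem q m (z • n) = z • elem q m n :=
  map_zsmul (elemHom q m) z n

theorem end_ext_of_mem {f g : AddMonoid.End M} (H : ∀ i, ∀ x ∈ ℳ i, f x = g x) : f = g :=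
  hom_ext_of_mem H

theorem elem_skew (q : SuperForm 𝒜 ℳ) {i j : ZMod 2} {m n : M} (hm : m ∈ ℳ i) (hn : n ∈ ℳ j) :
    elem q n m = -(kos i j • elem q m n) := by
  refine end_ext_of_mem (ℳ := ℳ) fun k p hp => ?_
  rw [end_neg_apply, end_zsmul_apply, elem_apply q hm hn hp, elem_apply q hn hm hp, kos_comm j i]
  rcases kos_eq_or i j with h1 | h1 <;> rcases kos_eq_or i k with h2 | h2 <;>
    rcases kos_eq_or j k with h3 | h3 <;> simp only [h1, h2, h3, mul_one, mul_neg,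
            neg_neg, one_smul, neg_smul] <;> abel

section SMul

variable [SetLike.GradedSMul 𝒜 ℳ]

theorem hasDegree_elem (q : SuperForm 𝒜 ℳ) {i j : ZMod 2} {m n : M} (hm : m ∈ ℳ i)
    (hn : n ∈ ℳ j) : HasDegree (pr ℳ) (i + j) (elem q m n) := by
  refine hasDegree_pr_iff.2 fun k p hp => ?_
  rw [elem_apply q hm hn hp]
  refine (ℳ _).sub_mem ((ℳ _).zsmul_mem ?_ _) ((ℳ _).zsmul_mem ?_ _)
  · have := smul_mem_deg (q.degree j k n p hn hp) hm
    rwa [show i + j + k = j + k + i by ring]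
  · have := smul_mem_deg (q.degree i k m p hm hp) hn
    rwa [show i + j + k = i + k + j by ring]

theorem elem_smul_left (hA : IsSupercommutative 𝒜) (q : SuperForm 𝒜 ℳ) {k i j : ZMod 2}
    {a : A} (ha : a ∈ 𝒜 k) {m n : M} (hm : m ∈ ℳ i) (hn : n ∈ ℳ j) :
    elem q (a • m) n = lmul M a * elem q m n := by
  refine end_ext_of_mem (ℳ := ℳ) fun l p hp => ?_
  have h : a • q.toFun n p • m = kos k (j + l) • (q.toFun n p • a • m) := by
    rw [← mul_smul, hA _ _ _ _ ha (q.degree j l n p hn hp), smul_assoc, mul_smul]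
  rw [end_mul_apply, lmul_apply, elem_apply q hm hn hp, elem_apply q (smul_mem_deg ha hm) hn hp,
    smul_sub, q.smul_left hA, smul_comm a (_ : ℤ), smul_comm a (_ : ℤ), h, mul_smul a]
  simp only [kos_add_left, kos_add_right, mul_smul]
  congr 1
  rw [smul_comm (kos i l) (kos k j), smul_comm (kos i l) (kos k l),
    smul_comm (kos k j) (kos i j)]

theorem elem_smul_right (hA : IsSupercommutative 𝒜) (q : SuperForm 𝒜 ℳ) {k i j : ZMod 2}
    {a : A} (ha : a ∈ 𝒜 k) {m n : M} (hm : m ∈ ℳ i) (hn : n ∈ ℳ j) :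
    elem q m (a • n) = kos k i • (lmul M a * elem q m n) := by
  rw [elem_skew q (smul_mem_deg ha hn) hm, elem_smul_left hA q ha hn hm,
    elem_skew q hm hn, kos_add_left]
  ext p
  simp only [end_neg_apply, end_zsmul_apply, end_mul_apply, map_neg, map_zsmul]
  rw [smul_neg, neg_neg, mul_smul, kos_comm j i, kos_smul_smul]

theorem elem_mem_endA (hA : IsSupercommutative 𝒜) (q : SuperForm 𝒜 ℳ) (m n : M) :
    elem q m n ∈ endA 𝒜 ℳ := by
  suffices h : ∀ x, elem q m x ∈ endASubgroup 𝒜 ℳ from h n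
  intro n
  refine induction_deg ℳ (P := fun m => elem q m n ∈ endASubgroup 𝒜 ℳ) (fun x y hx hy => ?_)
    (fun i m hm => ?_) m
  · rw [elem_add_left]; exact AddSubgroup.add_mem _ hx hy
  refine induction_deg ℳ (P := fun n => elem q m n ∈ endASubgroup 𝒜 ℳ) (fun x y hx hy => ?_)
    (fun j n hn => ?_) n
  · rw [elem_add_right]; exact AddSubgroup.add_mem _ hx hy
  refine mem_endA_of_map_smul (hasDegree_elem q hm hn) fun k a ha l p hp => ?_
  rw [elem_apply q hm hn hp, elem_apply q hm hn (smul_mem_deg ha hp), q.smul_right hA ha hn,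
    q.smul_right hA ha hm, smul_sub, smul_comm a (_ : ℤ), smul_comm a (_ : ℤ), smul_smul a,
    smul_smul a, smul_assoc, smul_assoc, smul_sub]
  simp only [kos_add_left, kos_add_right, smul_smul]
  rw [kos_comm j k, kos_comm i k]
  rcases kos_eq_or k i with h1 | h1 <;> rcases kos_eq_or k j with h2 | h2 <;>
    simp only [h1, h2, one_mul, mul_one, neg_mul, mul_neg,
            neg_neg, neg_smul] <;> abel

/-! ### The orthosymplectic superalgebra -/

/-- The orthosymplectic superalgebra as an additive group. -/
def ospSubgroup (q : SuperForm 𝒜 ℳ) : AddSubgroup (AddMonoid.End M) where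
  carrier := osp q
  zero_mem' := ⟨(endASubgroup 𝒜 ℳ).zero_mem, fun i j m n _ _ => by simp⟩
  add_mem' := fun {f g} hf hg => ⟨(endASubgroup 𝒜 ℳ).add_mem hf.1 hg.1, fun i j m n hm hn => by
    simp only [end_add_apply, map_add, AddMonoidHom.add_apply, smul_add]
    rw [add_add_add_comm, hf.2 i j m n hm hn, hg.2 i j m n hm hn, add_zero]⟩
  neg_mem' := fun {f} hf => ⟨(endASubgroup 𝒜 ℳ).neg_mem hf.1, fun i j m n hm hn => by
    simp only [end_neg_apply, map_neg, AddMonoidHom.neg_apply, smul_neg]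
    rw [← neg_add, hf.2 i j m n hm hn, neg_zero]⟩

theorem endComp_mem_osp {q : SuperForm 𝒜 ℳ} {f : AddMonoid.End M} (hf : f ∈ osp q)
    (α : ZMod 2) : endComp (pr ℳ) α f ∈ osp q := by
  refine ⟨endComp_mem_endA hf.1 α, fun i j m n hm hn => ?_⟩
  rw [endComp_apply (isGrading_pr ℳ) α f (pr_of_mem hm),
    endComp_apply (isGrading_pr ℳ) α f (pr_of_mem hn), ← q.pr_toFun_left _ _ hn,
    ← q.pr_toFun_left _ _ hm, show α + j + i = α + i + j by ring, ← map_zsmul, ← map_add,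
    hf.2 i j m n hm hn, map_zero]

theorem elem_mem_osp (hA : IsSupercommutative 𝒜) (q : SuperForm 𝒜 ℳ) (m n : M) :
    elem q m n ∈ osp q := by
  suffices h : ∀ x, elem q m x ∈ ospSubgroup q from h n
  intro n
  refine induction_deg ℳ (P := fun m => elem q m n ∈ ospSubgroup q) (fun x y hx hy => ?_)
    (fun i m hm => ?_) m
  · rw [elem_add_left]; exact AddSubgroup.add_mem _ hx hy
  refine induction_deg ℳ (P := fun n => elem q m n ∈ ospSubgroup q) (fun x y hx hy => ?_)
    (fun j n hn => ?_) n
  · rw [elem_add_right]; exact AddSubgroup.add_mem _ hx hy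
  refine ⟨elem_mem_endA hA q m n, fun k l p p' hp hp' => ?_⟩
  rw [elem_apply q hm hn hp, elem_apply q hm hn hp']
  simp only [map_sub, map_zsmul, AddMonoidHom.sub_apply, AddMonoidHom.coe_smul, Pi.smul_apply,
    q.smul_left hA, smul_sub]
  rw [hA _ _ _ _ (q.degree j k n p hn hp) (q.degree i l m p' hm hp'),
    hA _ _ _ _ (q.degree j l n p' hn hp') (q.degree i k m p hm hp)]
  simp only [kos_add_left, kos_add_right, smul_smul]
  rw [kos_comm j i, kos_comm k i, kos_comm l k, kos_comm l i]
  rcases kos_eq_or i j with h1 | h1 <;> rcases kos_eq_or i k with h2 | h2 <;>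
    rcases kos_eq_or i l with h3 | h3 <;> rcases kos_eq_or j k with h4 | h4 <;>
      rcases kos_eq_or j l with h5 | h5 <;> rcases kos_eq_or k l with h6 | h6 <;>
        simp only [h1, h2, h3, h4, h5, h6, mul_one, mul_neg,
            neg_neg, one_smul, neg_smul] <;> abel

end SMul

end Form

/-! ### Superderivations of a quadratic module -/

section Along

variable {A : Type u} {M : Type w} [Ring A] [AddCommGroup M] [Module A M]
  {𝒜 : ZMod 2 → AddSubgroup A} [GradedRing 𝒜]
  {ℳ : ZMod 2 → AddSubgroup M} [DirectSum.Decomposition ℳ]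

/-- `S` is a superderivation of degree `α` of the quadratic module `(M, q)` along the
endomorphism `Δ` of `A`. For a faithful module these are the endomorphisms satisfying the
first two conditions that define `𝒮`. -/
structure IsAlong (q : SuperForm 𝒜 ℳ) (α : ZMod 2) (S : AddMonoid.End M)
    (Δ : AddMonoid.End A) : Prop where
  deg : HasDegree (pr ℳ) α S
  sBr_lmul : ∀ a, sBr (pr ℳ) S (lmul M a) = lmul M (Δ a)
  form : ∀ i j m n, m ∈ ℳ i → n ∈ ℳ j →
    Δ (q.toFun m n) = q.toFun (S m) n + kos i j • q.toFun (S n) m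

/-- The superbracket acts by superderivations on products. -/
theorem sBr_mul {L : Type*} [AddCommGroup L] {π : ZMod 2 → AddMonoid.End L} (h : IsGrading π)
    {α β γ : ZMod 2} {f g k : AddMonoid.End L}
    (hf : HasDegree π α f) (hg : HasDegree π β g) (hk : HasDegree π γ k) :
    sBr π f (g * k) = sBr π f g * k + kos α β • (g * sBr π f k) := by
  rw [sBr_of_hasDegree h hf (hg.mul hk), sBr_of_hasDegree h hf hg, sBr_of_hasDegree h hf hk,
    kos_add_right]
  ext x
  simp only [end_sub_apply, end_add_apply, end_zsmul_apply, end_mul_apply, map_sub, map_zsmul,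
    smul_sub, mul_smul]
  abel

variable [SetLike.GradedSMul 𝒜 ℳ] {q : SuperForm 𝒜 ℳ}

theorem IsAlong.map_smul {α : ZMod 2} {S : AddMonoid.End M} {Δ : AddMonoid.End A}
    (h : IsAlong q α S Δ) {i : ZMod 2} {a : A} (ha : a ∈ 𝒜 i) (m : M) :
    S (a • m) = Δ a • m + kos α i • (a • S m) := by
  have := DFunLike.congr_fun (h.sBr_lmul a) m
  rw [sBr_of_hasDegree (isGrading_pr ℳ) h.deg (hasDegree_lmul ha)] at this
  rw [← lmul_apply, ← lmul_apply, ← this]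
  simp [lmul_apply]

theorem IsAlong.form' {α : ZMod 2} {S : AddMonoid.End M} {Δ : AddMonoid.End A}
    (h : IsAlong q α S Δ) {i j : ZMod 2} {m n : M} (hm : m ∈ ℳ i) (hn : n ∈ ℳ j) :
    Δ (q.toFun m n) = q.toFun (S m) n + kos α i • q.toFun m (S n) := by
  rw [h.form i j m n hm hn, q.supersymm _ _ _ _ (h.deg.mem hn) hm, smul_smul, kos_add_left,
    kos_comm j i, mul_comm, mul_assoc, kos_mul_self, mul_one]

/-- `[S, E_{m,n}] = E_{S m, n} + (-1)^(|S||m|) E_{m, S n}`. -/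
theorem IsAlong.sBr_elem {α : ZMod 2} {S : AddMonoid.End M}
    {Δ : AddMonoid.End A} (h : IsAlong q α S Δ) {i j : ZMod 2} {m n : M} (hm : m ∈ ℳ i)
    (hn : n ∈ ℳ j) :
    sBr (pr ℳ) S (elem q m n) = elem q (S m) n + kos α i • elem q m (S n) := by
  refine end_ext_of_mem (ℳ := ℳ) fun k p hp => ?_
  have e1 := h.form' hn hp
  have e2 := h.form' hm hp
  have hSm := h.deg.mem hm
  have hSn := h.deg.mem hn
  have hSp := h.deg.mem hp
  rw [sBr_of_hasDegree (isGrading_pr ℳ) h.deg (hasDegree_elem q hm hn)]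
  simp only [end_sub_apply, end_add_apply, end_zsmul_apply, end_mul_apply]
  rw [elem_apply q hm hn hp, elem_apply q hm hn hSp, elem_apply q hSm hn hp,
    elem_apply q hm hSn hp, map_sub, map_zsmul, map_zsmul, h.map_smul (q.degree j k n p hn hp),
    h.map_smul (q.degree i k m p hm hp), e1, e2]
  simp only [kos_add_left, kos_add_right, add_smul, smul_add, smul_sub, mul_smul, smul_assoc]
  rw [kos_comm i α, kos_comm j α]
  rcases kos_eq_or i j with h1 | h1 <;> rcases kos_eq_or i k with h2 | h2 <;>
    rcases kos_eq_or j k with h3 | h3 <;> rcases kos_eq_or α i with h4 | h4 <;>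
      rcases kos_eq_or α j with h5 | h5 <;> rcases kos_eq_or α k with h6 | h6 <;>
        simp only [h1, h2, h3, h4, h5, h6, one_smul, neg_smul, neg_neg, smul_neg] <;> abel

/-- A homogeneous element of `osp(q)` is a superderivation along zero. -/
theorem isAlong_of_mem_osp {x : AddMonoid.End M} {ξ : ZMod 2} (hx : x ∈ osp q)
    (hd : HasDegree (pr ℳ) ξ x) : IsAlong q ξ x 0 where
  deg := hd
  sBr_lmul a := by rw [sBr_endA_lmul hx.1]; exact lmul_zero.symm
  form i j m n hm hn := (hx.2 i j m n hm hn).symm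

theorem IsAlong.mem_osp {x : AddMonoid.End M} {ξ : ZMod 2} (h : IsAlong q ξ x 0) : x ∈ osp q :=
  ⟨mem_endA_of_sBr_lmul (𝒜 := 𝒜) h.deg fun a => (h.sBr_lmul a).trans lmul_zero,
    fun i j m n hm hn => (h.form i j m n hm hn).symm⟩

theorem IsAlong.sub {α : ZMod 2} {S S' : AddMonoid.End M} {Δ Δ' : AddMonoid.End A}
    (h : IsAlong q α S Δ) (h' : IsAlong q α S' Δ') : IsAlong q α (S - S') (Δ - Δ') where
  deg := h.deg.sub h'.deg
  sBr_lmul a := by rw [sBr_sub_left, h.sBr_lmul, h'.sBr_lmul, ← lmul_sub]; rfl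
  form i j m n hm hn := by
    simp only [end_sub_apply, h.form i j m n hm hn, h'.form i j m n hm hn, map_sub,
      AddMonoidHom.sub_apply, smul_sub]
    abel

theorem IsAlong.add {α : ZMod 2} {S S' : AddMonoid.End M} {Δ Δ' : AddMonoid.End A}
    (h : IsAlong q α S Δ) (h' : IsAlong q α S' Δ') : IsAlong q α (S + S') (Δ + Δ') where
  deg := h.deg.add h'.deg
  sBr_lmul a := by rw [sBr_add_left, h.sBr_lmul, h'.sBr_lmul, ← lmul_add]; rfl
  form i j m n hm hn := by
    simp only [end_add_apply, h.form i j m n hm hn, h'.form i j m n hm hn, map_add,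
      AddMonoidHom.add_apply, smul_add]
    abel

/-- `osp(q)` is normalized by the superderivations of the quadratic module. -/
theorem IsAlong.sBr {α β : ZMod 2} {S S' : AddMonoid.End M} {Δ Δ' : AddMonoid.End A}
    (h : IsAlong q α S Δ) (h' : IsAlong q β S' Δ') :
    IsAlong q (α + β) (sBr (pr ℳ) S S') (Δ * Δ' - kos α β • (Δ' * Δ)) where
  deg := hasDegree_sBr (isGrading_pr ℳ) h.deg h'.deg
  sBr_lmul a := by
    refine induction_deg 𝒜 (P := fun a => OspDer.sBr (pr ℳ) (OspDer.sBr (pr ℳ) S S') (lmul M a) =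
      lmul M ((Δ * Δ' - kos α β • (Δ' * Δ)) a)) (fun x y hx hy => ?_) (fun i a ha => ?_) a
    · rw [lmul_add, sBr_add_right, hx, hy, map_add, lmul_add]
    · have := sBr_jacobi (isGrading_pr ℳ) h.deg h'.deg (hasDegree_lmul (ℳ := ℳ) ha)
      rw [h.sBr_lmul, h'.sBr_lmul, h.sBr_lmul, h'.sBr_lmul] at this
      rw [end_sub_apply, lmul_sub, end_zsmul_apply, lmul_zsmul, end_mul_apply, end_mul_apply, this]
      abel
  form i j m n hm hn := by
    rw [sBr_of_hasDegree (isGrading_pr ℳ) h.deg h'.deg]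
    simp only [end_sub_apply, end_zsmul_apply, end_mul_apply, map_sub, map_zsmul,
      AddMonoidHom.sub_apply, AddMonoidHom.coe_smul, Pi.smul_apply, smul_sub]
    rw [h'.form i j m n hm hn, h.form i j m n hm hn]
    simp only [map_add, map_zsmul]
    rw [h.form' (h'.deg.mem hm) hn, h.form' (h'.deg.mem hn) hm, h'.form' (h.deg.mem hm) hn,
      h'.form' (h.deg.mem hn) hm, q.supersymm _ _ _ _ (h'.deg.mem hm) (h.deg.mem hn),
      q.supersymm _ _ _ _ (h.deg.mem hm) (h'.deg.mem hn)]
    simp only [kos_add_left, kos_add_right, smul_add, mul_smul]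
    rw [kos_comm β α, kos_comm i α, kos_comm i β]
    rcases kos_eq_or i j with h1 | h1 <;> rcases kos_eq_or α β with h2 | h2 <;>
      rcases kos_eq_or α i with h3 | h3 <;> rcases kos_eq_or α j with h4 | h4 <;>
        rcases kos_eq_or β i with h5 | h5 <;> rcases kos_eq_or β j with h6 | h6 <;>
          simp only [h1, h2, h3, h4, h5, h6, one_smul, neg_smul, neg_neg, smul_neg] <;> abel

theorem sBr_mem_osp {x : AddMonoid.End M} (hx : x ∈ osp q) {α : ZMod 2} {S : AddMonoid.End M}
    {Δ : AddMonoid.End A} (h : IsAlong q α S Δ) : OspDer.sBr (pr ℳ) S x ∈ osp q := by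
  rw [← endComp_add_endComp (isGrading_pr ℳ) x, sBr_add_right]
  have key : ∀ β, OspDer.sBr (pr ℳ) S (endComp (pr ℳ) β x) ∈ ospSubgroup q := by
    intro β
    have := h.sBr (isAlong_of_mem_osp (endComp_mem_osp hx β)
      (hasDegree_endComp (isGrading_pr ℳ) β x))
    have e : Δ * 0 - kos α β • (0 * Δ) = 0 := by ext; simp
    rw [e] at this
    exact this.mem_osp
  exact (ospSubgroup q).add_mem (key 0) (key 1)

/-- On a faithful module, `Δ` is a superderivation of `A`. -/
theorem IsAlong.leibniz (hinj : Function.Injective (lmul M : A → AddMonoid.End M)) {α : ZMod 2}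
    {S : AddMonoid.End M} {Δ : AddMonoid.End A} (h : IsAlong q α S Δ) {i : ZMod 2} {a : A}
    (ha : a ∈ 𝒜 i) (b : A) : Δ (a * b) = Δ a * b + kos α i • (a * Δ b) := by
  refine induction_deg 𝒜 (P := fun b => Δ (a * b) = Δ a * b + kos α i • (a * Δ b))
    (fun x y hx hy => ?_) (fun j b hb => ?_) b
  · simp only [mul_add, map_add, hx, hy, smul_add]; abel
  apply hinj
  rw [← h.sBr_lmul, lmul_mul, sBr_mul (isGrading_pr ℳ) h.deg (hasDegree_lmul ha)
    (hasDegree_lmul hb), h.sBr_lmul, h.sBr_lmul, lmul_add, lmul_mul, lmul_zsmul, lmul_mul]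

theorem IsAlong.hasDegree (hinj : Function.Injective (lmul M : A → AddMonoid.End M)) {α : ZMod 2}
    {S : AddMonoid.End M} {Δ : AddMonoid.End A} (h : IsAlong q α S Δ) :
    HasDegree (pr 𝒜) α Δ := by
  intro i a ha
  apply hinj
  rw [← endComp_lmul (ℳ := ℳ), ← h.sBr_lmul]
  exact endComp_of_hasDegree (isGrading_pr ℳ)
    (hasDegree_sBr (isGrading_pr ℳ) h.deg (hasDegree_lmul (pr_eq_iff.1 ha)))

end Along

/-! ### The superalgebra `ℰ_∞` -/

section Tw

variable {M : Type w} [AddCommGroup M]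
  {ℳ : ZMod 2 → AddSubgroup M} [DirectSum.Decomposition ℳ]

theorem twApp_add_left (x y : AddMonoid.End M) (m : M) :
    twApp ℳ (x + y) m = twApp ℳ x m + twApp ℳ y m := by
  simp only [twApp, endComp_add, end_add_apply, smul_add, Finset.sum_add_distrib]

theorem twApp_add_right (x : AddMonoid.End M) (m n : M) :
    twApp ℳ x (m + n) = twApp ℳ x m + twApp ℳ x n := by
  simp only [twApp, map_add, smul_add, Finset.sum_add_distrib]

theorem twApp_zero_left (m : M) : twApp ℳ 0 m = 0 := by
  simp [twApp, endComp_zero]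

theorem twApp_zero_right (x : AddMonoid.End M) : twApp ℳ x 0 = 0 := by
  simp [twApp]

theorem twApp_of_deg {i j : ZMod 2} {x : AddMonoid.End M} (hx : HasDegree (pr ℳ) i x) {m : M}
    (hm : m ∈ ℳ j) : twApp ℳ x m = kos i j • x m := by
  rw [twApp, Finset.sum_eq_single i, Finset.sum_eq_single j, pr_of_mem hm,
    endComp_of_hasDegree (isGrading_pr ℳ) hx]
  · intro k _ hk; rw [pr_of_mem_ne hm hk.symm]; simp
  · simp
  · intro k _ hk
    simp [endComp_of_ne (isGrading_pr ℳ) hx hk]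
  · simp

end Tw

section InftyAlg

variable {A : Type u} {K : Type v} {M : Type w} [Ring A] [Ring K] [AddCommGroup M] [Module A M]
  {𝒜 : ZMod 2 → AddSubgroup A} [GradedRing 𝒜]
  {ℳ : ZMod 2 → AddSubgroup M} [DirectSum.Decomposition ℳ]
  {ι : K →+* A} {q : SuperForm 𝒜 ℳ} (E : OspSubalgebra ι q)

namespace Infty

theorem ext_iff' {E : OspSubalgebra ι q} {y z : Infty E} : y = z ↔ y.1 = z.1 ∧ y.2.1 = z.2.1 ∧
    y.2.2.1 = z.2.2.1 ∧ (y.2.2.2 : AddMonoid.End M) = z.2.2.2 := by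
  rw [Prod.ext_iff, Prod.ext_iff, Prod.ext_iff, Subtype.ext_iff]

theorem isGrading_proj : IsGrading (proj E) where
  idem i y := ext_iff'.2 ⟨(isGrading_pr 𝒜).idem i _, (isGrading_pr ℳ).idem i _,
    (isGrading_pr ℳ).idem i _,
    endComp_of_hasDegree (isGrading_pr ℳ) (hasDegree_endComp (isGrading_pr ℳ) i _)⟩
  orth i j y hij := ext_iff'.2 ⟨(isGrading_pr 𝒜).orth i j _ hij, (isGrading_pr ℳ).orth i j _ hij,
    (isGrading_pr ℳ).orth i j _ hij,
    endComp_of_ne (isGrading_pr ℳ) (hasDegree_endComp (isGrading_pr ℳ) j _) hij⟩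
  add_eq y := ext_iff'.2 ⟨pr_add_pr 𝒜 _, pr_add_pr ℳ _, pr_add_pr ℳ _,
    endComp_add_endComp (isGrading_pr ℳ) _⟩

/-- An element of `ℰ_∞` is homogeneous when all its entries are. -/
theorem proj_eq_iff {E : OspSubalgebra ι q} {i : ZMod 2} {y : Infty E} :
    proj E i y = y ↔ y.1 ∈ 𝒜 i ∧ y.2.1 ∈ ℳ i ∧ y.2.2.1 ∈ ℳ i ∧
      HasDegree (pr ℳ) i (y.2.2.2 : AddMonoid.End M) := by
  rw [ext_iff', ← pr_eq_iff, ← pr_eq_iff, ← pr_eq_iff]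
  refine and_congr Iff.rfl (and_congr Iff.rfl (and_congr Iff.rfl ⟨fun h => ?_, fun h => ?_⟩))
  · rw [← h]; exact hasDegree_endComp (isGrading_pr ℳ) i _
  · exact endComp_of_hasDegree (isGrading_pr ℳ) h

theorem proj_mk_iff {E : OspSubalgebra ι q} {i : ZMod 2} {a : A} {m n : M} {x : E.carrier} :
    proj E i (a, m, n, x) = (a, m, n, x) ↔ a ∈ 𝒜 i ∧ m ∈ ℳ i ∧ n ∈ ℳ i ∧
      HasDegree (pr ℳ) i (x : AddMonoid.End M) :=
  proj_eq_iff

theorem bracket_add_left (y y' z : Infty E) :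
    bracket E (y + y') z = bracket E y z + bracket E y' z := by
  refine ext_iff'.2 ⟨?_, ?_, ?_, ?_⟩
  · simp only [bracket, Prod.fst_add, Prod.snd_add, map_add, AddMonoidHom.add_apply]; abel
  · simp only [bracket, Prod.fst_add, Prod.snd_add, AddSubgroup.coe_add, add_smul, end_add_apply,
      rsmul_add_left, twApp_add_right]; abel
  · simp only [bracket, Prod.fst_add, Prod.snd_add, AddSubgroup.coe_add, add_smul, end_add_apply,
      rsmul_add_left, twApp_add_right]; abel
  · simp only [bracket, Prod.fst_add, Prod.snd_add, AddSubgroup.coe_add, elem_add_left,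
      sBr_add_left]; abel

theorem bracket_add_right (y z z' : Infty E) :
    bracket E y (z + z') = bracket E y z + bracket E y z' := by
  refine ext_iff'.2 ⟨?_, ?_, ?_, ?_⟩
  · simp only [bracket, Prod.fst_add, Prod.snd_add, map_add]; abel
  · simp only [bracket, Prod.fst_add, Prod.snd_add, AddSubgroup.coe_add, smul_add, map_add,
      rsmul_add_right, twApp_add_left]; abel
  · simp only [bracket, Prod.fst_add, Prod.snd_add, AddSubgroup.coe_add, smul_add, map_add,
      rsmul_add_right, twApp_add_left]; abel
  · simp only [bracket, Prod.fst_add, Prod.snd_add, AddSubgroup.coe_add, elem_add_right,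
      sBr_add_right]; abel

/-- The bracket of homogeneous elements. -/
theorem bracket_of_deg {i j : ZMod 2} {a a' : A} {m n m' n' : M} {x x' : E.carrier}
    (ha' : a' ∈ 𝒜 j)
    (hm : m ∈ ℳ i) (hn : n ∈ ℳ i) (hx : HasDegree (pr ℳ) i (x : AddMonoid.End M))
    (hx' : HasDegree (pr ℳ) j (x' : AddMonoid.End M)) :
    (bracket E (a, m, n, x) (a', m', n', x')).1 = q.toFun m n' - q.toFun n m' ∧
    (bracket E (a, m, n, x) (a', m', n', x')).2.1 =
      a • m' + (x : AddMonoid.End M) m' - kos i j • (a' • m) -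
        kos i j • (x' : AddMonoid.End M) m ∧
    (bracket E (a, m, n, x) (a', m', n', x')).2.2.1 =
      -(a • n') + (x : AddMonoid.End M) n' + kos i j • (a' • n) -
        kos i j • (x' : AddMonoid.End M) n ∧
    ((bracket E (a, m, n, x) (a', m', n', x')).2.2.2 : AddMonoid.End M) =
      elem q m n' + elem q n m' + ((x : AddMonoid.End M) * x' -
        kos i j • ((x' : AddMonoid.End M) * x)) := by
  refine ⟨rfl, ?_, ?_, ?_⟩
  · simp only [bracket, rsmul_of_mem ha' hm, twApp_of_deg hx' hm, kos_comm j i]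
  · simp only [bracket, rsmul_of_mem ha' hn, twApp_of_deg hx' hn, kos_comm j i]
  · simp only [bracket, sBr_of_hasDegree (isGrading_pr ℳ) hx hx']

variable [SetLike.GradedSMul 𝒜 ℳ]

variable {𝒦 : ZMod 2 → AddSubgroup K} [GradedRing 𝒦]

theorem bracket_deg {E : OspSubalgebra ι q} {i j : ZMod 2} {y z : Infty E} (hy : proj E i y = y)
    (hz : proj E j z = z) : proj E (i + j) (bracket E y z) = bracket E y z := by
  obtain ⟨a, m, n, x⟩ := y
  obtain ⟨a', m', n', x'⟩ := z
  obtain ⟨ha, hm, hn, hx⟩ := proj_mk_iff.1 hy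
  obtain ⟨ha', hm', hn', hx'⟩ := proj_mk_iff.1 hz
  obtain ⟨e1, e2, e3, e4⟩ := bracket_of_deg E (a := a) (m' := m') (n' := n') ha' hm hn hx hx'
  rw [proj_eq_iff, e1, e2, e3, e4]
  have c1 := smul_mem_deg ha hm'
  have c2 := smul_mem_deg ha hn'
  have c3 := smul_mem_deg ha' hm
  have c4 := smul_mem_deg ha' hn
  have c5 := hx'.mem hm
  have c6 := hx'.mem hn
  have c7 := hx'.mul hx
  rw [add_comm j i] at c3 c4 c5 c6 c7
  refine ⟨(𝒜 _).sub_mem (q.degree i j m n' hm hn') (q.degree i j n m' hn hm'), ?_, ?_, ?_⟩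
  · exact (ℳ _).sub_mem ((ℳ _).sub_mem ((ℳ _).add_mem c1 (hx.mem hm')) ((ℳ _).zsmul_mem c3 _))
      ((ℳ _).zsmul_mem c5 _)
  · exact (ℳ _).sub_mem ((ℳ _).add_mem ((ℳ _).add_mem ((ℳ _).neg_mem c2) (hx.mem hn'))
      ((ℳ _).zsmul_mem c4 _)) ((ℳ _).zsmul_mem c6 _)
  · exact ((hasDegree_elem q hm hn').add (hasDegree_elem q hn hm')).add
      ((hx.mul hx').sub (c7.zsmul _))

theorem lact_deg (hι : ∀ i, ∀ k ∈ 𝒦 i, ι k ∈ 𝒜 i) {κ : ZMod 2} {k : K} (hk : k ∈ 𝒦 κ) :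
    HasDegree (proj E) κ (lact E k) := by
  intro j y hy
  obtain ⟨ha, hm, hn, hx⟩ := proj_eq_iff.1 hy
  have hk' := hι κ k hk
  exact proj_eq_iff.2 ⟨mul_mem_deg hk' ha, smul_mem_deg hk' hm, smul_mem_deg hk' hn,
    (hasDegree_lmul hk').mul hx⟩

theorem lact_add (k k' : K) : lact E (k + k') = lact E k + lact E k' := by
  ext y : 1
  refine ext_iff'.2 ⟨?_, ?_, ?_, ?_⟩
  · exact (congrArg (· * y.1) (map_add ι k k')).trans (add_mul _ _ _)
  · exact (congrArg (· • y.2.1) (map_add ι k k')).trans (add_smul _ _ _)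
  · exact (congrArg (· • y.2.2.1) (map_add ι k k')).trans (add_smul _ _ _)
  · exact (congrArg (lmul M · * (y.2.2.2 : AddMonoid.End M)) (map_add ι k k')).trans
      ((congrArg (· * (y.2.2.2 : AddMonoid.End M)) (lmul_add _ _)).trans (add_mul _ _ _))

theorem lact_bracket_deg (hA : IsSupercommutative 𝒜) (hι : ∀ i, ∀ k ∈ 𝒦 i, ι k ∈ 𝒜 i)
    {κ : ZMod 2} {k : K} (hk : k ∈ 𝒦 κ) {i j : ZMod 2} {y z : Infty E} (hy : proj E i y = y)
    (hz : proj E j z = z) :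
    bracket E (lact E k y) z = lact E k (bracket E y z) ∧
    bracket E y (lact E k z) = kos κ i • lact E k (bracket E y z) := by
  have hky := lact_deg E hι hk i y hy
  have hkz := lact_deg E hι hk j z hz
  obtain ⟨a, m, n, x⟩ := y
  obtain ⟨a', m', n', x'⟩ := z
  obtain ⟨ha, hm, hn, hx⟩ := proj_mk_iff.1 hy
  obtain ⟨ha', hm', hn', hx'⟩ := proj_mk_iff.1 hz
  obtain ⟨hka, hkm, hkn, hkx⟩ := proj_eq_iff.1 hky
  obtain ⟨hka', hkm', hkn', hkx'⟩ := proj_eq_iff.1 hkz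
  have hk' := hι κ k hk
  have hxA := (E.le_osp _ x.2).1
  have hxA' := (E.le_osp _ x'.2).1
  obtain ⟨e1, e2, e3, e4⟩ := bracket_of_deg E (a := a) (m' := m') (n' := n') ha' hm hn hx hx'
  obtain ⟨f1, f2, f3, f4⟩ := bracket_of_deg E (a := ι k * a) (m' := m') (n' := n') ha' hkm hkn
    hkx hx'
  obtain ⟨g1, g2, g3, g4⟩ := bracket_of_deg E (a := a) (m' := ι k • m') (n' := ι k • n') hka' hm
    hn hx hkx'
  have mx := fun p => endA_map_smul hxA hx hk' p
  have mx' := fun p => endA_map_smul hxA' hx' hk' p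
  have hax := fun (b : A) (i : ZMod 2) (hb : b ∈ 𝒜 i) (p : M) =>
    show b • ι k • p = kos i κ • (ι k • b • p) by
      rw [← mul_smul, hA _ _ _ _ hb hk', smul_assoc, mul_smul]
  constructor
  · refine ext_iff'.2 ⟨f1.trans ?_, f2.trans ?_, f3.trans ?_, f4.trans ?_⟩
    · show _ = ι k * (bracket E (a, m, n, x) (a', m', n', x')).1
      rw [e1, mul_sub]
      exact congrArg₂ (· - ·) (q.smul_left hA _ _ _) (q.smul_left hA _ _ _)
    · show _ = ι k • (bracket E (a, m, n, x) (a', m', n', x')).2.1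
      rw [e2]
      show (ι k * a) • m' + ι k • (x : AddMonoid.End M) m' - kos (κ + i) j • (a' • ι k • m) -
        kos (κ + i) j • (x' : AddMonoid.End M) (ι k • m) = _
      rw [hax a' j ha', mx']
      simp only [kos_add_left, kos_comm j κ, mul_smul, smul_sub,
        smul_add, smul_comm (ι k) (kos i j)]
      rcases kos_eq_or i j with h1 | h1 <;> rcases kos_eq_or κ j with h2 | h2 <;>
        rcases kos_eq_or κ i with h3 | h3 <;>
          simp only [h1, h2, one_smul, neg_smul, smul_neg, neg_neg]
    · show _ = ι k • (bracket E (a, m, n, x) (a', m', n', x')).2.2.1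
      rw [e3]
      show -((ι k * a) • n') + ι k • (x : AddMonoid.End M) n' + kos (κ + i) j • (a' • ι k • n) -
        kos (κ + i) j • (x' : AddMonoid.End M) (ι k • n) = _
      rw [hax a' j ha', mx']
      simp only [kos_add_left, kos_comm j κ, mul_smul, smul_sub,
        smul_add, smul_neg, smul_comm (ι k) (kos i j)]
      rcases kos_eq_or i j with h1 | h1 <;> rcases kos_eq_or κ j with h2 | h2 <;>
        rcases kos_eq_or κ i with h3 | h3 <;>
          simp only [h1, h2, one_smul, neg_smul, smul_neg, neg_neg]
    · show _ = lmul M (ι k) * ((bracket E (a, m, n, x) (a', m', n', x')).2.2.2 : AddMonoid.End M)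
      rw [e4]
      show elem q (ι k • m) n' + elem q (ι k • n) m' + (lmul M (ι k) * (x : AddMonoid.End M) * x' -
        kos (κ + i) j • ((x' : AddMonoid.End M) * (lmul M (ι k) * x))) = _
      rw [elem_smul_left hA q hk' hm hn', elem_smul_left hA q hk' hn hm']
      ext p
      simp only [end_add_apply, end_sub_apply, end_zsmul_apply, end_mul_apply, lmul_apply, mx',
        smul_add, smul_sub]
      rw [smul_comm (ι k) (kos i j), kos_add_left, kos_comm j κ, mul_comm (kos κ j), mul_smul,
        kos_smul_smul]
  · refine ext_iff'.2 ⟨g1.trans ?_, g2.trans ?_, g3.trans ?_, g4.trans ?_⟩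
    · show _ = kos κ i • (ι k * (bracket E (a, m, n, x) (a', m', n', x')).1)
      rw [e1, mul_sub, smul_sub, q.smul_right hA hk' hm, q.smul_right hA hk' hn]
    · show _ = kos κ i • (ι k • (bracket E (a, m, n, x) (a', m', n', x')).2.1)
      rw [e2]
      show a • ι k • m' + (x : AddMonoid.End M) (ι k • m') - kos i (κ + j) • ((ι k * a') • m) -
        kos i (κ + j) • (ι k • (x' : AddMonoid.End M) m) = _
      rw [hax a i ha, mx]
      simp only [kos_add_right, kos_comm i κ, mul_smul, smul_sub,
        smul_add, smul_comm (ι k) (kos i j)]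
    · show _ = kos κ i • (ι k • (bracket E (a, m, n, x) (a', m', n', x')).2.2.1)
      rw [e3]
      show -(a • ι k • n') + (x : AddMonoid.End M) (ι k • n') + kos i (κ + j) • ((ι k * a') • n) -
        kos i (κ + j) • (ι k • (x' : AddMonoid.End M) n) = _
      rw [hax a i ha, mx]
      simp only [kos_add_right, kos_comm i κ, mul_smul, smul_sub,
        smul_add, smul_neg, smul_comm (ι k) (kos i j)]
    · show _ = kos κ i •
        (lmul M (ι k) * ((bracket E (a, m, n, x) (a', m', n', x')).2.2.2 : AddMonoid.End M))
      rw [e4]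
      show elem q m (ι k • n') + elem q n (ι k • m') +
        ((x : AddMonoid.End M) * (lmul M (ι k) * x') -
          kos i (κ + j) • (lmul M (ι k) * (x' : AddMonoid.End M) * x)) = _
      rw [elem_smul_right hA q hk' hm hn', elem_smul_right hA q hk' hn hm']
      ext p
      simp only [end_add_apply, end_sub_apply, end_zsmul_apply, end_mul_apply, lmul_apply, mx,
        smul_add, smul_sub]
      rw [smul_comm (ι k) (kos i j), kos_add_right, kos_comm i κ, mul_smul]

theorem ract_add (k : K) (y z : Infty E) : ract E k (y + z) = ract E k y + ract E k z := by
  refine ext_iff'.2 ⟨add_mul _ _ _, rsmul_add_left _ _ _, rsmul_add_left _ _ _, add_mul _ _ _⟩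

theorem lact_ract (hA : IsSupercommutative 𝒜) (k k' : K) (y : Infty E) :
    lact E k (ract E k' y) = ract E k' (lact E k y) :=
  ext_iff'.2 ⟨(mul_assoc _ _ _).symm, lmul_rsmul hA _ _ _, lmul_rsmul hA _ _ _,
    (mul_assoc _ _ _).symm⟩

/-- `ℰ_∞` is a superalgebra over `K`. -/
theorem isSuperAlgebra (hA : IsSupercommutative 𝒜) (hι : ∀ i, ∀ k ∈ 𝒦 i, ι k ∈ 𝒜 i) :
    IsSuperAlgebra 𝒦 (proj E) (lact E) (ract E) (bracket E) where
  grading := isGrading_proj E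
  mul_add := bracket_add_right E
  add_mul := bracket_add_left E
  mul_deg i j y z hy hz := bracket_deg hy hz
  l_add := lact_add E
  l_deg κ k hk := lact_deg E hι hk
  l_r := lact_ract E hA
  r_add := ract_add E
  l_mul k y z := by
    have G := isGrading_proj E
    rw [← pr_add_pr 𝒦 k, ← G.add_eq y, ← G.add_eq z]
    simp only [lact_add, end_add_apply, map_add, bracket_add_left, bracket_add_right]
    simp only [(lact_bracket_deg E hA hι (pr_mem 𝒦 _ k) (G.idem _ y) (G.idem _ z)).1]
  mul_l κ k hk i y z hy := by
    have G := isGrading_proj E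
    rw [← G.add_eq z]
    simp only [map_add, bracket_add_right, smul_add]
    simp only [(lact_bracket_deg E hA hι hk hy (G.idem _ z)).2]

end Infty

end InftyAlg

/-! ### The derivations `d_{S,0}` and the Jacobi identity -/

section Derivations

variable {A : Type u} {K : Type v} {M : Type w} [Ring A] [Ring K] [AddCommGroup M] [Module A M]
  {𝒜 : ZMod 2 → AddSubgroup A} [GradedRing 𝒜]
  {ℳ : ZMod 2 → AddSubgroup M} [DirectSum.Decomposition ℳ] [SetLike.GradedSMul 𝒜 ℳ]
  {ι : K →+* A} {q : SuperForm 𝒜 ℳ} (E : OspSubalgebra ι q)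
  {𝒦 : ZMod 2 → AddSubgroup K} [GradedRing 𝒦]

/-- A homogeneous `K`-linear endomorphism supercommutes with scalars from `K`. -/
theorem sBr_lmul_of_mem_endK (hι : ∀ i, ∀ k ∈ 𝒦 i, ι k ∈ 𝒜 i) {α : ZMod 2}
    {S : AddMonoid.End M} (hd : HasDegree (pr ℳ) α S) (hS : S ∈ endK 𝒜 ℳ ι) (k : K) :
    sBr (pr ℳ) S (lmul M (ι k)) = 0 := by
  refine induction_deg 𝒦 (P := fun k => sBr (pr ℳ) S (lmul M (ι k)) = 0)
    (fun x y hx hy => ?_) (fun κ k hk => ?_) k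
  · rw [map_add, lmul_add, sBr_add_right, hx, hy, add_zero]
  · rw [sBr_of_hasDegree (isGrading_pr ℳ) hd (hasDegree_lmul (hι κ k hk)), sub_eq_zero]
    ext m
    exact map_smul_of_map_rsmul hd (hι κ k hk) (fun m => hS m k) m

theorem sBr_mul_lmul (hι : ∀ i, ∀ k ∈ 𝒦 i, ι k ∈ 𝒜 i) {α : ZMod 2}
    {S : AddMonoid.End M} (hd : HasDegree (pr ℳ) α S) (hS : S ∈ endK 𝒜 ℳ ι) (k : K)
    (x : AddMonoid.End M) :
    sBr (pr ℳ) S (x * lmul M (ι k)) = sBr (pr ℳ) S x * lmul M (ι k) := by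
  refine induction_deg 𝒦 (P := fun k => sBr (pr ℳ) S (x * lmul M (ι k)) =
    sBr (pr ℳ) S x * lmul M (ι k)) (fun a b ha hb => ?_) (fun κ k hk => ?_) k
  · rw [map_add, lmul_add, mul_add, sBr_add_right, ha, hb, mul_add]
  · have G := isGrading_pr ℳ
    have key : ∀ β, sBr (pr ℳ) S (endComp (pr ℳ) β x * lmul M (ι k)) =
        sBr (pr ℳ) S (endComp (pr ℳ) β x) * lmul M (ι k) := by
      intro β
      rw [sBr_mul G hd (hasDegree_endComp G β x) (hasDegree_lmul (hι κ k hk)),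
        sBr_lmul_of_mem_endK hι hd hS, mul_zero]
      ext m
      simp
    rw [← endComp_add_endComp G x, add_mul, sBr_add_right, sBr_add_right, add_mul, key, key]

/-- The components of the map `d_{S,0}` along `Δ`, where `[S, a · id] = Δ(a) · id`. -/
theorem isD_iff (hinj : Function.Injective (lmul M : A → AddMonoid.End M)) {S : AddMonoid.End M}
    {Δ : AddMonoid.End A} (hΔ : ∀ a, sBr (pr ℳ) S (lmul M a) = lmul M (Δ a))
    {d : AddMonoid.End (Infty E)} :
    IsD E S 0 d ↔ ∀ y : Infty E, (d y).1 = Δ y.1 ∧ (d y).2.1 = S y.2.1 ∧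
      (d y).2.2.1 = S y.2.2.1 ∧
      ((d y).2.2.2 : AddMonoid.End M) = sBr (pr ℳ) S (y.2.2.2 : AddMonoid.End M) := by
  constructor
  · rintro h ⟨a, m, n, x⟩
    obtain ⟨h1, h2, h3, h4⟩ := h a m n x
    rw [hΔ, sBr_zero_left, add_zero] at h1
    rw [add_zero] at h2
    rw [sub_zero] at h3
    rw [sBr_zero_left, zero_add] at h4
    exact ⟨hinj h1, h2, h3, h4⟩
  · intro h a m n x
    obtain ⟨h1, h2, h3, h4⟩ := h (a, m, n, x)
    rw [h1, h2, h3, h4, hΔ, sBr_zero_left, sBr_zero_left, add_zero, add_zero, sub_zero, zero_add]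
    exact ⟨rfl, rfl, rfl, rfl⟩

namespace Infty

/-- `d_{S,0}` is a superderivation of `ℰ_∞`. -/
theorem isD_leibniz (hinj : Function.Injective (lmul M : A → AddMonoid.End M)) {α : ZMod 2}
    {S : AddMonoid.End M} {Δ : AddMonoid.End A} (h : IsAlong q α S Δ)
    {d : AddMonoid.End (Infty E)} (hd : IsD E S 0 d) {i j : ZMod 2} {y z : Infty E}
    (hy : proj E i y = y) (hz : proj E j z = z) :
    d (bracket E y z) = bracket E (d y) z + kos α i • bracket E y (d z) := by
  have hD := (isD_iff E hinj h.sBr_lmul).1 hd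
  obtain ⟨a, m, n, x⟩ := y
  obtain ⟨a', m', n', x'⟩ := z
  obtain ⟨ha, hm, hn, hx⟩ := proj_mk_iff.1 hy
  obtain ⟨ha', hm', hn', hx'⟩ := proj_mk_iff.1 hz
  have Δdeg := h.hasDegree hinj
  have hSx := hasDegree_sBr (isGrading_pr ℳ) h.deg hx
  have hSx' := hasDegree_sBr (isGrading_pr ℳ) h.deg hx'
  have key : ∀ (a : A) (m n : M) (x : E.carrier), ∃ hx : sBr (pr ℳ) S x ∈ E.carrier,
      d (a, m, n, x) = (Δ a, S m, S n, ⟨sBr (pr ℳ) S x, hx⟩) := by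
    intro a m n x
    obtain ⟨h1, h2, h3, h4⟩ := hD (a, m, n, x)
    exact ⟨h4 ▸ (d (a, m, n, x)).2.2.2.2, ext_iff'.2 ⟨h1, h2, h3, h4⟩⟩
  obtain ⟨hxE, dy⟩ := key a m n x
  obtain ⟨hxE', dz⟩ := key a' m' n' x'
  rw [dy, dz]
  obtain ⟨e1, e2, e3, e4⟩ := bracket_of_deg E (a := a) (m' := m') (n' := n') ha' hm hn hx hx'
  obtain ⟨f1, f2, f3, f4⟩ := bracket_of_deg E (a := Δ a) (m' := m') (n' := n') ha' (h.deg.mem hm)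
    (h.deg.mem hn) (x := ⟨_, hxE⟩) hSx hx'
  obtain ⟨g1, g2, g3, g4⟩ := bracket_of_deg E (a := a) (m' := S m') (n' := S n')
    (Δdeg.mem ha') hm hn hx (x' := ⟨_, hxE'⟩) hSx'
  obtain ⟨d1, d2, d3, d4⟩ := hD (bracket E (a, m, n, x) (a', m', n', x'))
  have s1 := sBr_of_hasDegree (isGrading_pr ℳ) h.deg hx
  have s2 := sBr_of_hasDegree (isGrading_pr ℳ) h.deg hx'
  have k1 := kos_comm i α
  have k2 := kos_comm j α
  refine ext_iff'.2 ⟨d1.trans ?_, d2.trans ?_, d3.trans ?_, d4.trans ?_⟩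
  · show _ = (bracket E _ _).1 + kos α i • (bracket E _ _).1
    rw [e1, f1, g1, map_sub, h.form' hm hn', h.form' hn hm', smul_sub]
    abel
  · show _ = (bracket E _ _).2.1 + kos α i • (bracket E _ _).2.1
    rw [e2, f2, g2]
    simp only [s1, s2, end_sub_apply, end_zsmul_apply, end_mul_apply, map_sub, map_add, map_zsmul,
      h.map_smul ha, h.map_smul ha', kos_add_left, kos_add_right, smul_sub, smul_add, mul_smul,
      k1]
    rcases kos_eq_or i j with h1 | h1 <;> rcases kos_eq_or α i with h2 | h2 <;>
      rcases kos_eq_or α j with h3 | h3 <;>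
        simp only [h1, h2, h3, one_smul, neg_smul, smul_neg, neg_neg] <;> abel
  · show _ = (bracket E _ _).2.2.1 + kos α i • (bracket E _ _).2.2.1
    rw [e3, f3, g3]
    simp only [s1, s2, end_sub_apply, end_zsmul_apply, end_mul_apply, map_sub, map_add, map_zsmul,
      map_neg,
      h.map_smul ha, h.map_smul ha', kos_add_left, kos_add_right, smul_sub, smul_add, mul_smul,
      k1]
    rcases kos_eq_or i j with h1 | h1 <;> rcases kos_eq_or α i with h2 | h2 <;>
      rcases kos_eq_or α j with h3 | h3 <;>
        simp only [h1, h2, h3, one_smul, neg_smul, smul_neg, neg_neg] <;> abel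
  · show _ = ((bracket E _ _).2.2.2 : AddMonoid.End M) +
      kos α i • ((bracket E _ _).2.2.2 : AddMonoid.End M)
    rw [e4, f4, g4, ← sBr_of_hasDegree (isGrading_pr ℳ) hx hx',
      ← sBr_of_hasDegree (isGrading_pr ℳ) hSx hx', ← sBr_of_hasDegree (isGrading_pr ℳ) hx hSx',
      sBr_add_right, sBr_add_right, h.sBr_elem hm hn', h.sBr_elem hn hm',
      sBr_jacobi (isGrading_pr ℳ) h.deg hx hx', end_zsmul_add, end_zsmul_add]
    abel

/-- `d_{S,0}` is a derivation of `ℰ_∞` over `K`. -/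
theorem isD_mem_derHom (hinj : Function.Injective (lmul M : A → AddMonoid.End M))
    (hι : ∀ i, ∀ k ∈ 𝒦 i, ι k ∈ 𝒜 i) {α : ZMod 2}
    {S : AddMonoid.End M} {Δ : AddMonoid.End A} (h : IsAlong q α S Δ) (hK : S ∈ endK 𝒜 ℳ ι)
    {d : AddMonoid.End (Infty E)} (hd : IsD E S 0 d) :
    d ∈ derHom (proj E) (ract E) (bracket E) α := by
  have hD := (isD_iff E hinj h.sBr_lmul).1 hd
  have G := isGrading_proj E
  refine ⟨fun j y hy => ?_, fun k y => ?_, fun i y z hy => ?_⟩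
  · obtain ⟨h1, h2, h3, h4⟩ := hD y
    obtain ⟨ha, hm, hn, hx⟩ := proj_eq_iff.1 hy
    rw [proj_eq_iff, h1, h2, h3, h4]
    exact ⟨(h.hasDegree hinj).mem ha, h.deg.mem hm, h.deg.mem hn,
      hasDegree_sBr (isGrading_pr ℳ) h.deg hx⟩
  · obtain ⟨h1, h2, h3, h4⟩ := hD y
    obtain ⟨h1', h2', h3', h4'⟩ := hD (ract E k y)
    refine ext_iff'.2 ⟨h1'.trans ?_, h2'.trans ?_, h3'.trans ?_, h4'.trans ?_⟩
    · show Δ (y.1 * ι k) = (d y).1 * ι k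
      rw [h1]
      have hz : Δ (ι k) = 0 := by
        apply hinj
        rw [← h.sBr_lmul, sBr_lmul_of_mem_endK hι h.deg hK, lmul_zero]
      refine induction_deg 𝒜 (P := fun a => Δ (a * ι k) = Δ a * ι k) (fun a b ha hb => ?_)
        (fun i a ha => ?_) y.1
      · rw [add_mul, map_add, map_add, ha, hb, add_mul]
      · rw [h.leibniz hinj ha, hz, mul_zero, smul_zero, add_zero]
    · show S (rsmul 𝒜 ℳ y.2.1 (ι k)) = rsmul 𝒜 ℳ (d y).2.1 (ι k)
      rw [hK, h2]
    · show S (rsmul 𝒜 ℳ y.2.2.1 (ι k)) = rsmul 𝒜 ℳ (d y).2.2.1 (ι k)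
      rw [hK, h3]
    · show sBr (pr ℳ) S (y.2.2.2 * lmul M (ι k)) = ((d y).2.2.2 : AddMonoid.End M) * lmul M (ι k)
      rw [h4]
      exact sBr_mul_lmul hι h.deg hK k _
  · rw [← G.add_eq z]
    simp only [map_add, bracket_add_right, smul_add]
    rw [isD_leibniz E hinj h hd hy (G.idem 0 z), isD_leibniz E hinj h hd hy (G.idem 1 z)]
    abel

theorem bracket_comp {i j : ZMod 2} {y z : Infty E} (hy : proj E i y = y)
    (hz : proj E j z = z) :
    (bracket E y z).1 = q.toFun y.2.1 z.2.2.1 - q.toFun y.2.2.1 z.2.1 ∧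
    (bracket E y z).2.1 =
      y.1 • z.2.1 + (y.2.2.2 : AddMonoid.End M) z.2.1 - kos i j • (z.1 • y.2.1) -
        kos i j • (z.2.2.2 : AddMonoid.End M) y.2.1 ∧
    (bracket E y z).2.2.1 =
      -(y.1 • z.2.2.1) + (y.2.2.2 : AddMonoid.End M) z.2.2.1 + kos i j • (z.1 • y.2.2.1) -
        kos i j • (z.2.2.2 : AddMonoid.End M) y.2.2.1 ∧
    ((bracket E y z).2.2.2 : AddMonoid.End M) =
      elem q y.2.1 z.2.2.1 + elem q y.2.2.1 z.2.1 + ((y.2.2.2 : AddMonoid.End M) * z.2.2.2 -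
        kos i j • ((z.2.2.2 : AddMonoid.End M) * y.2.2.2)) := by
  obtain ⟨-, hm, hn, hx⟩ := proj_eq_iff.1 hy
  obtain ⟨ha', -, -, hx'⟩ := proj_eq_iff.1 hz
  exact bracket_of_deg E ha' hm hn hx hx'

theorem bracket_skew {i j : ZMod 2} {y z : Infty E} (hy : proj E i y = y)
    (hz : proj E j z = z) : bracket E y z = -(kos i j • bracket E z y) := by
  obtain ⟨e1, e2, e3, e4⟩ := bracket_comp E hy hz
  obtain ⟨f1, f2, f3, f4⟩ := bracket_comp E hz hy
  obtain ⟨ha, hm, hn, hx⟩ := proj_eq_iff.1 hy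
  obtain ⟨ha', hm', hn', hx'⟩ := proj_eq_iff.1 hz
  refine ext_iff'.2 ⟨e1.trans ?_, e2.trans ?_, e3.trans ?_, e4.trans ?_⟩
  · show _ = -(kos i j • (bracket E z y).1)
    rw [f1, q.supersymm _ _ _ _ hm' hn, q.supersymm _ _ _ _ hn' hm, kos_comm j i, smul_sub,
      kos_smul_smul, kos_smul_smul]
    abel
  · show _ = -(kos i j • (bracket E z y).2.1)
    rw [f2, kos_comm j i]
    simp only [smul_sub, smul_add, kos_smul_smul]
    abel
  · show _ = -(kos i j • (bracket E z y).2.2.1)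
    rw [f3, kos_comm j i]
    simp only [smul_sub, smul_add, kos_smul_smul, smul_neg]
    abel
  · show _ = -(kos i j • ((bracket E z y).2.2.2 : AddMonoid.End M))
    rw [f4, kos_comm j i, elem_skew q hm hn', elem_skew q hn hm']
    ext p
    simp only [end_neg_apply, end_zsmul_apply, end_add_apply, end_sub_apply, smul_sub, smul_add,
      kos_smul_smul, smul_neg]
    abel

set_option maxHeartbeats 1000000 in
/-- The Jacobi identity for elements without component in `ℰ`. -/
theorem jacobi_core (hA : IsSupercommutative 𝒜) {i j k : ZMod 2} {y z w : Infty E}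
    (hy : proj E i y = y) (hz : proj E j z = z) (hw : proj E k w = w)
    (hy0 : y.2.2.2 = 0) (hz0 : z.2.2.2 = 0) (hw0 : w.2.2.2 = 0) :
    bracket E y (bracket E z w) =
      bracket E (bracket E y z) w + kos i j • bracket E z (bracket E y w) := by
  obtain ⟨e1, e2, e3, e4⟩ := bracket_comp E hz hw
  obtain ⟨f1, f2, f3, f4⟩ := bracket_comp E hy hz
  obtain ⟨g1, g2, g3, g4⟩ := bracket_comp E hy hw
  obtain ⟨e1', e2', e3', e4'⟩ := bracket_comp E hy (bracket_deg hz hw)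
  obtain ⟨f1', f2', f3', f4'⟩ := bracket_comp E (bracket_deg hy hz) hw
  obtain ⟨g1', g2', g3', g4'⟩ := bracket_comp E hz (bracket_deg hy hw)
  simp only [e1, e2, e3, e4] at e1' e2' e3' e4'
  simp only [f1, f2, f3, f4] at f1' f2' f3' f4'
  simp only [g1, g2, g3, g4] at g1' g2' g3' g4'
  clear e1 e2 e3 e4 f1 f2 f3 f4 g1 g2 g3 g4
  obtain ⟨ha, hm, hn, -⟩ := proj_eq_iff.1 hy
  obtain ⟨ha', hm', hn', -⟩ := proj_eq_iff.1 hz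
  obtain ⟨ha'', hm'', hn'', -⟩ := proj_eq_iff.1 hw
  refine ext_iff'.2 ⟨e1'.trans (Eq.trans ?_ (congrArg₂ (· + kos i j • ·) f1' g1').symm),
    e2'.trans (Eq.trans ?_ (congrArg₂ (· + kos i j • ·) f2' g2').symm),
    e3'.trans (Eq.trans ?_ (congrArg₂ (· + kos i j • ·) f3' g3').symm),
    e4'.trans (Eq.trans ?_ (congrArg₂ (· + kos i j • ·) f4' g4').symm)⟩
  all_goals
    clear e1' e2' e3' e4' f1' f2' f3' f4' g1' g2' g3' g4'
    rw [hy0, hz0, hw0]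
    clear hy0 hz0 hw0 hy hz hw
    obtain ⟨a, m, n, x⟩ := y
    obtain ⟨a', m', n', x'⟩ := z
    obtain ⟨a'', m'', n'', x''⟩ := w
    dsimp only at ha hm hn ha' hm' hn' ha'' hm'' hn'' ⊢
    have k1 := kos_comm j i
    have k2 := kos_comm k i
    have k3 := kos_comm k j
    have k4 : ∀ (a : A) (z : ℤ) (p : M), a • z • p = z • a • p := fun a z p => smul_comm a z p
    have k5 : ∀ z : ℤ, z • (0 : AddMonoid.End M) = 0 := fun z => zsmul_zero z
    simp only [ZeroMemClass.coe_zero, end_zero_apply, zero_mul, mul_zero, sub_zero, add_zero,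
      smul_zero, kos_add_left, kos_add_right, k1, k5]
  · simp only [map_sub, map_add, map_neg, map_zsmul, AddMonoidHom.sub_apply,
      AddMonoidHom.add_apply, AddMonoidHom.neg_apply, AddMonoidHom.coe_smul, Pi.smul_apply,
      q.smul_left hA, q.smul_right hA ha hm', q.smul_right hA ha hn',
      q.smul_right hA ha' hm, q.smul_right hA ha' hn, q.smul_right hA ha'' hm,
      q.smul_right hA ha'' hn, q.smul_right hA ha'' hm', q.smul_right hA ha'' hn',
      q.supersymm _ _ _ _ hm' hn, q.supersymm _ _ _ _ hn' hm,
      mul_smul_comm, smul_sub, smul_add, smul_neg, k1, k2,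
      k3]
    rcases kos_eq_or i j with h1 | h1 <;> rcases kos_eq_or i k with h2 | h2 <;>
      rcases kos_eq_or j k with h3 | h3 <;>
        simp only [h1, h2, h3, one_smul, neg_smul, smul_neg, neg_neg] <;> abel
  · have c1 : ∀ p : M, a' • a • p = kos i j • (a • a' • p) := fun p => by
      rw [← mul_smul, hA j i a' a ha' ha, smul_assoc, mul_smul, k1]
    have c2 : ∀ p : M, a'' • a • p = kos i k • (a • a'' • p) := fun p => by
      rw [← mul_smul, hA k i a'' a ha'' ha, smul_assoc, mul_smul, k2]
    have c3 : ∀ p : M, a'' • a' • p = kos j k • (a' • a'' • p) := fun p => by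
      rw [← mul_smul, hA k j a'' a' ha'' ha', smul_assoc, mul_smul, k3]
    simp only [end_add_apply, elem_apply q hm hn' hm'', elem_apply q hn hm' hm'',
      elem_apply q hm' hn'' hm, elem_apply q hn' hm'' hm, elem_apply q hm hn'' hm',
      elem_apply q hn hm'' hm', c1, c2, c3,
      q.supersymm _ _ _ _ hm' hm, q.supersymm _ _ _ _ hn' hm,
      q.supersymm _ _ _ _ hm'' hm,
      q.supersymm _ _ _ _ hn'' hm, q.supersymm _ _ _ _ hm'' hm',
      q.supersymm _ _ _ _ hn'' hm',
      smul_sub, smul_add, sub_smul, mul_smul, smul_assoc,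
      k4, k1, k2, k3]
    rcases kos_eq_or i j with h1 | h1 <;> rcases kos_eq_or i k with h2 | h2 <;>
      rcases kos_eq_or j k with h3 | h3 <;>
        simp only [h1, h2, h3, one_smul, neg_smul, smul_neg, neg_neg] <;> abel
  · have c1 : ∀ p : M, a' • a • p = kos i j • (a • a' • p) := fun p => by
      rw [← mul_smul, hA j i a' a ha' ha, smul_assoc, mul_smul, k1]
    have c2 : ∀ p : M, a'' • a • p = kos i k • (a • a'' • p) := fun p => by
      rw [← mul_smul, hA k i a'' a ha'' ha, smul_assoc, mul_smul, k2]
    have c3 : ∀ p : M, a'' • a' • p = kos j k • (a' • a'' • p) := fun p => by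
      rw [← mul_smul, hA k j a'' a' ha'' ha', smul_assoc, mul_smul, k3]
    simp only [end_add_apply, elem_apply q hm hn' hn'', elem_apply q hn hm' hn'',
      elem_apply q hm' hn'' hn, elem_apply q hn' hm'' hn, elem_apply q hm hn'' hn',
      elem_apply q hn hm'' hn', c1, c2, c3,
      q.supersymm _ _ _ _ hm' hn,
      q.supersymm _ _ _ _ hn' hn, q.supersymm _ _ _ _ hm'' hn,
      q.supersymm _ _ _ _ hn'' hn,
      q.supersymm _ _ _ _ hm'' hn', q.supersymm _ _ _ _ hn'' hn',
      smul_sub, smul_add, smul_neg, sub_smul, mul_smul, smul_assoc,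
      k4, k1, k2, k3]
    rcases kos_eq_or i j with h1 | h1 <;> rcases kos_eq_or i k with h2 | h2 <;>
      rcases kos_eq_or j k with h3 | h3 <;>
        simp only [h1, h2, h3, one_smul, neg_smul, smul_neg, neg_neg] <;> abel
  · simp only [elem_add_left, elem_add_right, elem_sub_left, elem_sub_right, elem_neg_left,
      elem_neg_right, elem_zsmul_left, elem_zsmul_right,
      elem_smul_left hA q ha hm' hn'', elem_smul_left hA q ha hn' hm'',
      elem_smul_left hA q ha' hm hn'', elem_smul_left hA q ha' hn hm'',
      elem_smul_right hA q ha' hm hn'', elem_smul_right hA q ha' hn hm'',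
      elem_smul_right hA q ha'' hm hn', elem_smul_right hA q ha'' hn hm',
      elem_smul_right hA q ha hm' hn'', elem_smul_right hA q ha hn' hm'',
      elem_smul_right hA q ha'' hm' hn, elem_smul_right hA q ha'' hn' hm,
      elem_skew q hm hn', elem_skew q hn hm']
    ext p
    simp only [end_add_apply, end_sub_apply, end_neg_apply, end_zsmul_apply, end_mul_apply,
      smul_add, smul_sub, smul_neg, map_neg, map_zsmul, k1, k2, k3]
    rcases kos_eq_or i j with h1 | h1 <;> rcases kos_eq_or i k with h2 | h2 <;>
      rcases kos_eq_or j k with h3 | h3 <;>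
        simp only [h1, h2, h3, one_smul, neg_smul, smul_neg, neg_neg] <;> abel

end Infty

end Derivations

/-! ### Inner derivations -/

section Inner

variable {A : Type u} {K : Type v} {M : Type w} [Ring A] [Ring K] [AddCommGroup M] [Module A M]
  {𝒜 : ZMod 2 → AddSubgroup A} [GradedRing 𝒜]
  {ℳ : ZMod 2 → AddSubgroup M} [DirectSum.Decomposition ℳ] [SetLike.GradedSMul 𝒜 ℳ]
  {ι : K →+* A} {q : SuperForm 𝒜 ℳ} (E : OspSubalgebra ι q)
  {𝒦 : ZMod 2 → AddSubgroup K} [GradedRing 𝒦]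

namespace Infty

/-- The inner derivation given by `y`. -/
def adEnd (y : Infty E) : AddMonoid.End (Infty E) :=
  AddMonoidHom.mk' (bracket E y) (bracket_add_right E y)

theorem adEnd_apply (y z : Infty E) : adEnd E y z = bracket E y z := rfl

theorem adEnd_add (y z : Infty E) : adEnd E (y + z) = adEnd E y + adEnd E z := by
  ext w : 1
  exact bracket_add_left E y z w

theorem bracket_inc (x : E.carrier) (y : Infty E) : bracket E (0, 0, 0, x) y =
    (0, (x : AddMonoid.End M) y.2.1, (x : AddMonoid.End M) y.2.2.1,
      ⟨sBr (pr ℳ) x y.2.2.2, E.bracket_mem _ x.2 _ y.2.2.2.2⟩) := by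
  refine ext_iff'.2 ⟨?_, ?_, ?_, ?_⟩
  · simp [bracket]
  · simp [bracket, twApp_zero_right]
  · simp [bracket, twApp_zero_right]
  · simp [bracket, elem_zero_left]

/-- `ad x = d_{x,0}` for `x ∈ ℰ`. -/
theorem isD_adEnd_inc (x : E.carrier) : IsD E x 0 (adEnd E (0, 0, 0, x)) := by
  intro a m n y
  rw [adEnd_apply, bracket_inc, sBr_zero_left, sBr_zero_left, add_zero, sub_zero, zero_add,
    sBr_endA_lmul (E.le_osp _ x.2).1, lmul_zero, add_zero]
  exact ⟨rfl, rfl, rfl, rfl⟩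

theorem proj_inc {i : ZMod 2} {y : Infty E} (hy : proj E i y = y) :
    proj E i (0, 0, 0, y.2.2.2) = (0, 0, 0, y.2.2.2) :=
  proj_mk_iff.2 ⟨(𝒜 i).zero_mem, (ℳ i).zero_mem, (ℳ i).zero_mem, (proj_eq_iff.1 hy).2.2.2⟩

theorem proj_core {i : ZMod 2} {y : Infty E} (hy : proj E i y = y) :
    proj E i (y.1, y.2.1, y.2.2.1, 0) = (y.1, y.2.1, y.2.2.1, 0) := by
  obtain ⟨h1, h2, h3, -⟩ := proj_eq_iff.1 hy
  exact proj_mk_iff.2 ⟨h1, h2, h3, HasDegree.zero i⟩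

theorem core_add_inc (y : Infty E) : (y.1, y.2.1, y.2.2.1, 0) + (0, 0, 0, y.2.2.2) = y := by
  refine ext_iff'.2 ⟨add_zero _, add_zero _, add_zero _, ?_⟩
  exact zero_add _

variable (hA : IsSupercommutative 𝒜) (hι : ∀ i, ∀ k ∈ 𝒦 i, ι k ∈ 𝒜 i)
  (hinj : Function.Injective (lmul M : A → AddMonoid.End M))

include hinj in
theorem jacobi_inc {i j k : ZMod 2} {x : E.carrier} {z w : Infty E}
    (hx : proj E i (0, 0, 0, x) = (0, 0, 0, x)) (hz : proj E j z = z) (hw : proj E k w = w) :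
    bracket E (0, 0, 0, x) (bracket E z w) = bracket E (bracket E (0, 0, 0, x) z) w +
      kos i j • bracket E z (bracket E (0, 0, 0, x) w) :=
  isD_leibniz E hinj (isAlong_of_mem_osp (E.le_osp _ x.2) (proj_mk_iff.1 hx).2.2.2)
    (isD_adEnd_inc E x) hz hw

include hA hι hinj in
/-- The Jacobi identity in `ℰ_∞`. -/
theorem jacobi {i j k : ZMod 2} {y z w : Infty E}
    (hy : proj E i y = y) (hz : proj E j z = z) (hw : proj E k w = w) :
    bracket E y (bracket E z w) =
      bracket E (bracket E y z) w + kos i j • bracket E z (bracket E y w) := by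
  have H := isSuperAlgebra E hA hι
  -- by skew symmetry, the identity for one entry in `ℰ` follows from the one for the first entry
  have second : ∀ {i j k : ZMod 2} {y w : Infty E} {x : E.carrier},
      proj E i y = y → proj E j (0, 0, 0, x) = (0, 0, 0, x) → proj E k w = w →
      bracket E y (bracket E (0, 0, 0, x) w) =
        bracket E (bracket E y (0, 0, 0, x)) w +
          kos i j • bracket E (0, 0, 0, x) (bracket E y w) := by
    intro i j k y w x hy hx hw
    rw [jacobi_inc E hinj hx hy hw, bracket_skew E hx hy, H.neg_mul, H.zsmul_mul, kos_comm j i,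
      smul_add, smul_neg, kos_smul_smul, kos_smul_smul]
    abel
  have third : ∀ {i j k : ZMod 2} {y z : Infty E} {x : E.carrier},
      proj E i y = y → proj E j z = z → proj E k (0, 0, 0, x) = (0, 0, 0, x) →
      bracket E y (bracket E z (0, 0, 0, x)) =
        bracket E (bracket E y z) (0, 0, 0, x) +
          kos i j • bracket E z (bracket E y (0, 0, 0, x)) := by
    intro i j k y z x hy hz hx
    rw [bracket_skew E hz hx, bracket_skew E hy hx, bracket_skew E (bracket_deg hy hz) hx,
      jacobi_inc E hinj hx hy hz, H.mul_neg, H.mul_neg, H.mul_zsmul, H.mul_zsmul,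
      bracket_skew E hz (bracket_deg hx hy), kos_add_left, kos_add_right, kos_comm j i,
      kos_comm k i]
    rcases kos_eq_or i j with h1 | h1 <;> rcases kos_eq_or i k with h2 | h2 <;>
      rcases kos_eq_or j k with h3 | h3 <;>
        simp only [h1, h2, h3, one_smul, neg_smul, smul_neg, neg_neg, mul_one,
          mul_neg] <;> abel
  have a1 := jacobi_core E hA (proj_core E hy) (proj_core E hz) (proj_core E hw) rfl rfl rfl
  have a2 := third (proj_core E hy) (proj_core E hz) (proj_inc E hw)
  have a3 := second (proj_core E hy) (proj_inc E hz) hw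
  have a4 := jacobi_inc E hinj (proj_inc E hy) hz hw
  have b1 : bracket E (y.1, y.2.1, y.2.2.1, 0) (bracket E (z.1, z.2.1, z.2.2.1, 0) w) =
      bracket E (bracket E (y.1, y.2.1, y.2.2.1, 0) (z.1, z.2.1, z.2.2.1, 0)) w + kos i j •
        bracket E (z.1, z.2.1, z.2.2.1, 0) (bracket E (y.1, y.2.1, y.2.2.1, 0) w) := by
    conv_lhs => rw [← core_add_inc E w]
    conv_rhs => rw [← core_add_inc E w]
    simp only [bracket_add_right, smul_add, a1, a2]
    abel
  have b2 : bracket E (y.1, y.2.1, y.2.2.1, 0) (bracket E z w) =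
      bracket E (bracket E (y.1, y.2.1, y.2.2.1, 0) z) w + kos i j •
        bracket E z (bracket E (y.1, y.2.1, y.2.2.1, 0) w) := by
    conv_lhs => rw [← core_add_inc E z]
    conv_rhs => rw [← core_add_inc E z]
    simp only [bracket_add_right, bracket_add_left, smul_add, b1, a3]
    abel
  conv_lhs => rw [← core_add_inc E y]
  conv_rhs => rw [← core_add_inc E y]
  simp only [bracket_add_right, bracket_add_left, smul_add, b2, a4]
  abel

include hA hι in
theorem ract_of_deg {κ j : ZMod 2} {k : K} (hk : k ∈ 𝒦 κ) {y : Infty E} (hy : proj E j y = y) :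
    ract E k y = kos κ j • lact E k y := by
  obtain ⟨ha, hm, hn, hx⟩ := proj_eq_iff.1 hy
  have hk' := hι κ k hk
  refine ext_iff'.2 ⟨?_, rsmul_of_mem hk' hm, rsmul_of_mem hk' hn, ?_⟩
  · show y.1 * ι k = kos κ j • (ι k * y.1)
    rw [hA _ _ _ _ ha hk', kos_comm]
  · show (y.2.2.2 : AddMonoid.End M) * lmul M (ι k) =
      kos κ j • (lmul M (ι k) * (y.2.2.2 : AddMonoid.End M))
    ext m
    rw [kos_comm]
    exact endA_map_smul (E.le_osp _ y.2.2.2.2).1 hx hk' m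

include hA hι in
theorem bracket_ract (k : K) (y z : Infty E) :
    bracket E y (ract E k z) = ract E k (bracket E y z) := by
  have H := isSuperAlgebra E hA hι
  have G := isGrading_proj E
  have key : ∀ κ, ∀ k ∈ 𝒦 κ, ∀ i j y z, proj E i y = y → proj E j z = z →
      bracket E y (ract E k z) = ract E k (bracket E y z) := by
    intro κ k hk i j y z hy hz
    rw [ract_of_deg E hA hι hk hz, ract_of_deg E hA hι hk (bracket_deg hy hz), H.mul_zsmul,
      H.mul_l κ k hk i y z hy, smul_smul, kos_add_right, mul_comm]
  have radd : ∀ k k' y, ract E (k + k') y = ract E k y + ract E k' y := by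
    intro k k' y
    refine ext_iff'.2 ⟨?_, ?_, ?_, ?_⟩
    · show _ * ι (k + k') = _ * ι k + _ * ι k'
      rw [map_add, mul_add]
    · show rsmul 𝒜 ℳ _ (ι (k + k')) = rsmul 𝒜 ℳ _ (ι k) + rsmul 𝒜 ℳ _ (ι k')
      rw [map_add, rsmul_add_right]
    · show rsmul 𝒜 ℳ _ (ι (k + k')) = rsmul 𝒜 ℳ _ (ι k) + rsmul 𝒜 ℳ _ (ι k')
      rw [map_add, rsmul_add_right]
    · show _ * lmul M (ι (k + k')) = _ * lmul M (ι k) + _ * lmul M (ι k')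
      rw [map_add, lmul_add, mul_add]
  rw [← pr_add_pr 𝒦 k, ← G.add_eq y, ← G.add_eq z]
  simp only [radd, ract_add, bracket_add_left, bracket_add_right,
    key _ _ (pr_mem 𝒦 _ k) _ _ _ _ (G.idem _ y) (G.idem _ z)]

include hA hι hinj in
theorem adEnd_mem_derHom {i : ZMod 2} {y : Infty E} (hy : proj E i y = y) :
    adEnd E y ∈ derHom (proj E) (ract E) (bracket E) i := by
  have G := isGrading_proj E
  refine ⟨fun j z hz => bracket_deg hy hz, fun k z => bracket_ract E hA hι k y z,
    fun j z w hz => ?_⟩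
  rw [← G.add_eq w]
  simp only [map_add, bracket_add_right, smul_add, adEnd_apply]
  rw [jacobi E hA hι hinj hy hz (G.idem 0 w), jacobi E hA hι hinj hy hz (G.idem 1 w)]
  abel

include hA hι hinj in
theorem adEnd_mem_derivations (y : Infty E) : adEnd E y ∈ derivations E := by
  have H := isSuperAlgebra E hA hι
  have G := isGrading_proj E
  rw [← G.add_eq y, adEnd_add]
  exact H.isLieSubalgebra_der.add_mem _
    (H.derHom_subset_der 0 (adEnd_mem_derHom E hA hι hinj (G.idem 0 y))) _
    (H.derHom_subset_der 1 (adEnd_mem_derHom E hA hι hinj (G.idem 1 y)))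

theorem mem_ad_iff {d : AddMonoid.End (Infty E)} : d ∈ ad E ↔ ∃ y, d = adEnd E y :=
  ⟨fun ⟨y, hy⟩ => ⟨y, by ext z : 1; exact hy z⟩, fun ⟨y, hy⟩ => ⟨y, fun z => by rw [hy]; rfl⟩⟩

theorem mem_adE_iff {d : AddMonoid.End (Infty E)} :
    d ∈ adE E ↔ ∃ x : E.carrier, d = adEnd E (0, 0, 0, x) :=
  ⟨fun ⟨y, hy⟩ => ⟨y, by ext z : 1; exact hy z⟩, fun ⟨y, hy⟩ => ⟨y, fun z => by rw [hy]; rfl⟩⟩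

include hA hι hinj in
theorem ad_eq_innerOn :
    ad E = innerOn (proj E) (ract E) (bracket E) (fun _ => True) := by
  ext d
  rw [mem_ad_iff]
  constructor
  · rintro ⟨y, rfl⟩
    exact ⟨adEnd_mem_derivations E hA hι hinj y, fun _ _ => ⟨y, fun _ _ => rfl⟩⟩
  · rintro ⟨-, h⟩
    obtain ⟨y, hy⟩ := h Set.univ trivial
    exact ⟨y, by ext z : 1; exact hy z (Set.mem_univ z)⟩

theorem adLoc_eq_innerOn :
    adLoc E = innerOn (proj E) (ract E) (bracket E) Set.Finite := by
  ext d
  refine and_congr Iff.rfl ⟨fun h s hs => ?_, fun h s => h s s.finite_toSet⟩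
  obtain ⟨y, hy⟩ := h hs.toFinset
  exact ⟨y, fun z hz => hy z (hs.mem_toFinset.2 hz)⟩

include hA hι hinj in
theorem isLieSubalgebra_ad : IsLieSubalgebra (proj E) (lact E) (ad E) := by
  rw [ad_eq_innerOn E hA hι hinj]
  exact (isSuperAlgebra E hA hι).isLieSubalgebra_innerOn (fun _ _ _ _ => trivial)
    (fun _ _ _ => trivial)

include hA hι in
theorem isLieSubalgebra_adLoc : IsLieSubalgebra (proj E) (lact E) (adLoc E) := by
  rw [adLoc_eq_innerOn E]
  exact (isSuperAlgebra E hA hι).isLieSubalgebra_innerOn (fun _ _ => Set.Finite.union)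
    (fun f _ h => h.image f)

include hA hι hinj in
theorem sBr_mem_ad {D d : AddMonoid.End (Infty E)} (hD : D ∈ derivations E) (hd : d ∈ ad E) :
    sBr (proj E) D d ∈ ad E := by
  rw [ad_eq_innerOn E hA hι hinj] at hd ⊢
  exact (isSuperAlgebra E hA hι).sBr_mem_innerOn (fun _ _ _ _ => trivial)
    (fun _ _ _ => trivial) hD hd

include hA hι in
theorem sBr_mem_adLoc {D d : AddMonoid.End (Infty E)} (hD : D ∈ derivations E)
    (hd : d ∈ adLoc E) : sBr (proj E) D d ∈ adLoc E := by
  rw [adLoc_eq_innerOn E] at hd ⊢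
  exact (isSuperAlgebra E hA hι).sBr_mem_innerOn (fun _ _ => Set.Finite.union)
    (fun f _ h => h.image f) hD hd

end Infty

end Inner

/-! ### The Lie superalgebra `𝒮` and the map `S ↦ d_{S,0}` -/

section SAlg

variable {A : Type u} {K : Type v} {M : Type w} [Ring A] [Ring K] [AddCommGroup M] [Module A M]
  {𝒜 : ZMod 2 → AddSubgroup A} [GradedRing 𝒜]
  {ℳ : ZMod 2 → AddSubgroup M} [DirectSum.Decomposition ℳ] [SetLike.GradedSMul 𝒜 ℳ]
  {ι : K →+* A} {q : SuperForm 𝒜 ℳ} (E : OspSubalgebra ι q)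
  {𝒦 : ZMod 2 → AddSubgroup K} [GradedRing 𝒦]

/-- Left multiplication by elements of `A` can be pulled out of superbrackets with elements of
`End_A M`. -/
theorem sBr_lmul_mul (c : A) (S : AddMonoid.End M) {x : AddMonoid.End M} (hx : x ∈ endA 𝒜 ℳ) :
    sBr (pr ℳ) (lmul M c * S) x = lmul M c * sBr (pr ℳ) S x := by
  have G := isGrading_pr ℳ
  have key : ∀ κ, ∀ c ∈ 𝒜 κ, ∀ α β, sBr (pr ℳ) (lmul M c * endComp (pr ℳ) α S)
      (endComp (pr ℳ) β x) =
      lmul M c * sBr (pr ℳ) (endComp (pr ℳ) α S) (endComp (pr ℳ) β x) := by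
    intro κ c hc α β
    have hS := hasDegree_endComp G α S
    have hx' := hasDegree_endComp G β x
    rw [sBr_of_hasDegree G ((hasDegree_lmul hc).mul hS) hx', sBr_of_hasDegree G hS hx']
    ext m
    simp only [end_sub_apply, end_zsmul_apply, end_mul_apply, lmul_apply, smul_sub,
      endA_map_smul (endComp_mem_endA hx β) hx' hc]
    rw [kos_add_left, kos_comm β κ, mul_comm, mul_smul, kos_smul_smul, smul_comm c]
  have e : sBr (pr ℳ) (lmul M (pr 𝒜 0 c + pr 𝒜 1 c) * (endComp (pr ℳ) 0 S + endComp (pr ℳ) 1 S))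
      (endComp (pr ℳ) 0 x + endComp (pr ℳ) 1 x) =
      lmul M (pr 𝒜 0 c + pr 𝒜 1 c) * sBr (pr ℳ) (endComp (pr ℳ) 0 S + endComp (pr ℳ) 1 S)
        (endComp (pr ℳ) 0 x + endComp (pr ℳ) 1 x) := by
    simp only [lmul_add, add_mul, mul_add, sBr_add_left, sBr_add_right, key _ _ (pr_mem 𝒜 _ c)]
  rwa [pr_add_pr, endComp_add_endComp G, endComp_add_endComp G] at e

variable (hA : IsSupercommutative 𝒜) (hι : ∀ i, ∀ k ∈ 𝒦 i, ι k ∈ 𝒜 i)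
  (hinj : Function.Injective (lmul M : A → AddMonoid.End M))

include hA in
theorem IsAlong.lmul_mul {α κ : ZMod 2} {S : AddMonoid.End M} {Δ : AddMonoid.End A}
    (h : IsAlong q α S Δ) {c : A} (hc : c ∈ 𝒜 κ) :
    IsAlong q (κ + α) (lmul M c * S) (lmul A c * Δ) where
  deg := (hasDegree_lmul hc).mul h.deg
  sBr_lmul a := by
    rw [sBr_lmul_mul c S (lmul_mem_endA hA a), h.sBr_lmul, ← OspDer.lmul_mul]
    rfl
  form i j m n hm hn := by
    simp only [end_mul_apply, lmul_apply, h.form i j m n hm hn, q.smul_left hA, smul_eq_mul,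
      mul_add, mul_smul_comm]

include hinj in
/-- On a faithful module, `𝒮_α` consists of the `K`-linear superderivations of `(M, q)` that
normalize `ℰ`. -/
theorem mem_sHom_iff {α : ZMod 2} {S : AddMonoid.End M} :
    S ∈ sHom E α ↔ S ∈ endK 𝒜 ℳ ι ∧ (∃ Δ, IsAlong q α S Δ) ∧
      ∀ x ∈ E.carrier, sBr (pr ℳ) S x ∈ E.carrier := by
  constructor
  · rintro ⟨h1, h2, h3, h4, h5⟩
    choose Δ hΔ using h3
    refine ⟨h1, ⟨AddMonoidHom.mk' Δ ?_, h2, hΔ, fun i j m n hm hn => ?_⟩, h5⟩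
    · intro a b
      apply hinj
      rw [← hΔ, lmul_add, sBr_add_right, hΔ, hΔ, lmul_add]
    · apply hinj
      exact (hΔ _).symm.trans (h4 i j m n hm hn)
  · rintro ⟨h1, ⟨Δ, hΔ⟩, h5⟩
    refine ⟨h1, hΔ.deg, fun a => ⟨Δ a, hΔ.sBr_lmul a⟩, fun i j m n hm hn => ?_, h5⟩
    rw [hΔ.sBr_lmul, hΔ.form i j m n hm hn]

theorem mul_lmul_mem_endK (hA : IsSupercommutative 𝒜) {S : AddMonoid.End M}
    (hS : S ∈ endK 𝒜 ℳ ι) (c : A) : lmul M c * S ∈ endK 𝒜 ℳ ι := fun m k => by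
  rw [end_mul_apply, hS, end_mul_apply]
  exact lmul_rsmul hA c _ _

/-- `End_K M` as an additive group. -/
def endKSubgroup (𝒜 : ZMod 2 → AddSubgroup A) [GradedRing 𝒜]
    (ℳ : ZMod 2 → AddSubgroup M) [DirectSum.Decomposition ℳ] (ι : K →+* A) :
    AddSubgroup (AddMonoid.End M) where
  carrier := endK 𝒜 ℳ ι
  zero_mem' := fun m a => by simp
  add_mem' := fun {f g} hf hg m a => by
    simp [rsmul_add_left, hf m a, hg m a]
  neg_mem' := fun {f} hf m a => by
    simp [rsmul_neg_left, hf m a]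

theorem sBr_mem_endK {α β : ZMod 2} {f g : AddMonoid.End M} (hf : f ∈ endK 𝒜 ℳ ι)
    (hg : g ∈ endK 𝒜 ℳ ι) (hfd : HasDegree (pr ℳ) α f) (hgd : HasDegree (pr ℳ) β g) :
    sBr (pr ℳ) f g ∈ endK 𝒜 ℳ ι := by
  rw [sBr_of_hasDegree (isGrading_pr ℳ) hfd hgd]
  refine (endKSubgroup 𝒜 ℳ ι).sub_mem (fun m k => ?_)
    ((endKSubgroup 𝒜 ℳ ι).zsmul_mem (fun m k => ?_) _)
  · rw [end_mul_apply, end_mul_apply, hg, hf]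
  · rw [end_mul_apply, end_mul_apply, hf, hg]

theorem IsAlong.neg {α : ZMod 2} {S : AddMonoid.End M} {Δ : AddMonoid.End A}
    (h : IsAlong q α S Δ) : IsAlong q α (-S) (-Δ) where
  deg := h.deg.neg
  sBr_lmul a := by rw [sBr_neg_left, h.sBr_lmul, ← lmul_neg]; rfl
  form i j m n hm hn := by
    simp only [end_neg_apply, h.form i j m n hm hn, map_neg, AddMonoidHom.neg_apply, smul_neg]
    abel

theorem IsAlong.zero (α : ZMod 2) : IsAlong q α 0 0 where
  deg := HasDegree.zero α
  sBr_lmul a := by rw [sBr_zero_left]; exact lmul_zero.symm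
  form i j m n hm hn := by simp

/-- `𝒮_α` as an additive group. -/
def sPart (α : ZMod 2) : AddSubgroup (AddMonoid.End M) where
  carrier := sHom E α
  zero_mem' := (mem_sHom_iff E hinj).2 ⟨(endKSubgroup 𝒜 ℳ ι).zero_mem, ⟨0, IsAlong.zero α⟩,
    fun x _ => by rw [sBr_zero_left]; exact E.carrier.zero_mem⟩
  add_mem' := by
    intro f g hf hg
    obtain ⟨h1, ⟨Δ, h2⟩, h3⟩ := (mem_sHom_iff E hinj).1 hf
    obtain ⟨h1', ⟨Δ', h2'⟩, h3'⟩ := (mem_sHom_iff E hinj).1 hg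
    refine (mem_sHom_iff E hinj).2 ⟨(endKSubgroup 𝒜 ℳ ι).add_mem h1 h1', ⟨_, h2.add h2'⟩,
      fun x hx => ?_⟩
    rw [sBr_add_left]
    exact E.carrier.add_mem (h3 x hx) (h3' x hx)
  neg_mem' := by
    intro f hf
    obtain ⟨h1, ⟨Δ, h2⟩, h3⟩ := (mem_sHom_iff E hinj).1 hf
    refine (mem_sHom_iff E hinj).2 ⟨(endKSubgroup 𝒜 ℳ ι).neg_mem h1, ⟨_, h2.neg⟩,
      fun x hx => ?_⟩
    rw [sBr_neg_left]
    exact E.carrier.neg_mem (h3 x hx)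

theorem sPart_deg : ∀ α, ∀ f ∈ sPart E hinj α, HasDegree (pr ℳ) α f := fun _ _ hf => hf.2.1

theorem sAlg_eq : sAlg E = (sPart E hinj 0 : Set (AddMonoid.End M)) + sPart E hinj 1 := rfl

include hinj in
theorem mem_sAlg_iff {S : AddMonoid.End M} :
    S ∈ sAlg E ↔ ∀ α, endComp (pr ℳ) α S ∈ sHom E α := by
  rw [sAlg_eq E hinj]
  exact mem_add_parts (isGrading_pr ℳ) (sPart_deg E hinj)

include hinj in
theorem sHom_subset_sAlg (α : ZMod 2) : sHom E α ⊆ sAlg E := fun _ hS =>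
  mem_add_parts_of_mem (isGrading_pr ℳ) (sPart_deg E hinj) (α := α) hS

include hA hι hinj in
/-- `𝒮` is a Lie superalgebra. -/
theorem isLieSubalgebra_sAlg :
    IsLieSubalgebra (pr ℳ) (fun k : K => lmul M (ι k)) (sAlg E) := by
  have G := isGrading_pr ℳ
  rw [sAlg_eq E hinj]
  refine isLieSubalgebra_parts 𝒦 G (fun k k' => by rw [map_add, lmul_add])
    (sPart_deg E hinj) ?_ ?_
  · intro κ k hk α f hf
    obtain ⟨h1, ⟨Δ, h2⟩, h3⟩ := (mem_sHom_iff E hinj).1 hf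
    refine (mem_sHom_iff E hinj).2 ⟨mul_lmul_mem_endK hA h1 _, ⟨_, h2.lmul_mul hA (hι κ k hk)⟩,
      fun x hx => ?_⟩
    rw [sBr_lmul_mul _ f (E.le_osp x hx).1]
    exact E.smul_mem k _ (h3 x hx)
  · intro α f hf β g hg
    obtain ⟨h1, ⟨Δ, h2⟩, h3⟩ := (mem_sHom_iff E hinj).1 hf
    obtain ⟨h1', ⟨Δ', h2'⟩, h3'⟩ := (mem_sHom_iff E hinj).1 hg
    refine (mem_sHom_iff E hinj).2 ⟨sBr_mem_endK h1 h1' h2.deg h2'.deg, ⟨_, h2.sBr h2'⟩,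
      fun x hx => ?_⟩
    have key : ∀ γ, sBr (pr ℳ) (sBr (pr ℳ) f g) (endComp (pr ℳ) γ x) ∈ E.carrier := by
      intro γ
      have hc := E.comp_mem γ x hx
      have := sBr_jacobi G h2.deg h2'.deg (hasDegree_endComp G γ x)
      rw [← sub_eq_iff_eq_add] at this
      rw [← this]
      exact E.carrier.sub_mem (h3 _ (h3' _ hc)) (E.carrier.zsmul_mem (h3' _ (h3 _ hc)) _)
    rw [← endComp_add_endComp G x, sBr_add_right]
    exact E.carrier.add_mem (key 0) (key 1)

include hinj in
theorem mem_sAlg_of_mem {x : AddMonoid.End M} (hx : x ∈ E.carrier) : x ∈ sAlg E := by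
  have G := isGrading_pr ℳ
  refine (mem_sAlg_iff E hinj).2 fun α => (mem_sHom_iff E hinj).2 ?_
  have hc := E.comp_mem α x hx
  exact ⟨fun m k => (E.le_osp _ hc).1 m (ι k),
    ⟨0, isAlong_of_mem_osp (E.le_osp _ hc) (hasDegree_endComp G α x)⟩,
    fun y hy => E.bracket_mem _ hc _ hy⟩

/-- For every element of `𝒮` there is an endomorphism `Δ` of `A` with `[S, a · id] = Δ(a) · id`. -/
theorem exists_along {S : AddMonoid.End M} (hinj : Function.Injective (lmul M : A → AddMonoid.End M))
    (hS : S ∈ sAlg E) : ∃ Δ : AddMonoid.End A, ∀ a, sBr (pr ℳ) S (lmul M a) = lmul M (Δ a) := by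
  have G := isGrading_pr ℳ
  obtain ⟨-, ⟨Δ, h⟩, -⟩ := (mem_sHom_iff E hinj).1 ((mem_sAlg_iff E hinj).1 hS 0)
  obtain ⟨-, ⟨Δ', h'⟩, -⟩ := (mem_sHom_iff E hinj).1 ((mem_sAlg_iff E hinj).1 hS 1)
  refine ⟨Δ + Δ', fun a => ?_⟩
  rw [← endComp_add_endComp G S, sBr_add_left, h.sBr_lmul, h'.sBr_lmul, ← lmul_add]
  rfl

include hinj in
theorem sAlg_normalizes {S : AddMonoid.End M} (hS : S ∈ sAlg E) :
    ∀ x ∈ E.carrier, sBr (pr ℳ) S x ∈ E.carrier := by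
  intro x hx
  have G := isGrading_pr ℳ
  have h0 := ((mem_sHom_iff E hinj).1 ((mem_sAlg_iff E hinj).1 hS 0)).2.2
  have h1 := ((mem_sHom_iff E hinj).1 ((mem_sAlg_iff E hinj).1 hS 1)).2.2
  rw [← endComp_add_endComp G S, sBr_add_left]
  exact E.carrier.add_mem (h0 x hx) (h1 x hx)

include hinj in
theorem exists_isD {S : AddMonoid.End M} (hS : S ∈ sAlg E) :
    ∃ d : AddMonoid.End (Infty E), IsD E S 0 d := by
  obtain ⟨Δ, hΔ⟩ := exists_along E hinj hS
  have h3 := sAlg_normalizes E hinj hS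
  refine ⟨AddMonoidHom.mk' (fun y => (Δ y.1, S y.2.1, S y.2.2.1,
    ⟨sBr (pr ℳ) S y.2.2.2, h3 _ y.2.2.2.2⟩)) fun y z => ?_,
    (isD_iff E hinj hΔ).2 fun y => ⟨rfl, rfl, rfl, rfl⟩⟩
  exact Infty.ext_iff'.2 ⟨map_add Δ _ _, map_add S _ _, map_add S _ _, sBr_add_right _ _ _⟩

include hinj in
theorem IsD.unique {S T : AddMonoid.End M} {d d' : AddMonoid.End (Infty E)} (h : IsD E S T d)
    (h' : IsD E S T d') : d = d' := by
  ext y : 1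
  obtain ⟨a, m, n, x⟩ := y
  obtain ⟨h1, h2, h3, h4⟩ := h a m n x
  obtain ⟨h1', h2', h3', h4'⟩ := h' a m n x
  exact Infty.ext_iff'.2 ⟨hinj (h1.trans h1'.symm), h2.trans h2'.symm, h3.trans h3'.symm,
    h4.trans h4'.symm⟩

open Classical in
/-- The map `S ↦ d_{S,0}`, extended by zero to the endomorphisms for which `d_{S,0}` is not
defined. -/
noncomputable def dMap (S : AddMonoid.End M) : AddMonoid.End (Infty E) :=
  if h : ∃ d, IsD E S 0 d then h.choose else 0

include hinj in
theorem isD_dMap {S : AddMonoid.End M} (hS : S ∈ sAlg E) : IsD E S 0 (dMap E S) := by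
  have h := exists_isD E hinj hS
  rw [dMap, dif_pos h]
  exact h.choose_spec

include hinj in
theorem isD_iff_eq_dMap {S : AddMonoid.End M} (hS : S ∈ sAlg E) (d : AddMonoid.End (Infty E)) :
    IsD E S 0 d ↔ d = dMap E S :=
  ⟨fun h => h.unique E hinj (isD_dMap E hinj hS), fun h => h ▸ isD_dMap E hinj hS⟩

theorem zero_mem_tHom (α : ZMod 2) : (0 : AddMonoid.End M) ∈ tHom E α := by
  refine ⟨(endKSubgroup 𝒜 ℳ ι).zero_mem, HasDegree.zero α, fun a => ?_, fun i j m n _ _ => ?_,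
    fun x _ => ⟨0, ?_⟩⟩
  · rw [sBr_zero_left]; exact E.carrier.zero_mem
  · rw [sBr_zero_left, end_zero_apply, end_zero_apply, elem_zero_left, elem_zero_left]
    ext; simp
  · rw [sBr_zero_left, lmul_zero]

include hinj in
theorem dMap_mem_dAlg {S : AddMonoid.End M} (hS : S ∈ sAlg E) : dMap E S ∈ dAlg E :=
  ⟨S, hS, 0, ⟨0, zero_mem_tHom E 0, 0, zero_mem_tHom E 1, add_zero 0⟩, isD_dMap E hinj hS⟩

include hinj in
theorem dSet_eq {X : Set (AddMonoid.End M)} (hX : X ⊆ sAlg E) : dSet E X = dMap E '' X := by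
  ext d
  constructor
  · rintro ⟨-, S, hS, h⟩
    exact ⟨S, hS, ((isD_iff_eq_dMap E hinj (hX hS) d).1 h).symm⟩
  · rintro ⟨S, hS, rfl⟩
    exact ⟨dMap_mem_dAlg E hinj (hX hS), S, hS, isD_dMap E hinj (hX hS)⟩

include hinj in
theorem dMap_add {S S' : AddMonoid.End M} (hS : S ∈ sAlg E) (hS' : S' ∈ sAlg E)
    (hSS : S + S' ∈ sAlg E) : dMap E (S + S') = dMap E S + dMap E S' := by
  symm
  rw [← isD_iff_eq_dMap E hinj hSS]
  have h := isD_dMap E hinj hS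
  have h' := isD_dMap E hinj hS'
  intro a m n x
  obtain ⟨h1, h2, h3, h4⟩ := h a m n x
  obtain ⟨h1', h2', h3', h4'⟩ := h' a m n x
  rw [sBr_zero_left] at h1 h1' h4 h4' ⊢
  rw [sBr_zero_left, sBr_add_left, sBr_add_left]
  refine ⟨?_, ?_, ?_, ?_⟩
  · show lmul M ((dMap E S (a, m, n, x)).1 + (dMap E S' (a, m, n, x)).1) = _
    rw [lmul_add, h1, h1']; abel
  · show (dMap E S (a, m, n, x)).2.1 + (dMap E S' (a, m, n, x)).2.1 = _
    rw [h2, h2', add_zero, add_zero, add_zero]; rfl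
  · show (dMap E S (a, m, n, x)).2.2.1 + (dMap E S' (a, m, n, x)).2.2.1 = _
    rw [h3, h3', sub_zero, sub_zero, sub_zero]; rfl
  · show ((dMap E S (a, m, n, x)).2.2.2 : AddMonoid.End M) + (dMap E S' (a, m, n, x)).2.2.2 = _
    rw [h4, h4']; abel

include hι hinj in
theorem dMap_mem_derHom {α : ZMod 2} {S : AddMonoid.End M} (hS : S ∈ sHom E α) :
    dMap E S ∈ derHom (Infty.proj E) (Infty.ract E) (Infty.bracket E) α := by
  obtain ⟨h1, ⟨Δ, h2⟩, -⟩ := (mem_sHom_iff E hinj).1 hS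
  exact Infty.isD_mem_derHom E hinj hι h2 h1 (isD_dMap E hinj (sHom_subset_sAlg E hinj α hS))

include hA hι hinj in
theorem dMap_mem_derivations {S : AddMonoid.End M} (hS : S ∈ sAlg E) :
    dMap E S ∈ Infty.derivations E := by
  have h := (mem_sAlg_iff E hinj).1 hS
  have h' := fun α => sHom_subset_sAlg E hinj α (h α)
  have e := endComp_add_endComp (isGrading_pr ℳ) S
  rw [← e, dMap_add E hinj (h' 0) (h' 1) (e.symm ▸ hS)]
  exact Set.add_mem_add (dMap_mem_derHom E hι hinj (h 0)) (dMap_mem_derHom E hι hinj (h 1))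

include hA hι hinj in
/-- `S ↦ d_{S,0}` is a monomorphism of Lie superalgebras on every subalgebra of `𝒮`. -/
theorem isLieMono_dMap {X : Set (AddMonoid.End M)}
    (hX : IsLieSubalgebra (pr ℳ) (fun k : K => lmul M (ι k)) X) (hXS : X ⊆ sAlg E) :
    IsLieMono (pr ℳ) (fun k : K => lmul M (ι k)) (Infty.proj E) (Infty.lact E) X (dMap E) := by
  have G := isGrading_pr ℳ
  have G' := Infty.isGrading_proj E
  have comp : ∀ α, ∀ f ∈ sAlg E,
      dMap E (endComp (pr ℳ) α f) = endComp (Infty.proj E) α (dMap E f) := by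
    intro α f hf
    have h := (mem_sAlg_iff E hinj).1 hf
    have h' := fun α => sHom_subset_sAlg E hinj α (h α)
    have e := endComp_add_endComp (isGrading_pr ℳ) f
    conv_rhs => rw [← e, dMap_add E hinj (h' 0) (h' 1) (e.symm ▸ hf), endComp_add]
    have d0 := (dMap_mem_derHom E hι hinj (h 0)).1
    have d1 := (dMap_mem_derHom E hι hinj (h 1)).1
    rcases zmod_two_cases α with rfl | rfl
    · rw [endComp_of_hasDegree G' d0, endComp_of_ne G' d1 (by decide), add_zero]
    · rw [endComp_of_hasDegree G' d1, endComp_of_ne G' d0 (by decide), zero_add]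
  refine ⟨hX, ?_, ?_, ?_, fun α f hf => comp α f (hXS hf), ?_⟩
  · intro S hS S' hS' h
    ext m
    have h1 := (isD_dMap E hinj (hXS hS) 0 m 0 0).2.1
    have h2 := (isD_dMap E hinj (hXS hS') 0 m 0 0).2.1
    have h0 : dMap E S = dMap E S' := h
    rw [h0, h2, add_zero, add_zero] at h1
    exact h1.symm
  · exact fun f hf g hg => dMap_add E hinj (hXS hf) (hXS hg) (hXS (hX.add_mem f hf g hg))
  · intro k f hf
    symm
    show Infty.lact E k * dMap E f = dMap E (lmul M (ι k) * f)
    rw [← isD_iff_eq_dMap E hinj (hXS (hX.smul_mem k f hf))]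
    intro a m n x
    obtain ⟨h1, h2, h3, h4⟩ := isD_dMap E hinj (hXS hf) a m n x
    rw [sBr_zero_left] at h1 h4
    rw [sBr_zero_left, sBr_zero_left, sBr_lmul_mul _ _ (lmul_mem_endA hA a),
      sBr_lmul_mul _ _ (E.le_osp _ x.2).1]
    rw [add_zero] at h1 h2
    rw [sub_zero] at h3
    rw [zero_add] at h4
    rw [add_zero, add_zero, sub_zero, zero_add]
    refine ⟨?_, ?_, ?_, ?_⟩
    · show lmul M (ι k * (dMap E f (a, m, n, x)).1) = _
      rw [lmul_mul, h1]
    · show ι k • (dMap E f (a, m, n, x)).2.1 = _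
      rw [h2]; rfl
    · show ι k • (dMap E f (a, m, n, x)).2.2.1 = _
      rw [h3]; rfl
    · show lmul M (ι k) * ((dMap E f (a, m, n, x)).2.2.2 : AddMonoid.End M) = _
      rw [h4]
  · have hSL := isLieSubalgebra_sAlg E hA hι hinj
    have key : ∀ α β, ∀ f ∈ sHom E α, ∀ g ∈ sHom E β,
        dMap E (sBr (pr ℳ) f g) = sBr (Infty.proj E) (dMap E f) (dMap E g) := by
      intro α β f hf g hg
      have hfS := sHom_subset_sAlg E hinj α hf
      have hgS := sHom_subset_sAlg E hinj β hg
      obtain ⟨-, ⟨Δ, h2⟩, -⟩ := (mem_sHom_iff E hinj).1 hf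
      obtain ⟨-, ⟨Δ', h2'⟩, -⟩ := (mem_sHom_iff E hinj).1 hg
      have F := (isD_iff E hinj h2.sBr_lmul).1 (isD_dMap E hinj hfS)
      have F' := (isD_iff E hinj h2'.sBr_lmul).1 (isD_dMap E hinj hgS)
      symm
      rw [← isD_iff_eq_dMap E hinj (hSL.bracket_mem f hfS g hgS),
        isD_iff E hinj (h2.sBr h2').sBr_lmul,
        sBr_of_hasDegree G' (dMap_mem_derHom E hι hinj hf).1 (dMap_mem_derHom E hι hinj hg).1]
      intro y
      obtain ⟨a1, a2, a3, a4⟩ := F y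
      obtain ⟨b1, b2, b3, b4⟩ := F' y
      obtain ⟨c1, c2, c3, c4⟩ := F (dMap E g y)
      obtain ⟨d1, d2, d3, d4⟩ := F' (dMap E f y)
      refine ⟨?_, ?_, ?_, ?_⟩
      · show (dMap E f (dMap E g y)).1 - kos α β • (dMap E g (dMap E f y)).1 = _
        rw [c1, d1, a1, b1]; rfl
      · show (dMap E f (dMap E g y)).2.1 - kos α β • (dMap E g (dMap E f y)).2.1 = _
        rw [c2, d2, a2, b2, sBr_of_hasDegree G h2.deg h2'.deg]; rfl
      · show (dMap E f (dMap E g y)).2.2.1 - kos α β • (dMap E g (dMap E f y)).2.2.1 = _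
        rw [c3, d3, a3, b3, sBr_of_hasDegree G h2.deg h2'.deg]; rfl
      · show ((dMap E f (dMap E g y)).2.2.2 : AddMonoid.End M) -
          kos α β • ((dMap E g (dMap E f y)).2.2.2 : AddMonoid.End M) = _
        rw [c4, d4, a4, b4]
        generalize (y.2.2.2 : AddMonoid.End M) = x
        have J := fun γ => sBr_jacobi G h2.deg h2'.deg (hasDegree_endComp G γ x)
        rw [← endComp_add_endComp G x]
        simp only [sBr_add_right, J, end_zsmul_add]
        abel
    intro f hf g hg
    have hf' := (mem_sAlg_iff E hinj).1 (hXS hf)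
    have hg' := (mem_sAlg_iff E hinj).1 (hXS hg)
    have m1 := fun α => sHom_subset_sAlg E hinj α (hf' α)
    have m2 := fun α => sHom_subset_sAlg E hinj α (hg' α)
    have m12 := fun α β => hSL.bracket_mem _ (m1 α) _ (m2 β)
    conv_rhs => rw [sBr_comp_comp G']
    rw [sBr_comp_comp G]
    simp only [← comp _ f (hXS hf), ← comp _ g (hXS hg), ← key _ _ _ (hf' _) _ (hg' _)]
    rw [show (Finset.univ : Finset (ZMod 2)) = {0, 1} from by decide,
      Finset.sum_pair (by decide), Finset.sum_pair (by decide), Finset.sum_pair (by decide),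
      Finset.sum_pair (by decide), Finset.sum_pair (by decide), Finset.sum_pair (by decide)]
    have p0 := hSL.add_mem _ (m12 0 0) _ (m12 0 1)
    have p1 := hSL.add_mem _ (m12 1 0) _ (m12 1 1)
    rw [dMap_add E hinj p0 p1 (hSL.add_mem _ p0 _ p1),
      dMap_add E hinj (m12 0 0) (m12 0 1) p0, dMap_add E hinj (m12 1 0) (m12 1 1) p1]

end SAlg

/-! ### The superspace `𝒯` consists of scalar multiplications -/

section Frame

variable {A : Type u} {M : Type w} [Ring A] [AddCommGroup M] [Module A M]
  {𝒜 : ZMod 2 → AddSubgroup A} [GradedRing 𝒜]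
  {ℳ : ZMod 2 → AddSubgroup M} [DirectSum.Decomposition ℳ] {q : SuperForm 𝒜 ℳ}

theorem eq_zero_of_isUnit_smul {u : A} (hu : IsUnit u) {m : M} (h : u • m = 0) : m = 0 :=
  hu.smul_left_cancel.1 (h.trans (smul_zero u).symm)

theorem eq_zero_of_add_self (h2 : IsUnit (2 : A)) {m : M} (h : m + m = 0) : m = 0 :=
  eq_zero_of_isUnit_smul h2 ((two_smul A m).trans h)

theorem eq_zero_of_kos_mul_smul {i j i' j' : ZMod 2} {m : M}
    (h : (kos i j * kos i' j') • m = 0) : m = 0 := by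
  rw [mul_smul] at h
  rcases kos_eq_or i j with h1 | h1 <;> rcases kos_eq_or i' j' with h2 | h2 <;>
    simpa [h1, h2] using h

/-- A homogeneous unit is even, because odd elements square to zero. -/
theorem even_of_isUnit (hA : IsSupercommutative 𝒜) (h2 : IsUnit (2 : A)) {u : A} (hu : IsUnit u)
    (h : ∃ α, u ∈ 𝒜 α) : u ∈ 𝒜 0 := by
  obtain ⟨α, h⟩ := h
  rcases zmod_two_cases α with rfl | rfl
  · exact h
  have h1 : u * u = 0 := by
    have h1 := hA 1 1 u u h h
    rw [kos_one_one, neg_smul, one_smul] at h1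
    exact eq_zero_of_add_self h2 (add_eq_zero_iff_eq_neg.2 h1)
  have h3 : u = 0 := eq_zero_of_isUnit_smul hu h1
  rw [h3]
  exact (𝒜 0).zero_mem

theorem eq_zero_of_mem_of_mem {x : M} (h0 : x ∈ ℳ 0) (h1 : x ∈ ℳ 1) : x = 0 :=
  (pr_of_mem h0).symm.trans (pr_of_mem_ne h1 (by decide))

/-- The inverse of an even unit is even. -/
theorem inverse_mem {u : A} (hu : IsUnit u) (h : u ∈ 𝒜 0) : Ring.inverse u ∈ 𝒜 0 := by
  set v := Ring.inverse u with hv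
  have e : u * pr 𝒜 0 v + u * pr 𝒜 1 v = 1 := by
    rw [← mul_add, pr_add_pr, hv, Ring.mul_inverse_cancel u hu]
  have h0 : u * pr 𝒜 0 v ∈ 𝒜 0 := by simpa using mul_mem_deg h (pr_mem 𝒜 0 v)
  have h1 : u * pr 𝒜 1 v ∈ 𝒜 1 := by simpa using mul_mem_deg h (pr_mem 𝒜 1 v)
  have h3 : u * pr 𝒜 1 v = 0 := by
    refine eq_zero_of_mem_of_mem (ℳ := 𝒜) ?_ h1
    rw [eq_sub_of_add_eq' e]
    exact (𝒜 0).sub_mem (SetLike.GradedOne.one_mem) h0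
  have h4 : pr 𝒜 1 v = 0 := eq_zero_of_isUnit_smul hu h3
  have := pr_add_pr 𝒜 v
  rw [h4, add_zero] at this
  exact pr_eq_iff.1 this

theorem half_smul_add_self {N : Type*} [AddCommGroup N] [Module A N] (h2 : IsUnit (2 : A))
    (m : N) : Ring.inverse (2 : A) • (m + m) = m := by
  rw [← two_smul A m, ← mul_smul, Ring.inverse_mul_cancel _ h2, one_smul]

theorem eq_of_add_self_eq {N : Type*} [AddCommGroup N] [Module A N] (h2 : IsUnit (2 : A))
    {m n : N} (h : m + m = n + n) : m = n := by
  rw [← half_smul_add_self h2 m, h, half_smul_add_self h2]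

theorem half_mem (h2 : IsUnit (2 : A)) : Ring.inverse (2 : A) ∈ 𝒜 0 := by
  refine inverse_mem h2 ?_
  have h := add_mem (SetLike.GradedOne.one_mem (A := 𝒜)) (SetLike.GradedOne.one_mem (A := 𝒜))
  rwa [one_add_one_eq_two] at h

/-- Three orthogonal vectors as supplied by a basis of more than two elements: two even
anisotropic ones and a homogeneous one without annihilator. -/
structure IsFrame (q : SuperForm 𝒜 ℳ) (n₁ n₂ p : M) (π : ZMod 2) : Prop where
  even₁ : n₁ ∈ ℳ 0
  even₂ : n₂ ∈ ℳ 0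
  hom : p ∈ ℳ π
  unit₁ : IsUnit (q.toFun n₁ n₁)
  unit₂ : IsUnit (q.toFun n₂ n₂)
  orth : q.toFun n₁ n₂ = 0
  orth₁ : q.toFun n₁ p = 0
  orth₂ : q.toFun n₂ p = 0
  free : ∀ c : A, c • p = 0 → c = 0

theorem SuperForm.comm_even (q : SuperForm 𝒜 ℳ) {m : M} (hm : m ∈ ℳ 0) (n : M) :
    q.toFun m n = q.toFun n m := by
  refine induction_deg ℳ (P := fun n => q.toFun m n = q.toFun n m) (fun x y hx hy => ?_)
    (fun j n hn => ?_) n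
  · rw [map_add, map_add, hx, hy]; rfl
  · rw [q.supersymm 0 j m n hm hn, kos_zero_left, one_smul]

theorem SuperForm.eq_zero_comm (q : SuperForm 𝒜 ℳ) {i j : ZMod 2} {m n : M} (hm : m ∈ ℳ i)
    (hn : n ∈ ℳ j) (h : q.toFun m n = 0) : q.toFun n m = 0 := by
  rw [q.supersymm _ _ _ _ hn hm, h, smul_zero]

theorem IsFrame.symm {n₁ n₂ p : M} {π : ZMod 2} (h : IsFrame q n₁ n₂ p π) :
    IsFrame q n₂ n₁ p π :=
  ⟨h.even₂, h.even₁, h.hom, h.unit₂, h.unit₁, q.eq_zero_comm h.even₁ h.even₂ h.orth, h.orth₂,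
    h.orth₁, h.free⟩

variable [SetLike.GradedSMul 𝒜 ℳ] (hA : IsSupercommutative 𝒜)

include hA in
theorem IsFrame.free₁ {n₁ n₂ p : M} {π : ZMod 2} (h : IsFrame q n₁ n₂ p π) {c : A}
    (hc : c • n₁ = 0) : c = 0 := by
  have := q.smul_left hA c n₁ n₁
  rw [hc, map_zero, AddMonoidHom.zero_apply] at this
  exact h.unit₁.mul_left_eq_zero.1 this.symm

theorem elem_apply_even (q : SuperForm 𝒜 ℳ) {i j : ZMod 2} {m n p : M} (hm : m ∈ ℳ i)
    (hn : n ∈ ℳ j) (hp : p ∈ ℳ 0) :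
    elem q m n p = kos i j • (q.toFun n p • m) - q.toFun m p • n := by
  rw [elem_apply q hm hn hp, kos_zero_right, kos_zero_right, mul_one, one_smul]

variable {τ : ZMod 2} {T : AddMonoid.End M} {n₁ n₂ p : M} {π : ZMod 2}
  (F : IsFrame q n₁ n₂ p π) (hd : HasDegree (pr ℳ) τ T)
  (hT : ∀ i j m n, m ∈ ℳ i → n ∈ ℳ j → q.toFun m n = 0 →
    elem q (T m) n + kos i j • elem q (T n) m = 0)
  (hE : ∀ m n, ∃ c : A, sBr (pr ℳ) T (elem q m n) = lmul M c)

include F hd hT in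
/-- For `w` orthogonal to `n₂`, the relation for `w` and `n₂`, evaluated at `n₂`, determines `T w` up
to a multiple of `n₂`. -/
theorem IsFrame.unit_smul_map {k : ZMod 2} {w : M} (hw : w ∈ ℳ k) (h : q.toFun w n₂ = 0) :
    q.toFun n₂ n₂ • T w = q.toFun (T n₂) n₂ • w + q.toFun (T w) n₂ • n₂ := by
  have h1 := DFunLike.congr_fun (hT k 0 w n₂ hw F.even₂ h) n₂
  rw [kos_zero_right, one_smul, end_add_apply, end_zero_apply,
    elem_apply_even q (hd.mem hw) F.even₂ F.even₂, elem_apply_even q (hd.mem F.even₂) hw F.even₂,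
    h, kos_zero_right, one_smul, zero_smul, smul_zero, zero_sub] at h1
  rw [← sub_eq_zero, ← h1]
  abel

include hA F hd hT hE in
/-- The scalar `[T, E_{n₂,p}]` maps `n₁` to a multiple of `p` with coefficient `q(T n₁, n₂)`, up to
sign. Pairing with `n₁` shows that this scalar vanishes, hence so does the coefficient. -/
theorem IsFrame.map_orth : q.toFun (T n₁) n₂ = 0 := by
  have h1 := F.unit_smul_map hd hT F.even₁ F.orth
  obtain ⟨c, hc⟩ := hE n₂ p
  have hpn := q.eq_zero_comm F.even₁ F.hom F.orth₁
  have h2 : q.toFun (T n₁) p = 0 := by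
    refine eq_zero_of_isUnit_smul F.unit₂ ?_
    rw [smul_eq_mul, ← q.smul_left hA, h1, map_add, AddMonoidHom.add_apply, q.smul_left hA,
      q.smul_left hA, F.orth₁, F.orth₂, mul_zero, mul_zero, add_zero]
  have h3 := q.eq_zero_comm (hd.mem F.even₁) F.hom h2
  have h4 := DFunLike.congr_fun hc n₁
  rw [sBr_of_hasDegree (isGrading_pr ℳ) hd (hasDegree_elem q F.even₂ F.hom)] at h4
  simp only [end_sub_apply, end_zsmul_apply, end_mul_apply] at h4
  rw [elem_apply q F.even₂ F.hom F.even₁, elem_apply q F.even₂ F.hom (hd.mem F.even₁), hpn, h3,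
    F.symm.orth, q.comm_even F.even₂] at h4
  simp only [zero_smul, smul_zero, sub_zero, map_zero, zero_sub, smul_neg, neg_neg,
    lmul_apply] at h4
  have h5 : c = 0 := by
    refine F.unit₁.mul_left_eq_zero.1 ?_
    rw [← q.smul_left hA, ← h4]
    simp only [map_zsmul, AddMonoidHom.coe_smul, Pi.smul_apply, q.smul_left hA, hpn, mul_zero,
      smul_zero]
  rw [h5, zero_smul, smul_smul] at h4
  refine F.free _ (eq_zero_of_kos_mul_smul h4)

include hA F hd hT hE in
theorem IsFrame.smul_map_of_orth {k : ZMod 2} {w : M} (hw : w ∈ ℳ k) (h₁ : q.toFun w n₁ = 0)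
    (h₂ : q.toFun w n₂ = 0) : q.toFun n₂ n₂ • T w = q.toFun (T n₂) n₂ • w := by
  -- the relation for `w` and `n₁`, evaluated at `n₂`, shows that `T w` is orthogonal to `n₂`
  have h3 : q.toFun (T w) n₂ = 0 := by
    have h1 := DFunLike.congr_fun (hT k 0 w n₁ hw F.even₁ h₁) n₂
    rw [kos_zero_right, one_smul, end_add_apply, end_zero_apply,
      elem_apply_even q (hd.mem hw) F.even₁ F.even₂, elem_apply_even q (hd.mem F.even₁) hw F.even₂,
      h₂, F.orth, F.map_orth hA hd hT hE] at h1
    simp only [zero_smul, smul_zero, sub_zero, zero_sub, add_zero, neg_eq_zero] at h1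
    exact F.free₁ hA h1
  rw [F.unit_smul_map hd hT hw h₂, h3, zero_smul, add_zero]

include hA F hd hT hE in
/-- The multiples of `n₁` are not orthogonal to `n₁`, so that the argument for vectors orthogonal to
both `n₁` and `n₂` does not apply; the scalar `[T, E_{n₂,p}] = 0` is used in its place. -/
theorem IsFrame.smul_map_smul {k : ZMod 2} {c : A} (hc : c ∈ 𝒜 k) :
    q.toFun n₂ n₂ • T (c • n₁) = q.toFun (T n₂) n₂ • c • n₁ := by
  have hw : c • n₁ ∈ ℳ k := by simpa using smul_mem_deg hc F.even₁
  have hwo : q.toFun (c • n₁) n₂ = 0 := by rw [q.smul_left hA, F.orth, mul_zero]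
  have hwp : q.toFun (c • n₁) p = 0 := by rw [q.smul_left hA, F.orth₁, mul_zero]
  have h1 := F.unit_smul_map hd hT hw hwo
  obtain ⟨b, hb⟩ := hE n₂ p
  have ev : ∀ {j : ZMod 2} {w : M}, w ∈ ℳ j → q.toFun w n₂ = 0 → q.toFun w p = 0 →
      q.toFun (T w) p = 0 → (kos τ π * kos π (τ + j)) • (q.toFun (T w) n₂ • p) = b • w := by
    intro j w hw hwo hwp hTw
    have h4 := DFunLike.congr_fun hb w
    rw [sBr_of_hasDegree (isGrading_pr ℳ) hd (hasDegree_elem q F.even₂ F.hom)] at h4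
    simp only [end_sub_apply, end_zsmul_apply, end_mul_apply] at h4
    rw [elem_apply q F.even₂ F.hom hw, elem_apply q F.even₂ F.hom (hd.mem hw),
      q.eq_zero_comm hw F.hom hwp, q.comm_even F.even₂ w, hwo,
      q.eq_zero_comm (hd.mem hw) F.hom hTw, q.comm_even F.even₂ (T w)] at h4
    simpa [mul_smul, lmul_apply] using h4
  have orth : ∀ {j : ZMod 2} {w : M}, w ∈ ℳ j → q.toFun w n₂ = 0 → q.toFun w p = 0 →
      q.toFun (T w) p = 0 := by
    intro j w hw hwo hwp
    refine eq_zero_of_isUnit_smul F.unit₂ ?_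
    rw [smul_eq_mul, ← q.smul_left hA, F.unit_smul_map hd hT hw hwo, map_add,
      AddMonoidHom.add_apply, q.smul_left hA, q.smul_left hA, hwp, F.orth₂, mul_zero, mul_zero,
      add_zero]
  have hb0 : b = 0 := by
    refine F.free₁ hA ?_
    rw [← ev F.even₁ F.orth F.orth₁ (orth F.even₁ F.orth F.orth₁), F.map_orth hA hd hT hE,
      zero_smul, smul_zero]
  have h2 := ev hw hwo hwp (orth hw hwo hwp)
  rw [hb0, zero_smul] at h2
  rw [h1, F.free _ (eq_zero_of_kos_mul_smul h2), zero_smul, add_zero]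

include hA F hd hT hE in
/-- On all vectors supplied by a homogeneous basis, `T` is multiplication by the same scalar. -/
theorem IsFrame.exists_scalar : ∃ α ∈ 𝒜 τ, (∀ (k : ZMod 2) (c : A), c ∈ 𝒜 k →
      T (c • n₁) = α • c • n₁ ∧ T (c • n₂) = α • c • n₂) ∧
    ∀ (k : ZMod 2) (w : M), w ∈ ℳ k → q.toFun w n₁ = 0 → q.toFun w n₂ = 0 → T w = α • w := by
  have hu2 := q.degree 0 0 n₂ n₂ F.even₂ F.even₂
  have hu1 := q.degree 0 0 n₁ n₁ F.even₁ F.even₁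
  rw [add_zero] at hu1 hu2
  set u₂ := q.toFun n₂ n₂ with hu
  set u₁ := q.toFun n₁ n₁ with hu'
  have hα := q.degree (τ + 0) 0 _ n₂ (hd.mem F.even₂) F.even₂
  rw [add_zero, add_zero] at hα
  have inv : ∀ {m m' : M}, u₂ • m = q.toFun (T n₂) n₂ • m' →
      m = (Ring.inverse u₂ * q.toFun (T n₂) n₂) • m' := by
    intro m m' h
    rw [mul_smul, ← h, ← mul_smul, Ring.inverse_mul_cancel _ F.unit₂, one_smul]
  -- the scalars obtained from `n₁` and `n₂` agree
  have hn1 : T n₁ = (Ring.inverse u₂ * q.toFun (T n₂) n₂) • n₁ := by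
    have h := F.smul_map_smul hA hd hT hE (SetLike.GradedOne.one_mem (A := 𝒜))
    rw [one_smul] at h
    exact inv h
  have hs : q.toFun (T n₁) n₁ = u₁ * (Ring.inverse u₂ * q.toFun (T n₂) n₂) := by
    rw [hn1, q.smul_left hA, hA.even_comm hu1]
  refine ⟨Ring.inverse u₂ * q.toFun (T n₂) n₂, ?_, fun k c hc => ⟨?_, ?_⟩, fun k w hw h₁ h₂ => ?_⟩
  · simpa using mul_mem_deg (inverse_mem F.unit₂ hu2) hα
  · exact inv (F.smul_map_smul hA hd hT hE hc)
  · have h := F.symm.smul_map_smul hA hd hT hE hc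
    rw [hs, mul_smul u₁] at h
    exact F.unit₁.smul_left_cancel.1 h
  · exact inv (F.smul_map_of_orth hA hd hT hE hw h₁ h₂)

end Frame

/-! ### Decomposition of the derivations of `ℰ_∞` -/

section Decomposition

variable {A : Type u} {K : Type v} {M : Type w} [Ring A] [Ring K] [AddCommGroup M] [Module A M]
  {𝒜 : ZMod 2 → AddSubgroup A} [GradedRing 𝒜]
  {ℳ : ZMod 2 → AddSubgroup M} [DirectSum.Decomposition ℳ] [SetLike.GradedSMul 𝒜 ℳ]
  {ι : K →+* A} {q : SuperForm 𝒜 ℳ} (E : OspSubalgebra ι q)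
  {𝒦 : ZMod 2 → AddSubgroup K} [GradedRing 𝒦]

theorem sBr_lmul_endA {f : AddMonoid.End M} (hf : f ∈ endA 𝒜 ℳ) (a : A) :
    sBr (pr ℳ) (lmul M a) f = 0 := by
  have G := isGrading_pr ℳ
  rw [sBr_comp_comp G]
  refine Finset.sum_eq_zero fun i _ => Finset.sum_eq_zero fun j _ => ?_
  rw [sBr_skew G (hasDegree_endComp G i _) (hasDegree_endComp G j _),
    endComp_lmul (𝒜 := 𝒜), sBr_endA_lmul (endComp_mem_endA hf j)]
  ext; simp

namespace Infty

/-- The bracket with an element of `A ⊕ ℰ`. -/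
theorem bracket_diag (a : A) (x : E.carrier) (z : Infty E) :
    (bracket E (a, 0, 0, x) z).1 = 0 ∧
    (bracket E (a, 0, 0, x) z).2.1 = a • z.2.1 + (x : AddMonoid.End M) z.2.1 ∧
    (bracket E (a, 0, 0, x) z).2.2.1 = -(a • z.2.2.1) + (x : AddMonoid.End M) z.2.2.1 ∧
    ((bracket E (a, 0, 0, x) z).2.2.2 : AddMonoid.End M) = sBr (pr ℳ) x z.2.2.2 := by
  refine ⟨?_, ?_, ?_, ?_⟩
  · simp [bracket]
  · simp [bracket, twApp_zero_right]
  · simp [bracket, twApp_zero_right]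
  · simp [bracket, elem_zero_left]

theorem bracket_unit (z : Infty E) :
    bracket E (1, 0, 0, 0) z = (0, z.2.1, -z.2.2.1, 0) := by
  obtain ⟨h1, h2, h3, h4⟩ := bracket_diag E 1 0 z
  refine ext_iff'.2 ⟨h1, h2.trans ?_, h3.trans ?_, h4.trans (sBr_zero_left _)⟩
  · rw [one_smul]; exact add_zero _
  · rw [one_smul]; exact add_zero _

theorem bracket_left_unit (y : Infty E) :
    bracket E y (1, 0, 0, 0) = (0, -y.2.1, y.2.2.1, 0) := by
  refine ext_iff'.2 ⟨?_, ?_, ?_, ?_⟩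
  · simp [bracket]
  · simp [bracket, twApp_zero_left, rsmul_one]
  · simp [bracket, twApp_zero_left, rsmul_one]
  · simp [bracket, elem_zero_right, sBr_zero_right]

theorem bracket_pair (m n : M) : bracket E (0, m, 0, 0) (0, 0, n, 0) =
    (q.toFun m n, 0, 0, ⟨elem q m n, E.eosp_le (elem_mem_eosp q m n)⟩) := by
  refine ext_iff'.2 ⟨?_, ?_, ?_, ?_⟩
  · simp [bracket]
  · simp [bracket, twApp_zero_left]
  · simp [bracket, twApp_zero_left]
  · simp [bracket, elem_zero_right, sBr_zero_right]

variable (hA : IsSupercommutative 𝒜) (hι : ∀ i, ∀ k ∈ 𝒦 i, ι k ∈ 𝒜 i)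
  (hinj : Function.Injective (lmul M : A → AddMonoid.End M)) (h2 : IsUnit (2 : A))

include h2 in
/-- A derivation that maps the grading element `(1,0,0,0)` into `A ⊕ ℰ` preserves the
decomposition of `ℰ_∞` into `A ⊕ ℰ` and the two copies of `M`. -/
theorem preserves_of_unit {α : ZMod 2} {D : AddMonoid.End (Infty E)}
    (hD : D ∈ derHom (proj E) (ract E) (bracket E) α)
    (hm : (D (1, 0, 0, 0)).2.1 = 0) (hn : (D (1, 0, 0, 0)).2.2.1 = 0) :
    (∀ a x, (D (a, 0, 0, x)).2.1 = 0 ∧ (D (a, 0, 0, x)).2.2.1 = 0) ∧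
    (∀ m, D (0, m, 0, 0) = (0, (D (0, m, 0, 0)).2.1, 0, 0)) ∧
    ∀ n, D (0, 0, n, 0) = (0, 0, (D (0, 0, n, 0)).2.2.1, 0) := by
  have he : proj E 0 (1, 0, 0, 0) = (1, 0, 0, 0) :=
    proj_mk_iff.2 ⟨SetLike.GradedOne.one_mem, zero_mem _, zero_mem _, HasDegree.zero 0⟩
  have hDe : D (1, 0, 0, 0) = ((D (1, 0, 0, 0)).1, 0, 0, (D (1, 0, 0, 0)).2.2.2) :=
    ext_iff'.2 ⟨rfl, hm, hn, rfl⟩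
  have key := fun y => hD.2.2 0 (1, 0, 0, 0) y he
  simp only [kos_zero_right, one_smul, bracket_unit] at key
  generalize (D (1, 0, 0, 0)).1 = a₀ at hDe
  generalize (D (1, 0, 0, 0)).2.2.2 = x₀ at hDe
  rw [hDe] at key
  have z0 : D (0, 0, 0, 0) = 0 := map_zero D
  refine ⟨fun a x => ?_, fun m => ?_, fun n => ?_⟩
  · have h := key (a, 0, 0, x)
    obtain ⟨-, b2, b3, -⟩ := bracket_diag E a₀ x₀ (a, 0, 0, x)
    obtain ⟨-, c2, c3, -⟩ := ext_iff'.1 h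
    simp only [neg_zero, z0, Prod.snd_add, Prod.fst_add, b2, b3, smul_zero, map_zero, add_zero,
      zero_add] at c2 c3
    exact ⟨c2.symm, neg_eq_zero.1 c3.symm⟩
  · have h := key (0, m, 0, 0)
    obtain ⟨b1, -, b3, b4⟩ := bracket_diag E a₀ x₀ (0, m, 0, 0)
    obtain ⟨c1, -, c3, c4⟩ := ext_iff'.1 h
    simp only [neg_zero, Prod.snd_add, Prod.fst_add, b1, b3, b4, smul_zero,
      map_zero, add_zero, zero_add, AddSubgroup.coe_zero, sBr_zero_right] at c1 c3 c4
    exact ext_iff'.2 ⟨c1, rfl,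
      eq_zero_of_add_self h2 (add_eq_zero_iff_eq_neg.2 c3), c4⟩
  · have h := key (0, 0, n, 0)
    obtain ⟨b1, b2, -, b4⟩ := bracket_diag E a₀ x₀ (0, 0, n, 0)
    obtain ⟨c1, c2, -, c4⟩ := ext_iff'.1 h
    have e : ((0, 0, -n, 0) : Infty E) = -(0, 0, n, 0) := by
      refine ext_iff'.2 ⟨neg_zero.symm, neg_zero.symm, rfl, ?_⟩
      exact neg_zero.symm
    simp only [e, map_neg, Prod.snd_add, Prod.fst_add, Prod.snd_neg, Prod.fst_neg,
      AddSubgroup.coe_neg, b1, b2, b4, smul_zero,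
      map_zero, add_zero, zero_add, AddSubgroup.coe_zero, sBr_zero_right, neg_eq_zero] at c1 c2 c4
    exact ext_iff'.2 ⟨c1, eq_zero_of_add_self h2 (add_eq_zero_iff_eq_neg.2 c2.symm), rfl, c4⟩

theorem bracket_diag_left (a : A) (x : E.carrier) (m : M) :
    bracket E (a, 0, 0, x) (0, m, 0, 0) = (0, a • m + (x : AddMonoid.End M) m, 0, 0) := by
  obtain ⟨h1, h2, h3, h4⟩ := bracket_diag E a x (0, m, 0, 0)
  refine ext_iff'.2 ⟨h1, h2, h3.trans ?_, h4.trans (sBr_zero_right _)⟩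
  simp

theorem bracket_diag_right (a : A) (x : E.carrier) (n : M) :
    bracket E (a, 0, 0, x) (0, 0, n, 0) = (0, 0, -(a • n) + (x : AddMonoid.End M) n, 0) := by
  obtain ⟨h1, h2, h3, h4⟩ := bracket_diag E a x (0, 0, n, 0)
  refine ext_iff'.2 ⟨h1, h2.trans ?_, h3, h4.trans (sBr_zero_right _)⟩
  simp

include hA h2 in
/-- A derivation preserving the decomposition of `ℰ_∞` has the form `d_{S,T}`, where `S + T` and
`S - T` are its restrictions to the two copies of `M`. -/
theorem exists_isD_of_preserves {α : ZMod 2} {D : AddMonoid.End (Infty E)}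
    (hD : D ∈ derHom (proj E) (ract E) (bracket E) α)
    (hdiag : ∀ a x, (D (a, 0, 0, x)).2.1 = 0 ∧ (D (a, 0, 0, x)).2.2.1 = 0)
    (hleft : ∀ m, D (0, m, 0, 0) = (0, (D (0, m, 0, 0)).2.1, 0, 0))
    (hright : ∀ n, D (0, 0, n, 0) = (0, 0, (D (0, 0, n, 0)).2.2.1, 0)) :
    ∃ S ∈ sHom E α, ∃ T ∈ tHom E α, IsD E S T D := by
  have G := isGrading_pr ℳ
  have addL : ∀ m m' : M, ((0, m + m', 0, 0) : Infty E) = (0, m, 0, 0) + (0, m', 0, 0) :=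
    fun m m' => ext_iff'.2 ⟨(add_zero _).symm, rfl, (add_zero _).symm, (add_zero _).symm⟩
  have addR : ∀ m m' : M, ((0, 0, m + m', 0) : Infty E) = (0, 0, m, 0) + (0, 0, m', 0) :=
    fun m m' => ext_iff'.2 ⟨(add_zero _).symm, (add_zero _).symm, rfl, (add_zero _).symm⟩
  let P : AddMonoid.End M := AddMonoidHom.mk' (fun m => (D (0, m, 0, 0)).2.1) fun m m' => by
    rw [addL, map_add]; rfl
  let Q : AddMonoid.End M := AddMonoidHom.mk' (fun m => (D (0, 0, m, 0)).2.2.1) fun m m' => by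
    rw [addR, map_add]; rfl
  have hP : ∀ m, D (0, m, 0, 0) = (0, P m, 0, 0) := hleft
  have hQ : ∀ m, D (0, 0, m, 0) = (0, 0, Q m, 0) := hright
  have degL : ∀ {i : ZMod 2} {m : M}, m ∈ ℳ i → proj E i (0, m, 0, 0) = (0, m, 0, 0) :=
    fun hm => proj_mk_iff.2 ⟨zero_mem _, hm, zero_mem _, HasDegree.zero _⟩
  have degR : ∀ {i : ZMod 2} {m : M}, m ∈ ℳ i → proj E i (0, 0, m, 0) = (0, 0, m, 0) :=
    fun hm => proj_mk_iff.2 ⟨zero_mem _, zero_mem _, hm, HasDegree.zero _⟩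
  have degD : ∀ {i : ZMod 2} {a : A} {x : E.carrier}, a ∈ 𝒜 i →
      HasDegree (pr ℳ) i (x : AddMonoid.End M) → proj E i (a, 0, 0, x) = (a, 0, 0, x) :=
    fun ha hx => proj_mk_iff.2 ⟨ha, zero_mem _, zero_mem _, hx⟩
  have hPd : HasDegree (pr ℳ) α P := hasDegree_pr_iff.2 fun i m hm => by
    have := hD.1 i _ (degL hm)
    rw [hP] at this
    exact (proj_mk_iff.1 this).2.1
  have hQd : HasDegree (pr ℳ) α Q := hasDegree_pr_iff.2 fun i m hm => by
    have := hD.1 i _ (degR hm)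
    rw [hQ] at this
    exact (proj_mk_iff.1 this).2.2.1
  have hPK : P ∈ endK 𝒜 ℳ ι := fun m k => by
    have h := congrArg (fun y : Infty E => y.2.1) (hD.2.1 k (0, m, 0, 0))
    have e : ract E k (0, m, 0, 0) = (0, rsmul 𝒜 ℳ m (ι k), 0, 0) :=
      ext_iff'.2 ⟨zero_mul _, rfl, rsmul_zero_left _, zero_mul _⟩
    rw [e] at h
    exact h
  have hQK : Q ∈ endK 𝒜 ℳ ι := fun m k => by
    have h := congrArg (fun y : Infty E => y.2.2.1) (hD.2.1 k (0, 0, m, 0))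
    have e : ract E k (0, 0, m, 0) = (0, 0, rsmul 𝒜 ℳ m (ι k), 0) :=
      ext_iff'.2 ⟨zero_mul _, rsmul_zero_left _, rfl, zero_mul _⟩
    rw [e] at h
    exact h
  -- the action of `P` and `Q` on `A ⊕ ℰ`
  have hdiag' : ∀ a x, D (a, 0, 0, x) = ((D (a, 0, 0, x)).1, 0, 0, (D (a, 0, 0, x)).2.2.2) :=
    fun a x => ext_iff'.2 ⟨rfl, (hdiag a x).1, (hdiag a x).2, rfl⟩
  have act : ∀ (i : ZMod 2) (a : A) (x : E.carrier), a ∈ 𝒜 i →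
      HasDegree (pr ℳ) i (x : AddMonoid.End M) →
      sBr (pr ℳ) P (lmul M a + x) = lmul M (D (a, 0, 0, x)).1 + (D (a, 0, 0, x)).2.2.2 ∧
      sBr (pr ℳ) Q (lmul M a - x) = lmul M (D (a, 0, 0, x)).1 - (D (a, 0, 0, x)).2.2.2 := by
    intro i a x ha hx
    have hla := hasDegree_lmul (ℳ := ℳ) ha
    constructor
    · rw [sBr_of_hasDegree G hPd (hla.add hx)]
      ext m
      have h := congrArg (fun y : Infty E => y.2.1)
        (hD.2.2 i (a, 0, 0, x) (0, m, 0, 0) (degD ha hx))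
      rw [bracket_diag_left, hP, hP, bracket_diag_left, hdiag', bracket_diag_left] at h
      have h' : P (a • m + (x : AddMonoid.End M) m) = (D (a, 0, 0, x)).1 • m +
        ((D (a, 0, 0, x)).2.2.2 : AddMonoid.End M) m +
          kos α i • (a • P m + (x : AddMonoid.End M) (P m)) := h
      simp only [end_sub_apply, end_add_apply, end_zsmul_apply, end_mul_apply, lmul_apply]
      rw [h']
      abel
    · rw [sBr_of_hasDegree G hQd (hla.sub hx)]
      ext m
      have h := congrArg (fun y : Infty E => y.2.2.1)
        (hD.2.2 i (a, 0, 0, x) (0, 0, m, 0) (degD ha hx))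
      rw [bracket_diag_right, hQ, hQ, bracket_diag_right, hdiag', bracket_diag_right] at h
      have h' : Q (-(a • m) + (x : AddMonoid.End M) m) = -((D (a, 0, 0, x)).1 • m) +
        ((D (a, 0, 0, x)).2.2.2 : AddMonoid.End M) m +
          kos α i • (-(a • Q m) + (x : AddMonoid.End M) (Q m)) := h
      simp only [end_sub_apply, end_zsmul_apply, end_mul_apply, lmul_apply]
      rw [show a • m - (x : AddMonoid.End M) m = -(-(a • m) + (x : AddMonoid.End M) m) by abel,
        map_neg, h', show a • Q m - (x : AddMonoid.End M) (Q m) =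
          -(-(a • Q m) + (x : AddMonoid.End M) (Q m)) by abel, smul_neg]
      abel
  have addD : ∀ (a a' : A) (x x' : E.carrier),
      ((a + a', 0, 0, x + x') : Infty E) = (a, 0, 0, x) + (a', 0, 0, x') :=
    fun a a' x x' => ext_iff'.2 ⟨rfl, (add_zero _).symm, (add_zero _).symm, rfl⟩
  have act' : ∀ (a : A) (x : E.carrier),
      sBr (pr ℳ) P (lmul M a + x) = lmul M (D (a, 0, 0, x)).1 + (D (a, 0, 0, x)).2.2.2 ∧
      sBr (pr ℳ) Q (lmul M a - x) = lmul M (D (a, 0, 0, x)).1 - (D (a, 0, 0, x)).2.2.2 := by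
    intro a x
    have c := fun i => act i _ ⟨endComp (pr ℳ) i x, E.comp_mem i _ x.2⟩ (pr_mem 𝒜 i a)
      (hasDegree_endComp G i _)
    have ea := pr_add_pr 𝒜 a
    have ex : (⟨endComp (pr ℳ) 0 x, E.comp_mem 0 _ x.2⟩ : E.carrier) +
      ⟨endComp (pr ℳ) 1 x, E.comp_mem 1 _ x.2⟩ = x := Subtype.ext (endComp_add_endComp G _)
    rw [← ea, ← ex, addD, map_add]
    simp only [lmul_add, AddSubgroup.coe_add, Prod.fst_add, Prod.snd_add]
    constructor
    · rw [add_add_add_comm, sBr_add_right, (c 0).1, (c 1).1]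
      exact add_add_add_comm _ _ _ _
    · rw [add_sub_add_comm, sBr_add_right, (c 0).2, (c 1).2]
      exact (add_sub_add_comm _ _ _ _).symm
  have half : ∀ {X Y : AddMonoid.End M}, X = Y + Y → lmul M (Ring.inverse (2 : A)) * X = Y := by
    rintro X Y rfl
    ext m
    exact half_smul_add_self h2 _
  have hh := half_mem (𝒜 := 𝒜) h2
  have hSA : ∀ a, sBr (pr ℳ) (lmul M (Ring.inverse (2 : A)) * (P + Q)) (lmul M a) =
      lmul M (D (a, 0, 0, 0)).1 := by
    intro a
    obtain ⟨h, h'⟩ := act' a 0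
    rw [AddSubgroup.coe_zero, add_zero] at h
    rw [AddSubgroup.coe_zero, sub_zero] at h'
    rw [sBr_lmul_mul _ _ (lmul_mem_endA hA a), sBr_add_left, h, h']
    exact half (by abel)
  have hTA : ∀ a, sBr (pr ℳ) (lmul M (Ring.inverse (2 : A)) * (P - Q)) (lmul M a) =
      (D (a, 0, 0, 0)).2.2.2 := by
    intro a
    obtain ⟨h, h'⟩ := act' a 0
    rw [AddSubgroup.coe_zero, add_zero] at h
    rw [AddSubgroup.coe_zero, sub_zero] at h'
    rw [sBr_lmul_mul _ _ (lmul_mem_endA hA a), sBr_sub_left, h, h']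
    exact half (by abel)
  have hSE : ∀ x : E.carrier, sBr (pr ℳ) (lmul M (Ring.inverse (2 : A)) * (P + Q)) x =
      (D (0, 0, 0, x)).2.2.2 := by
    intro x
    obtain ⟨h, h'⟩ := act' 0 x
    rw [lmul_zero, zero_add] at h
    rw [lmul_zero, zero_sub, sBr_neg_right, neg_eq_iff_eq_neg] at h'
    rw [sBr_lmul_mul _ _ (E.le_osp _ x.2).1, sBr_add_left, h, h']
    exact half (by abel)
  have hTE : ∀ x : E.carrier, sBr (pr ℳ) (lmul M (Ring.inverse (2 : A)) * (P - Q)) x =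
      lmul M (D (0, 0, 0, x)).1 := by
    intro x
    obtain ⟨h, h'⟩ := act' 0 x
    rw [lmul_zero, zero_add] at h
    rw [lmul_zero, zero_sub, sBr_neg_right, neg_eq_iff_eq_neg] at h'
    rw [sBr_lmul_mul _ _ (E.le_osp _ x.2).1, sBr_sub_left, h, h']
    exact half (by abel)
  have eP : P = lmul M (Ring.inverse (2 : A)) * (P + Q) + lmul M (Ring.inverse (2 : A)) * (P - Q) :=
    (half (by abel)).symm.trans (mul_add _ (P + Q) (P - Q))
  have eQ : Q = lmul M (Ring.inverse (2 : A)) * (P + Q) - lmul M (Ring.inverse (2 : A)) * (P - Q) :=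
    (half (by abel)).symm.trans (mul_sub _ (P + Q) (P - Q))
  have hSd : HasDegree (pr ℳ) α (lmul M (Ring.inverse (2 : A)) * (P + Q)) := by
    simpa using (hasDegree_lmul (ℳ := ℳ) hh).mul (hPd.add hQd)
  have hTd : HasDegree (pr ℳ) α (lmul M (Ring.inverse (2 : A)) * (P - Q)) := by
    simpa using (hasDegree_lmul (ℳ := ℳ) hh).mul (hPd.sub hQd)
  have hSK : lmul M (Ring.inverse (2 : A)) * (P + Q) ∈ endK 𝒜 ℳ ι :=
    mul_lmul_mem_endK hA ((endKSubgroup 𝒜 ℳ ι).add_mem hPK hQK) _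
  have hTK : lmul M (Ring.inverse (2 : A)) * (P - Q) ∈ endK 𝒜 ℳ ι :=
    mul_lmul_mem_endK hA ((endKSubgroup 𝒜 ℳ ι).sub_mem hPK hQK) _
  -- from here on `S = ½ (P + Q)` and `T = ½ (P - Q)` enter only through the identities above
  generalize lmul M (Ring.inverse (2 : A)) * (P + Q) = S at *
  generalize lmul M (Ring.inverse (2 : A)) * (P - Q) = T at *
  -- the brackets of the two copies of `M`
  have pair : ∀ {i j : ZMod 2} {m n : M}, m ∈ ℳ i → n ∈ ℳ j →
      (D (q.toFun m n, 0, 0, 0)).1 +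
        (D (0, 0, 0, ⟨elem q m n, E.eosp_le (elem_mem_eosp q m n)⟩)).1 =
          q.toFun (P m) n + kos α i • q.toFun m (Q n) ∧
      ((D (q.toFun m n, 0, 0, 0)).2.2.2 : AddMonoid.End M) +
        (D (0, 0, 0, ⟨elem q m n, E.eosp_le (elem_mem_eosp q m n)⟩)).2.2.2 =
          elem q (P m) n + kos α i • elem q m (Q n) := by
    intro i j m n hm hn
    have h := hD.2.2 i _ (0, 0, n, 0) (degL hm)
    rw [bracket_pair, hP, hQ, bracket_pair, bracket_pair,
      show ((q.toFun m n, 0, 0, ⟨elem q m n, E.eosp_le (elem_mem_eosp q m n)⟩) : Infty E) =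
        (q.toFun m n, 0, 0, 0) + (0, 0, 0, ⟨elem q m n, E.eosp_le (elem_mem_eosp q m n)⟩) from
        ext_iff'.2 ⟨(add_zero _).symm, (add_zero _).symm, (add_zero _).symm, (zero_add _).symm⟩,
      map_add] at h
    obtain ⟨h1, -, -, h4⟩ := ext_iff'.1 h
    exact ⟨h1, h4⟩
  have swap : ∀ {i j : ZMod 2} {m n : M}, m ∈ ℳ i → n ∈ ℳ j →
      D (q.toFun n m, 0, 0, 0) = kos i j • D (q.toFun m n, 0, 0, 0) ∧
      D (0, 0, 0, ⟨elem q n m, E.eosp_le (elem_mem_eosp q n m)⟩) =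
        -(kos i j • D (0, 0, 0, ⟨elem q m n, E.eosp_le (elem_mem_eosp q m n)⟩)) := by
    intro i j m n hm hn
    rw [← map_zsmul, ← map_zsmul, ← map_neg]
    constructor
    · refine congrArg D (ext_iff'.2 ⟨?_, ?_, ?_, ?_⟩)
      · rw [q.supersymm _ _ _ _ hn hm, kos_comm]; rfl
      · show (0 : M) = kos i j • (0 : M)
        simp
      · show (0 : M) = kos i j • (0 : M)
        simp
      · exact (smul_zero (kos i j)).symm
    · refine congrArg D (ext_iff'.2 ⟨?_, ?_, ?_, elem_skew q hm hn⟩)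
      · show (0 : A) = -(kos i j • (0 : A))
        simp
      · show (0 : M) = -(kos i j • (0 : M))
        simp
      · show (0 : M) = -(kos i j • (0 : M))
        simp
  have hSq : ∀ i j m n, m ∈ ℳ i → n ∈ ℳ j → (D (q.toFun m n, 0, 0, 0)).1 =
      q.toFun (S m) n + kos i j • q.toFun (S n) m := by
    intro i j m n hm hn
    obtain ⟨h, -⟩ := pair hm hn
    obtain ⟨h', -⟩ := pair hn hm
    obtain ⟨w1, w2⟩ := swap hm hn
    refine eq_of_add_self_eq h2 ?_
    rw [w1, w2] at h'
    rw [eP, eQ] at h h'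
    simp only [end_add_apply, end_sub_apply, map_add, map_sub, AddMonoidHom.add_apply,
      q.supersymm _ _ _ _ hm (hSd.mem hn), q.supersymm _ _ _ _ hm (hTd.mem hn),
      q.supersymm _ _ _ _ hn (hSd.mem hm), q.supersymm _ _ _ _ hn (hTd.mem hm)] at h h'
    generalize D (q.toFun m n, 0, 0, 0) = F at *
    generalize D (0, 0, 0, ⟨elem q m n, E.eosp_le (elem_mem_eosp q m n)⟩) = F' at *
    have e : F.1 + F.1 = (F.1 + F'.1) + kos i j • ((kos i j • F).1 + (-(kos i j • F')).1) := by
      rw [show (kos i j • F).1 = kos i j • F.1 from rfl,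
        show (-(kos i j • F')).1 = -(kos i j • F'.1) from rfl, smul_add, smul_neg, kos_smul_smul,
        kos_smul_smul]
      abel
    rw [e, h, h']
    simp only [kos_add_right, smul_add, smul_sub, mul_smul, kos_comm j i,
      kos_comm i α, kos_comm j α, kos_smul_smul]
    rcases kos_eq_or i j with h1 | h1 <;> simp only [h1, one_smul, neg_smul] <;> abel
  have hTq : ∀ i j m n, m ∈ ℳ i → n ∈ ℳ j →
      ((D (q.toFun m n, 0, 0, 0)).2.2.2 : AddMonoid.End M) =
        elem q (T m) n + kos i j • elem q (T n) m := by
    intro i j m n hm hn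
    obtain ⟨-, h⟩ := pair hm hn
    obtain ⟨-, h'⟩ := pair hn hm
    obtain ⟨w1, w2⟩ := swap hm hn
    rw [w1, w2] at h'
    rw [eP, eQ] at h h'
    simp only [end_add_apply, end_sub_apply, elem_add_left, elem_sub_right,
      elem_skew q (hSd.mem hn) hm, elem_skew q (hTd.mem hn) hm,
      elem_skew q (hSd.mem hm) hn, elem_skew q (hTd.mem hm) hn] at h h'
    generalize D (q.toFun m n, 0, 0, 0) = F at *
    generalize D (0, 0, 0, ⟨elem q m n, E.eosp_le (elem_mem_eosp q m n)⟩) = F' at *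
    ext p
    have hp := DFunLike.congr_fun h p
    have hp' := DFunLike.congr_fun h' p
    refine eq_of_add_self_eq h2 ?_
    have e : (F.2.2.2 : AddMonoid.End M) p + (F.2.2.2 : AddMonoid.End M) p =
        ((F.2.2.2 : AddMonoid.End M) + (F'.2.2.2 : AddMonoid.End M)) p +
          kos i j • ((((kos i j • F).2.2.2 : AddMonoid.End M) +
            ((-(kos i j • F')).2.2.2 : AddMonoid.End M)) p) := by
      rw [show ((kos i j • F).2.2.2 : AddMonoid.End M) =
          kos i j • (F.2.2.2 : AddMonoid.End M) from rfl,
        show ((-(kos i j • F')).2.2.2 : AddMonoid.End M) =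
          -(kos i j • (F'.2.2.2 : AddMonoid.End M)) from rfl]
      simp only [end_add_apply, end_neg_apply, end_zsmul_apply]
      rw [smul_add, smul_neg, kos_smul_smul, kos_smul_smul]
      abel
    rw [e, hp, hp']
    simp only [end_add_apply, end_sub_apply, end_neg_apply, end_zsmul_apply,
      kos_add_left, smul_add, smul_sub, mul_smul, kos_comm j i,
      kos_smul_smul, smul_neg]
    rcases kos_eq_or i j with h1 | h1 <;> simp only [h1, one_smul, neg_smul, neg_neg] <;> abel
  refine ⟨S, ⟨hSK, hSd, fun a => ⟨_, hSA a⟩, fun i j m n hm hn => ?_, fun x hx => ?_⟩,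
    T, ⟨hTK, hTd, fun a => ?_, fun i j m n hm hn => ?_, fun x hx => ⟨_, hTE ⟨x, hx⟩⟩⟩, ?_⟩
  · rw [hSA, hSq i j m n hm hn]
  · rw [hSE ⟨x, hx⟩]
    exact (D (0, 0, 0, ⟨x, hx⟩)).2.2.2.2
  · rw [hTA a]
    exact (D (a, 0, 0, 0)).2.2.2.2
  · rw [hTA, hTq i j m n hm hn]
  · intro a m n x
    have e : ((a, m, n, x) : Infty E) =
        (a, 0, 0, 0) + (0, 0, 0, x) + (0, m, 0, 0) + (0, 0, n, 0) := by
      refine ext_iff'.2 ⟨?_, ?_, ?_, ?_⟩ <;> simp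
    rw [e, map_add, map_add, map_add, hP, hQ, hSA, hTE, hTA, hSE, ← lmul_add]
    simp only [Prod.fst_add, Prod.snd_add, (hdiag a 0).1, (hdiag a 0).2, (hdiag 0 x).1,
      (hdiag 0 x).2, AddSubgroup.coe_add, add_zero, zero_add]
    exact ⟨trivial, DFunLike.congr_fun eP m, DFunLike.congr_fun eQ n, trivial⟩

include hA hι hinj h2 in
/-- Up to an inner derivation, a derivation of `ℰ_∞` has the form `d_{S,0}`, provided that `𝒯`
consists of scalar multiplications. -/
theorem exists_eq_add_of_mem_derHom {α : ZMod 2}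
    (hT : ∀ T ∈ tHom E α, ∃ c ∈ 𝒜 α, T = lmul M c) {d : AddMonoid.End (Infty E)}
    (hd : d ∈ derHom (proj E) (ract E) (bracket E) α) :
    ∃ y, ∃ S ∈ sHom E α, d = adEnd E y + dMap E S := by
  have H := isSuperAlgebra E hA hι
  have he : proj E 0 (1, 0, 0, 0) = (1, 0, 0, 0) :=
    proj_mk_iff.2 ⟨SetLike.GradedOne.one_mem, zero_mem _, zero_mem _, HasDegree.zero 0⟩
  have hde := hd.1 0 _ he
  rw [add_zero] at hde
  obtain ⟨-, hm, hn, -⟩ := proj_eq_iff.1 hde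
  generalize hv : d (1, 0, 0, 0) = v at *
  -- the inner derivation of `(0, -v.2.1, v.2.2.1, 0)` has at `(1,0,0,0)` the same components in the
  -- two copies of `M` as `d`
  have hy : proj E α (0, -v.2.1, v.2.2.1, 0) = (0, -v.2.1, v.2.2.1, 0) :=
    proj_mk_iff.2 ⟨zero_mem _, neg_mem hm, hn, HasDegree.zero _⟩
  have hD : d - adEnd E (0, -v.2.1, v.2.2.1, 0) ∈
      derHom (proj E) (ract E) (bracket E) α :=
    (H.derPart α).sub_mem hd (adEnd_mem_derHom E hA hι hinj hy)
  have hDe : (d - adEnd E (0, -v.2.1, v.2.2.1, 0)) (1, 0, 0, 0) = (v.1, 0, 0, v.2.2.2) := by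
    rw [end_sub_apply, hv, adEnd_apply, bracket_left_unit]
    refine ext_iff'.2 ⟨sub_zero _, ?_, sub_self _, sub_zero _⟩
    show v.2.1 - - -v.2.1 = 0
    rw [neg_neg, sub_self]
  generalize hDD : d - adEnd E (0, -v.2.1, v.2.2.1, 0) = D at *
  obtain ⟨h1, h3, h4⟩ := preserves_of_unit E h2 hD (by rw [hDe]) (by rw [hDe])
  obtain ⟨S, hS, T, hTT, hIs⟩ := exists_isD_of_preserves E hA h2 hD h1 h3 h4
  obtain ⟨c, hc, rfl⟩ := hT T hTT
  -- `d_{0,T}` for `T = c · id` is the inner derivation of `(c,0,0,0)`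
  have hfin : D - adEnd E (c, 0, 0, 0) = dMap E S := by
    rw [← isD_iff_eq_dMap E hinj (sHom_subset_sAlg E hinj α hS)]
    intro a m n x
    obtain ⟨i1, i2, i3, i4⟩ := hIs a m n x
    obtain ⟨b1, b2, b3, b4⟩ := bracket_diag E c 0 (a, m, n, x)
    rw [sBr_lmul_endA (E.le_osp _ x.2).1] at i1
    rw [sBr_lmul_endA (lmul_mem_endA hA a)] at i4
    rw [sBr_zero_left, sBr_zero_left]
    rw [AddSubgroup.coe_zero] at b2 b3 b4
    rw [sBr_zero_left] at b4
    refine ⟨?_, ?_, ?_, ?_⟩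
    · show lmul M ((D (a, m, n, x)).1 - (bracket E (c, 0, 0, 0) (a, m, n, x)).1) = _
      rw [b1, sub_zero, i1]
    · show (D (a, m, n, x)).2.1 - (bracket E (c, 0, 0, 0) (a, m, n, x)).2.1 = _
      rw [b2, i2]
      simp [lmul_apply]
    · show (D (a, m, n, x)).2.2.1 - (bracket E (c, 0, 0, 0) (a, m, n, x)).2.2.1 = _
      rw [b3, i3]
      simp [lmul_apply]
    · show ((D (a, m, n, x)).2.2.2 : AddMonoid.End M) -
        (bracket E (c, 0, 0, 0) (a, m, n, x)).2.2.2 = _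
      rw [b4, i4, sub_zero]
  refine ⟨(0, -v.2.1, v.2.2.1, 0) + (c, 0, 0, 0), S, hS, ?_⟩
  rw [adEnd_add, ← hfin, ← hDD]
  abel

include hA hι hinj h2 in
theorem derivations_eq (hT : ∀ α, ∀ T ∈ tHom E α, ∃ c ∈ 𝒜 α, T = lmul M c) :
    derivations E = ad E + dMap E '' sAlg E := by
  have H := isSuperAlgebra E hA hι
  have L : IsLieSubalgebra (proj E) (lact E) (derivations E) := H.isLieSubalgebra_der
  ext d
  constructor
  · rintro ⟨d0, hd0, d1, hd1, rfl⟩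
    obtain ⟨y, S, hS, rfl⟩ := exists_eq_add_of_mem_derHom E hA hι hinj h2 (hT 0) hd0
    obtain ⟨y', S', hS', rfl⟩ := exists_eq_add_of_mem_derHom E hA hι hinj h2 (hT 1) hd1
    have m0 := sHom_subset_sAlg E hinj _ hS
    have m1 := sHom_subset_sAlg E hinj _ hS'
    have m := (isLieSubalgebra_sAlg E hA hι hinj).add_mem _ m0 _ m1
    refine ⟨adEnd E (y + y'), (mem_ad_iff E).2 ⟨_, rfl⟩, _, ⟨_, m, rfl⟩, ?_⟩
    show adEnd E (y + y') + dMap E (S + S') = _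
    rw [adEnd_add, dMap_add E hinj m0 m1 m]
    exact add_add_add_comm _ _ _ _
  · rintro ⟨d, hd, _, ⟨S, hS, rfl⟩, rfl⟩
    obtain ⟨y, rfl⟩ := (mem_ad_iff E).1 hd
    exact L.add_mem _ (adEnd_mem_derivations E hA hι hinj y) _
      (dMap_mem_derivations E hA hι hinj hS)

include hinj h2 in
/-- Only the elements of `ℰ` give inner derivations of the form `d_{S,0}`. -/
theorem eq_of_adEnd_eq_dMap {S : AddMonoid.End M} (hS : S ∈ sAlg E) {y : Infty E}
    (h : adEnd E y = dMap E S) : S = y.2.2.2 := by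
  obtain ⟨Δ, hΔ⟩ := exists_along E hinj hS
  have F := (isD_iff E hinj hΔ).1 (isD_dMap E hinj hS)
  rw [← h] at F
  obtain ⟨-, f2, f3, -⟩ := F (1, 0, 0, 0)
  rw [adEnd_apply, bracket_left_unit] at f2 f3
  rw [map_zero, neg_eq_zero] at f2
  rw [map_zero] at f3
  obtain ⟨a, m, n, x⟩ := y
  obtain rfl : m = 0 := f2
  obtain rfl : n = 0 := f3
  ext p
  obtain ⟨-, g2, g3, -⟩ := F (0, p, p, 0)
  rw [adEnd_apply, (bracket_diag E a x _).2.1] at g2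
  rw [adEnd_apply, (bracket_diag E a x _).2.2.1] at g3
  have g2' : a • p + (x : AddMonoid.End M) p = S p := g2
  have g3' : -(a • p) + (x : AddMonoid.End M) p = S p := g3
  refine eq_of_add_self_eq h2 ?_
  have e : S p + S p = (a • p + (x : AddMonoid.End M) p) +
      (-(a • p) + (x : AddMonoid.End M) p) := by rw [g2', g3']
  rw [e]
  show _ = (x : AddMonoid.End M) p + (x : AddMonoid.End M) p
  abel

theorem dMap_eq_adEnd {x : E.carrier} (hinj : Function.Injective (lmul M : A → AddMonoid.End M)) :
    dMap E x = adEnd E (0, 0, 0, x) :=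
  ((isD_iff_eq_dMap E hinj (mem_sAlg_of_mem E hinj x.2) _).1 (isD_adEnd_inc E x)).symm

include hinj in
theorem adE_eq : adE E = {d | ∃ S ∈ E.carrier, IsD E S 0 d} := by
  ext d
  rw [mem_adE_iff]
  constructor
  · rintro ⟨x, rfl⟩
    exact ⟨x, x.2, isD_adEnd_inc E x⟩
  · rintro ⟨S, hS, h⟩
    exact ⟨⟨S, hS⟩, h.unique E hinj (isD_adEnd_inc E ⟨S, hS⟩)⟩

include hinj h2 in
theorem ad_inter_dSet {X : Set (AddMonoid.End M)} (hX : X ⊆ sAlg E)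
    (hE : (E.carrier : Set (AddMonoid.End M)) ⊆ X) : ad E ∩ dSet E X = adE E := by
  rw [dSet_eq E hinj hX]
  ext d
  rw [mem_adE_iff]
  constructor
  · rintro ⟨hd, S, hS, rfl⟩
    obtain ⟨y, hy⟩ := (mem_ad_iff E).1 hd
    have e := eq_of_adEnd_eq_dMap E hinj h2 (hX hS) hy.symm
    exact ⟨y.2.2.2, by rw [e, dMap_eq_adEnd E hinj]⟩
  · rintro ⟨x, rfl⟩
    exact ⟨(mem_ad_iff E).2 ⟨_, rfl⟩, x, hE x.2, dMap_eq_adEnd E hinj⟩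

include hA hι hinj in
theorem isLieSubalgebra_dSet {X : Set (AddMonoid.End M)}
    (hX : IsLieSubalgebra (pr ℳ) (fun k : K => lmul M (ι k)) X) (hXS : X ⊆ sAlg E) :
    IsLieSubalgebra (proj E) (lact E) (dSet E X) := by
  have mono := isLieMono_dMap E hA hι hinj hX hXS
  rw [dSet_eq E hinj hXS]
  have zero : dMap E 0 = 0 := by
    have h := mono.map_add 0 hX.zero_mem 0 hX.zero_mem
    rw [add_zero] at h
    exact left_eq_add.1 h
  constructor
  · exact ⟨0, hX.zero_mem, zero⟩
  · rintro _ ⟨f, hf, rfl⟩ _ ⟨g, hg, rfl⟩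
    exact ⟨_, hX.add_mem f hf g hg, mono.map_add f hf g hg⟩
  · rintro _ ⟨f, hf, rfl⟩
    refine ⟨-f, hX.neg_mem f hf, ?_⟩
    have h := mono.map_add _ (hX.neg_mem f hf) f hf
    rw [neg_add_cancel, zero] at h
    exact eq_neg_of_add_eq_zero_left h.symm
  · rintro α _ ⟨f, hf, rfl⟩
    exact ⟨_, hX.comp_mem α f hf, mono.map_comp α f hf⟩
  · rintro k _ ⟨f, hf, rfl⟩
    exact ⟨_, hX.smul_mem k f hf, mono.map_smul k f hf⟩
  · rintro _ ⟨f, hf, rfl⟩ _ ⟨g, hg, rfl⟩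
    exact ⟨_, hX.bracket_mem f hf g hg, mono.map_bracket f hf g hg⟩

include hA hι hinj h2 in
/-- A splitting of `𝒮` modulo `ℰ` gives a splitting of the derivation algebra. -/
theorem isSemidirect_ad (hT : ∀ α, ∀ T ∈ tHom E α, ∃ c ∈ 𝒜 α, T = lmul M c)
    {S₀ : Set (AddMonoid.End M)}
    (h : IsSemidirect (pr ℳ) (fun k : K => lmul M (ι k)) (sAlg E) E.carrier S₀) :
    IsSemidirect (proj E) (lact E) (derivations E) (ad E) (dSet E S₀) := by
  have hS₀ : S₀ ⊆ sAlg E := by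
    intro S hS
    rw [h.eq_add]
    exact ⟨0, E.carrier.zero_mem, S, hS, zero_add S⟩
  refine ⟨(isSuperAlgebra E hA hι).isLieSubalgebra_der, isLieSubalgebra_ad E hA hι hinj,
    isLieSubalgebra_dSet E hA hι hinj h.subalgebra hS₀,
    fun d hd x hx => sBr_mem_ad E hA hι hinj hd hx, ?_, ?_⟩
  · rw [derivations_eq E hA hι hinj h2 hT, dSet_eq E hinj hS₀]
    ext d
    constructor
    · rintro ⟨d, hd, _, ⟨S, hS, rfl⟩, rfl⟩
      obtain ⟨y, rfl⟩ := (mem_ad_iff E).1 hd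
      have hS' := hS
      rw [h.eq_add] at hS'
      obtain ⟨x, hx, S', hS', rfl⟩ := hS'
      refine ⟨adEnd E (y + (0, 0, 0, ⟨x, hx⟩)), (mem_ad_iff E).2 ⟨_, rfl⟩, _, ⟨S', hS', rfl⟩, ?_⟩
      show adEnd E (y + (0, 0, 0, ⟨x, hx⟩)) + dMap E S' = adEnd E y + dMap E (x + S')
      rw [dMap_add E hinj (mem_sAlg_of_mem E hinj hx) (hS₀ hS') hS, adEnd_add,
        ← dMap_eq_adEnd E hinj, add_assoc]
    · rintro ⟨d, hd, _, ⟨S, hS, rfl⟩, rfl⟩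
      exact ⟨d, hd, _, ⟨S, hS₀ hS, rfl⟩, rfl⟩
  · have L := isLieSubalgebra_dSet E hA hι hinj h.subalgebra hS₀
    refine Set.Subset.antisymm ?_ (Set.singleton_subset_iff.2
      ⟨(isLieSubalgebra_ad E hA hι hinj).zero_mem, L.zero_mem⟩)
    rintro d ⟨hd, hd'⟩
    rw [dSet_eq E hinj hS₀] at hd'
    obtain ⟨S, hS, rfl⟩ := hd'
    obtain ⟨y, hy⟩ := (mem_ad_iff E).1 hd
    have e := eq_of_adEnd_eq_dMap E hinj h2 (hS₀ hS) hy.symm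
    have hS0 : S ∈ (E.carrier : Set (AddMonoid.End M)) ∩ S₀ := ⟨e ▸ y.2.2.2.2, hS⟩
    rw [h.inter] at hS0
    obtain rfl : S = 0 := hS0
    have z := dMap_eq_adEnd (x := 0) E hinj
    rw [AddSubgroup.coe_zero] at z
    rw [Set.mem_singleton_iff, z]
    exact (isSuperAlgebra E hA hι).mulHom.map_zero

end Infty

end Decomposition

/-! ### Homogeneous bases adapted to the form -/

section Basis

variable {A : Type u} {M : Type w} [Ring A] [AddCommGroup M] [Module A M]
  {𝒜 : ZMod 2 → AddSubgroup A} [GradedRing 𝒜]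
  {ℳ : ZMod 2 → AddSubgroup M} [DirectSum.Decomposition ℳ]

theorem basis_induction (𝒜 : ZMod 2 → AddSubgroup A) [GradedRing 𝒜] {S : Type*}
    (b : Module.Basis S A M) {P : M → Prop}
    (hzero : P 0) (hadd : ∀ x y, P x → P y → P (x + y))
    (hgen : ∀ s i c, c ∈ 𝒜 i → P (c • b s)) (m : M) : P m := by
  rw [← b.linearCombination_repr m, Finsupp.linearCombination_apply]
  refine Finset.sum_induction _ P hadd hzero fun s _ => ?_
  exact induction_deg 𝒜 (P := fun c => P (c • b s))
    (fun x y hx hy => by rw [add_smul]; exact hadd _ _ hx hy) (fun i c hc => hgen s i c hc) _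

theorem end_ext_basis (𝒜 : ZMod 2 → AddSubgroup A) [GradedRing 𝒜] {S : Type*}
    (b : Module.Basis S A M) {f g : AddMonoid.End M}
    (h : ∀ s i c, c ∈ 𝒜 i → f (c • b s) = g (c • b s)) : f = g := by
  ext m
  refine basis_induction 𝒜 b (P := fun m => f m = g m) (by simp) (fun x y hx hy => ?_) h m
  rw [map_add, map_add, hx, hy]

theorem eq_of_smul_basis_eq {S : Type*} (b : Module.Basis S A M) {s : S} {c d : A}
    (h : c • b s = d • b s) : c = d := by
  simpa using congrArg (fun m => b.repr m s) h

theorem eq_zero_of_smul_basis_eq_zero {S : Type*} (b : Module.Basis S A M) {s : S} {c : A}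
    (h : c • b s = 0) : c = 0 :=
  eq_of_smul_basis_eq b (h.trans (zero_smul A _).symm)

theorem lmul_injective {S : Type*} [Nonempty S] (b : Module.Basis S A M) :
    Function.Injective (lmul M : A → AddMonoid.End M) := fun _ _ h =>
  eq_of_smul_basis_eq b (s := Classical.arbitrary S) (DFunLike.congr_fun h _)

theorem hasDegree_of_basis [SetLike.GradedSMul 𝒜 ℳ] {S : Type*} (b : Module.Basis S A M)
    (hb : ∀ s, ∃ α, b s ∈ ℳ α) {α : ZMod 2} {f : AddMonoid.End M}
    (h : ∀ s i j c, c ∈ 𝒜 i → b s ∈ ℳ j → f (c • b s) ∈ ℳ (α + (i + j))) :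
    HasDegree (pr ℳ) α f := by
  have e : endComp (pr ℳ) α f = f := by
    refine end_ext_basis 𝒜 b fun s i c hc => ?_
    obtain ⟨j, hj⟩ := hb s
    rw [endComp_apply (isGrading_pr ℳ) α f (pr_of_mem (smul_mem_deg hc hj)),
      pr_of_mem (h s i j c hc hj)]
  rw [← e]
  exact hasDegree_endComp (isGrading_pr ℳ) α f

variable {I J : Type*} {q : SuperForm 𝒜 ℳ} {b : Module.Basis ((I ⊕ Fin 2) ⊕ J) A M} {bar : I → I}

namespace IsSplit

variable (hq : IsSplit q b bar) (hA : IsSupercommutative 𝒜) (h2 : IsUnit (2 : A))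

include hq in
theorem isUnit (s : I ⊕ Fin 2) :
    IsUnit (q.toFun (b (.inl s)) (b (.inl (Sum.map bar id s)))) := by
  rcases s with i | k
  · exact (hq.almostDiagonal i).1.1
  · exact (hq.invertiblyDiagonal k).1.1

include hq hA h2 in
theorem even (s : I ⊕ Fin 2) :
    q.toFun (b (.inl s)) (b (.inl (Sum.map bar id s))) ∈ 𝒜 0 := by
  refine even_of_isUnit hA h2 (hq.isUnit s) ?_
  rcases s with i | k
  · exact (hq.almostDiagonal i).1.2
  · exact (hq.invertiblyDiagonal k).1.2

include hq in
theorem comm_eq_zero {s t : (I ⊕ Fin 2) ⊕ J} (h : q.toFun (b s) (b t) = 0) :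
    q.toFun (b t) (b s) = 0 := by
  obtain ⟨i, hi⟩ := hq.homogeneous s
  obtain ⟨j, hj⟩ := hq.homogeneous t
  exact q.eq_zero_comm hi hj h

include hq in
theorem eq_zero {s t : I ⊕ Fin 2} (h : t ≠ Sum.map bar id s) :
    q.toFun (b (.inl s)) (b (.inl t)) = 0 := by
  rcases s with i | k <;> rcases t with j | l
  · exact (hq.almostDiagonal i).2 j fun e => h (congrArg Sum.inl e)
  · exact hq.orthogonal_N i l
  · exact hq.comm_eq_zero (hq.orthogonal_N j k)
  · exact (hq.invertiblyDiagonal k).2 l fun e => h (congrArg Sum.inr e)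

include hq in
theorem right_eq_zero (s : (I ⊕ Fin 2) ⊕ J) (j : J) : q.toFun (b s) (b (.inr j)) = 0 := by
  rcases s with s | j'
  · exact hq.orthogonal s j
  · exact hq.zero_R j' j

include hq in
theorem left_eq_zero (s : (I ⊕ Fin 2) ⊕ J) (j : J) : q.toFun (b (.inr j)) (b s) = 0 :=
  hq.comm_eq_zero (hq.right_eq_zero s j)

include hq in
theorem bar_bar [Nontrivial A] (s : I ⊕ Fin 2) : Sum.map bar id (Sum.map bar id s) = s := by
  by_contra h
  have h1 := hq.comm_eq_zero (hq.eq_zero (Ne.symm h))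
  exact (hq.isUnit s).ne_zero h1

include hq hA h2 in
/-- The vectors `n_i` and `n_{bar i}` have the same parity. -/
theorem mem_bar [Nontrivial A] {s : I ⊕ Fin 2} {i : ZMod 2} (hi : b (.inl s) ∈ ℳ i) :
    b (.inl (Sum.map bar id s)) ∈ ℳ i := by
  obtain ⟨j, hj⟩ := hq.homogeneous (.inl (Sum.map bar id s))
  have h1 := q.degree i j _ _ hi hj
  have h0 := hq.even hA h2 s
  rcases zmod_two_cases (i + j) with h | h
  · have e : i = j := (by decide : ∀ i j : ZMod 2, i + j = 0 → i = j) i j h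
    rwa [e]
  · rw [h] at h1
    exact absurd (eq_zero_of_mem_of_mem h0 h1) (hq.isUnit s).ne_zero

include hq hA h2 in
theorem even_two (k : Fin 2) : b (.inl (.inr k)) ∈ ℳ 0 := by
  obtain ⟨i, hi⟩ := hq.homogeneous (.inl (.inr k))
  rcases zmod_two_cases i with rfl | rfl
  · exact hi
  have h0 := q.supersymm 1 1 _ _ hi hi
  rw [kos_one_one, neg_smul, one_smul] at h0
  have h1 := eq_zero_of_add_self h2 (add_eq_zero_iff_eq_neg.2 h0)
  have hu : IsUnit (q.toFun (b (.inl (.inr k))) (b (.inl (.inr k)))) := hq.isUnit (.inr k)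
  rw [h1] at hu
  rw [eq_zero_of_isUnit_smul hu (zero_smul A (b (.inl (.inr k))))]
  exact zero_mem _

include hq hA h2 in
theorem exists_isFrame (hrank : 2 < Cardinal.mk ((I ⊕ Fin 2) ⊕ J)) : ∃ s π,
    IsFrame q (b (.inl (.inr 0))) (b (.inl (.inr 1))) (b s) π := by
  have key : ∀ s, s ≠ .inl (.inr 0) → s ≠ .inl (.inr 1) → ∃ π,
      IsFrame q (b (.inl (.inr 0))) (b (.inl (.inr 1))) (b s) π := by
    intro s h0 h1
    obtain ⟨π, hπ⟩ := hq.homogeneous s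
    have ho : ∀ k : Fin 2, s ≠ .inl (.inr k) → q.toFun (b (.inl (.inr k))) (b s) = 0 := by
      intro k hk
      rcases s with s | j
      · exact hq.eq_zero fun e => hk (congrArg Sum.inl e)
      · exact hq.right_eq_zero _ _
    exact ⟨π, hq.even_two hA h2 0, hq.even_two hA h2 1, hπ, hq.isUnit (.inr 0),
      hq.isUnit (.inr 1), hq.eq_zero fun e => by simp at e, ho 0 h0, ho 1 h1,
      fun c => eq_zero_of_smul_basis_eq_zero b⟩
  obtain ⟨s, hs⟩ := Cardinal.exists_notMem_of_length_lt
    [(.inl (.inr 0) : (I ⊕ Fin 2) ⊕ J), .inl (.inr 1)] hrank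
  simp only [List.mem_cons, List.not_mem_nil, or_false, not_or] at hs
  exact ⟨s, key s hs.1 hs.2⟩

end IsSplit

end Basis

/-! ### The lift `Δ_M` of a derivation `Δ` of `A` -/

section DerA

variable {A : Type u} {K : Type v} [Ring A] [Ring K]
  {𝒜 : ZMod 2 → AddSubgroup A} [GradedRing 𝒜] {ι : K →+* A}
  {𝒦 : ZMod 2 → AddSubgroup K} [GradedRing 𝒦]

/-- `A` is a superalgebra over `K`. -/
theorem isSuperAlgebra_ring (hA : IsSupercommutative 𝒜) (hι : ∀ i, ∀ k ∈ 𝒦 i, ι k ∈ 𝒜 i) :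
    IsSuperAlgebra 𝒦 (pr 𝒜) (fun k : K => lmul A (ι k)) (fun k a => a * ι k)
      (fun a b => a * b) where
  grading := isGrading_pr 𝒜
  mul_add := mul_add
  add_mul := add_mul
  mul_deg i j x y hx hy := pr_of_mem (mul_mem_deg (pr_eq_iff.1 hx) (pr_eq_iff.1 hy))
  l_add k k' := by rw [map_add, lmul_add]
  l_deg κ k hk := hasDegree_pr_iff.2 fun j x hx => mul_mem_deg (hι κ k hk) hx
  l_r k k' x := (mul_assoc _ _ _).symm
  r_add k x y := add_mul _ _ _
  l_mul k x y := mul_assoc _ _ _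
  mul_l κ k hk i x y hx := by
    show x * (ι k * y) = kos κ i • (ι k * (x * y))
    rw [← mul_assoc, hA i κ x _ (pr_eq_iff.1 hx) (hι κ k hk), smul_mul_assoc, mul_assoc, kos_comm]

/-- The `K`-derivations of degree `α` of `A`. -/
abbrev derAHom (𝒜 : ZMod 2 → AddSubgroup A) [GradedRing 𝒜] (ι : K →+* A) (α : ZMod 2) :
    Set (AddMonoid.End A) :=
  derHom (pr 𝒜) (fun (k : K) a => a * ι k) (fun a b => a * b) α

theorem derAHom_leibniz {α i : ZMod 2} {Δ : AddMonoid.End A} (h : Δ ∈ derAHom 𝒜 ι α) {a : A}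
    (ha : a ∈ 𝒜 i) (c : A) : Δ (a * c) = Δ a * c + kos α i • (a * Δ c) :=
  h.2.2 i a c (pr_of_mem ha)

theorem derAHom_one {α : ZMod 2} {Δ : AddMonoid.End A} (h : Δ ∈ derAHom 𝒜 ι α) : Δ 1 = 0 := by
  have e := derAHom_leibniz h (SetLike.GradedOne.one_mem (A := 𝒜)) 1
  rw [kos_zero_right, one_smul, mul_one, mul_one, one_mul] at e
  exact left_eq_add.1 e

theorem derAHom_map {α : ZMod 2} {Δ : AddMonoid.End A} (h : Δ ∈ derAHom 𝒜 ι α) (k : K) :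
    Δ (ι k) = 0 := by
  have e := h.2.1 k 1
  simpa [derAHom_one h] using e

end DerA

section Delta

variable {A : Type u} {K : Type v} {M : Type w} [Ring A] [Ring K] [AddCommGroup M] [Module A M]
  {𝒜 : ZMod 2 → AddSubgroup A} [GradedRing 𝒜]
  {ℳ : ZMod 2 → AddSubgroup M} [DirectSum.Decomposition ℳ]
  {ι : K →+* A} {𝒦 : ZMod 2 → AddSubgroup K} [GradedRing 𝒦]
  {I J : Type*} {q : SuperForm 𝒜 ℳ} {b : Module.Basis ((I ⊕ Fin 2) ⊕ J) A M} {bar : I → I}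

/-- The coefficient `½ Δ(q(n_i, n_{bar i})) q(n_i, n_{bar i})⁻¹` by which `Δ_M` maps the basis vector
`n_i` to a multiple of itself, and `0` for the basis vectors `r_j`. -/
noncomputable def deltaCoeff (q : SuperForm 𝒜 ℳ) (b : Module.Basis ((I ⊕ Fin 2) ⊕ J) A M)
    (bar : I → I) (Δ : AddMonoid.End A) : (I ⊕ Fin 2) ⊕ J → A :=
  Sum.elim (fun s => Ring.inverse (2 : A) *
    Δ (q.toFun (b (.inl s)) (b (.inl (Sum.map bar id s)))) *
      Ring.inverse (q.toFun (b (.inl s)) (b (.inl (Sum.map bar id s))))) fun _ => 0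

theorem deltaSplit_smul (Δ : AddMonoid.End A) (s : (I ⊕ Fin 2) ⊕ J) (c : A) :
    deltaSplit q b bar Δ (c • b s) = (deltaCoeff q b bar Δ s * c + Δ c) • b s := by
  have e : deltaSplit q b bar Δ (c • b s) = (b.repr (c • b s)).sum fun t d => (Sum.elim
      (fun i => Ring.inverse (2 : A) *
        Δ (q.toFun (b (.inl i)) (b (.inl (Sum.map bar id i)))) *
          Ring.inverse (q.toFun (b (.inl i)) (b (.inl (Sum.map bar id i)))) * d + Δ d)
      (fun _ => Δ d) t) • b t := rfl
  rw [e]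
  rw [map_smul, b.repr_self, Finsupp.smul_single, smul_eq_mul, mul_one, Finsupp.sum_single_index]
  · rcases s with s | j
    · rfl
    · simp [deltaCoeff]
  · rcases s with s | j <;> simp

theorem deltaCoeff_add (Δ Δ' : AddMonoid.End A) (s : (I ⊕ Fin 2) ⊕ J) :
    deltaCoeff q b bar (Δ + Δ') s = deltaCoeff q b bar Δ s + deltaCoeff q b bar Δ' s := by
  rcases s with s | j
  · simp [deltaCoeff, mul_add, add_mul]
  · simp [deltaCoeff]

theorem deltaSplit_add (Δ Δ' : AddMonoid.End A) :
    deltaSplit q b bar (Δ + Δ') = deltaSplit q b bar Δ + deltaSplit q b bar Δ' := by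
  refine end_ext_basis 𝒜 b fun s i c _ => ?_
  rw [end_add_apply, deltaSplit_smul, deltaSplit_smul, deltaSplit_smul, deltaCoeff_add, ← add_smul,
    end_add_apply, add_mul]
  exact congrArg (· • b s) (add_add_add_comm _ _ _ _)

/-- `Δ ↦ Δ_M` as an additive map. -/
noncomputable def deltaHom (q : SuperForm 𝒜 ℳ) (b : Module.Basis ((I ⊕ Fin 2) ⊕ J) A M)
    (bar : I → I) : AddMonoid.End A →+ AddMonoid.End M :=
  AddMonoidHom.mk' (deltaSplit q b bar) deltaSplit_add

theorem deltaHom_apply (Δ : AddMonoid.End A) : deltaHom q b bar Δ = deltaSplit q b bar Δ := rfl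

variable (hq : IsSplit q b bar) (hA : IsSupercommutative 𝒜) (h2 : IsUnit (2 : A))

include hq in
theorem deltaCoeff_eq_of (h2 : IsUnit (2 : A)) {Δ : AddMonoid.End A} {s : I ⊕ Fin 2} {x : A}
    (h : (x + x) * q.toFun (b (.inl s)) (b (.inl (Sum.map bar id s))) =
      Δ (q.toFun (b (.inl s)) (b (.inl (Sum.map bar id s))))) :
    deltaCoeff q b bar Δ (.inl s) = x := by
  show Ring.inverse (2 : A) * _ * _ = x
  rw [← h, ← mul_assoc, mul_assoc, Ring.mul_inverse_cancel _ (hq.isUnit s), mul_one]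
  exact half_smul_add_self h2 x

include hq in
theorem deltaCoeff_add_self_mul (h2 : IsUnit (2 : A)) (Δ : AddMonoid.End A) (s : I ⊕ Fin 2) :
    (deltaCoeff q b bar Δ (.inl s) + deltaCoeff q b bar Δ (.inl s)) *
      q.toFun (b (.inl s)) (b (.inl (Sum.map bar id s))) =
        Δ (q.toFun (b (.inl s)) (b (.inl (Sum.map bar id s)))) := by
  show (_ * _ * _ + _ * _ * _) * _ = _
  rw [add_mul, mul_assoc _ (Ring.inverse _) _, Ring.inverse_mul_cancel _ (hq.isUnit s), mul_one,
    ← mul_add]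
  exact half_smul_add_self h2 _

include hq hA h2 in
theorem deltaCoeff_mem {α : ZMod 2} {Δ : AddMonoid.End A} (h : HasDegree (pr 𝒜) α Δ)
    (s : (I ⊕ Fin 2) ⊕ J) : deltaCoeff q b bar Δ s ∈ 𝒜 α := by
  rcases s with s | j
  · have h0 := hq.even hA h2 s
    have := mul_mem_deg (mul_mem_deg (half_mem (𝒜 := 𝒜) h2) (h.mem h0))
      (inverse_mem (hq.isUnit s) h0)
    rwa [add_zero, zero_add, add_zero] at this
  · exact zero_mem _

variable [SetLike.GradedSMul 𝒜 ℳ]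

include hq hA h2 in
theorem hasDegree_deltaSplit {α : ZMod 2} {Δ : AddMonoid.End A} (h : HasDegree (pr 𝒜) α Δ) :
    HasDegree (pr ℳ) α (deltaSplit q b bar Δ) := by
  refine hasDegree_of_basis (𝒜 := 𝒜) b hq.homogeneous fun s i j c hc hs => ?_
  rw [deltaSplit_smul, ← add_assoc]
  exact smul_mem_deg (add_mem (mul_mem_deg (deltaCoeff_mem hq hA h2 h s) hc) (h.mem hc)) hs

include hq hA h2 in
theorem sBr_deltaSplit_lmul {α : ZMod 2} {Δ : AddMonoid.End A} (h : Δ ∈ derAHom 𝒜 ι α) (a : A) :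
    sBr (pr ℳ) (deltaSplit q b bar Δ) (lmul M a) = lmul M (Δ a) := by
  refine induction_deg 𝒜 (P := fun a => sBr (pr ℳ) (deltaSplit q b bar Δ) (lmul M a) =
    lmul M (Δ a)) (fun x y hx hy => ?_) (fun i a ha => ?_) a
  · rw [lmul_add, sBr_add_right, hx, hy, map_add, lmul_add]
  rw [sBr_of_hasDegree (isGrading_pr ℳ) (hasDegree_deltaSplit hq hA h2 h.1) (hasDegree_lmul ha)]
  refine end_ext_basis 𝒜 b fun s j c hc => ?_
  simp only [end_sub_apply, end_zsmul_apply, end_mul_apply, lmul_apply]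
  rw [← mul_smul, deltaSplit_smul, deltaSplit_smul, ← mul_smul, ← mul_smul, ← smul_assoc,
    ← sub_smul, derAHom_leibniz h ha, ← mul_assoc, hA _ _ _ _ (deltaCoeff_mem hq hA h2 h.1 s) ha]
  congr 1
  rw [mul_add, smul_add, smul_mul_assoc, ← mul_assoc]
  abel

theorem mem_endK_of_sBr_lmul (hι : ∀ i, ∀ k ∈ 𝒦 i, ι k ∈ 𝒜 i) {α : ZMod 2} {S : AddMonoid.End M}
    (hd : HasDegree (pr ℳ) α S) (h : ∀ k : K, sBr (pr ℳ) S (lmul M (ι k)) = 0) :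
    S ∈ endK 𝒜 ℳ ι := by
  intro m k
  refine induction_deg 𝒦 (P := fun k => S (rsmul 𝒜 ℳ m (ι k)) = rsmul 𝒜 ℳ (S m) (ι k))
    (fun x y hx hy => ?_) (fun i k hk => ?_) k
  · rw [map_add, rsmul_add_right, map_add, hx, hy, rsmul_add_right]
  · refine map_rsmul_of_map_smul hd (hι i k hk) (fun j m _ => ?_) m
    have e := DFunLike.congr_fun (h k) m
    rw [sBr_of_hasDegree (isGrading_pr ℳ) hd (hasDegree_lmul (hι i k hk))] at e
    exact sub_eq_zero.1 e

include hq hA h2 in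
/-- `Δ_M` is a superderivation of `(M, q)` along `Δ`. -/
theorem isAlong_deltaSplit {α : ZMod 2} {Δ : AddMonoid.End A} (h : Δ ∈ derAHom 𝒜 ι α) :
    IsAlong q α (deltaSplit q b bar Δ) Δ := by
  have hd := hasDegree_deltaSplit hq hA h2 h.1
  refine ⟨hd, sBr_deltaSplit_lmul hq hA h2 h, fun i j m n hm hn => ?_⟩
  rcases subsingleton_or_nontrivial A with hsub | hnon
  · exact Subsingleton.elim _ _
  -- the product rule, extended additively to all of `M` by twisting with the sign `(-1)^(|Δ||m|)`
  let σ : AddMonoid.End M := pr ℳ 0 + kos α 1 • pr ℳ 1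
  have hσ : ∀ {i : ZMod 2} {m : M}, m ∈ ℳ i → σ m = kos α i • m := by
    intro i m hm
    show pr ℳ 0 m + kos α 1 • pr ℳ 1 m = _
    rcases zmod_two_cases i with rfl | rfl
    · rw [pr_of_mem hm, pr_of_mem_ne hm (by decide)]; simp
    · rw [pr_of_mem hm, pr_of_mem_ne hm (by decide)]; simp
  have key : ∀ m n, Δ (q.toFun m n) = q.toFun (deltaSplit q b bar Δ m) n +
      q.toFun (σ m) (deltaSplit q b bar Δ n) := by
    intro m n
    refine basis_induction 𝒜 b (P := fun m => Δ (q.toFun m n) =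
      q.toFun (deltaSplit q b bar Δ m) n + q.toFun (σ m) (deltaSplit q b bar Δ n)) ?_ ?_ ?_ m
    · simp
    · intro x y hx hy
      simp only [map_add, AddMonoidHom.add_apply, hx, hy]
      abel
    intro s k c hc
    refine basis_induction 𝒜 b (P := fun n => Δ (q.toFun (c • b s) n) =
      q.toFun (deltaSplit q b bar Δ (c • b s)) n +
        q.toFun (σ (c • b s)) (deltaSplit q b bar Δ n)) ?_ ?_ ?_ n
    · simp
    · intro x y hx hy
      simp only [map_add, hx, hy]
      abel
    intro t l d hd
    obtain ⟨g, hg⟩ := hq.homogeneous s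
    have hds := add_mem (mul_mem_deg (deltaCoeff_mem hq hA h2 h.1 t) hd) (h.1.mem hd)
    rw [hσ (smul_mem_deg hc hg), deltaSplit_smul, deltaSplit_smul, map_zsmul,
      AddMonoidHom.coe_smul, Pi.smul_apply]
    simp only [q.smul_left hA]
    rw [q.smul_right hA hd hg, q.smul_right hA hds hg]
    by_cases h0 : q.toFun (b s) (b t) = 0
    · simp [h0]
    rcases s with s | j
    swap
    · exact absurd (hq.left_eq_zero t j) h0
    rcases t with t | j
    swap
    · exact absurd (hq.right_eq_zero (.inl s) j) h0
    obtain rfl : t = Sum.map bar id s := by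
      by_contra ht
      exact h0 (hq.eq_zero ht)
    have hcoef : deltaCoeff q b bar Δ (.inl (Sum.map bar id s)) = deltaCoeff q b bar Δ (.inl s) := by
      refine deltaCoeff_eq_of hq h2 ?_
      rw [hq.bar_bar, q.supersymm _ _ _ _ (hq.mem_bar hA h2 hg) hg, map_zsmul,
        ← deltaCoeff_add_self_mul hq h2 Δ s, mul_smul_comm]
    have hu := hq.even hA h2 s
    have e := deltaCoeff_add_self_mul hq h2 Δ s
    rw [hcoef]
    have hγ := deltaCoeff_mem hq hA h2 h.1 (.inl s)
    set u := q.toFun (b (.inl s)) (b (.inl (Sum.map bar id s)))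
    set γ := deltaCoeff q b bar Δ (.inl s)
    -- the remaining identity in `A`
    have e1 : Δ (d * u) = Δ d * u + kos α l • (d * (γ * u) + d * (γ * u)) := by
      rw [derAHom_leibniz h hd, ← e, add_mul, mul_add]
    have e2 : γ * c = kos α k • (c * γ) := hA _ _ _ _ hγ hc
    have e3 : γ * d = kos α l • (d * γ) := hA _ _ _ _ hγ hd
    have e4 : γ * (d * u) = kos α l • (d * (γ * u)) := by
      rw [← mul_assoc, e3, smul_mul_assoc, mul_assoc]
    rw [mul_smul_comm, map_zsmul, derAHom_leibniz h hc, e1, mul_smul_comm, mul_smul_comm,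
      add_mul (γ * c), e2, add_mul (γ * d), e3]
    simp only [kos_add_left, kos_add_right, mul_add, smul_add, smul_mul_assoc, mul_smul_comm,
      mul_smul, kos_comm l g, mul_assoc, e4]
    rcases kos_eq_or α k with h1 | h1 <;> rcases kos_eq_or α l with h3 | h3 <;>
      rcases kos_eq_or α g with h4 | h4 <;> rcases kos_eq_or g l with h5 | h5 <;>
        simp only [h1, h3, h4, h5, one_smul, neg_smul, smul_neg, neg_neg] <;>
          abel
  rw [key, hσ hm, map_zsmul, AddMonoidHom.coe_smul, Pi.smul_apply,
    q.supersymm _ _ _ _ hm (hd.mem hn), smul_smul, kos_add_right, kos_comm i α, ← mul_assoc,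
    kos_mul_self, one_mul]

end Delta

/-! ### The Lie superalgebra `(Der_K A)_M` -/

section DerAM

variable {A : Type u} {K : Type v} {M : Type w} [Ring A] [Ring K] [AddCommGroup M] [Module A M]
  {𝒜 : ZMod 2 → AddSubgroup A} [GradedRing 𝒜]
  {ℳ : ZMod 2 → AddSubgroup M} [DirectSum.Decomposition ℳ]
  {ι : K →+* A} {𝒦 : ZMod 2 → AddSubgroup K} [GradedRing 𝒦]
  {I J : Type*} {q : SuperForm 𝒜 ℳ} {b : Module.Basis ((I ⊕ Fin 2) ⊕ J) A M} {bar : I → I}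
  [SetLike.GradedSMul 𝒜 ℳ] (hq : IsSplit q b bar) (hA : IsSupercommutative 𝒜)
  (h2 : IsUnit (2 : A)) (hι : ∀ i, ∀ k ∈ 𝒦 i, ι k ∈ 𝒜 i)

include hA hι in
theorem mem_derA {Δ : AddMonoid.End A} :
    Δ ∈ derA 𝒜 ι ↔ ∀ α, endComp (pr 𝒜) α Δ ∈ derAHom 𝒜 ι α :=
  (isSuperAlgebra_ring hA hι).mem_der

include hA hι in
theorem isLieSubalgebra_derA :
    IsLieSubalgebra (pr 𝒜) (fun k : K => lmul A (ι k)) (derA 𝒜 ι) :=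
  (isSuperAlgebra_ring hA hι).isLieSubalgebra_der

include hA hι in
theorem derAHom_subset_derA (α : ZMod 2) : derAHom 𝒜 ι α ⊆ derA 𝒜 ι :=
  (isSuperAlgebra_ring hA hι).derHom_subset_der α

theorem derA_one {Δ : AddMonoid.End A} (h : Δ ∈ derA 𝒜 ι) : Δ 1 = 0 := by
  obtain ⟨Δ₀, h₀, Δ₁, h₁, rfl⟩ := h
  show Δ₀ 1 + Δ₁ 1 = 0
  rw [derAHom_one h₀, derAHom_one h₁, add_zero]

include hq hA h2 hι in
theorem deltaSplit_mem_endK {Δ : AddMonoid.End A} (h : Δ ∈ derA 𝒜 ι) :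
    deltaSplit q b bar Δ ∈ endK 𝒜 ℳ ι := by
  obtain ⟨Δ₀, h₀, Δ₁, h₁, rfl⟩ := h
  have key : ∀ {α}, ∀ Δ ∈ derAHom 𝒜 ι α, deltaSplit q b bar Δ ∈ endK 𝒜 ℳ ι := by
    intro α Δ h
    refine mem_endK_of_sBr_lmul hι (hasDegree_deltaSplit hq hA h2 h.1) fun k => ?_
    rw [sBr_deltaSplit_lmul hq hA h2 h, derAHom_map h, lmul_zero]
  show deltaSplit q b bar (Δ₀ + Δ₁) ∈ _
  rw [deltaSplit_add]
  exact (endKSubgroup 𝒜 ℳ ι).add_mem (key _ h₀) (key _ h₁)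

theorem deltaSplit_injOn [Nonempty ((I ⊕ Fin 2) ⊕ J)] :
    Set.InjOn (deltaSplit q b bar) (derA 𝒜 ι) := by
  intro Δ h Δ' h' e
  have key : ∀ s c, deltaCoeff q b bar Δ s * c + Δ c = deltaCoeff q b bar Δ' s * c + Δ' c := by
    intro s c
    refine eq_of_smul_basis_eq b (s := s) ?_
    rw [← deltaSplit_smul, ← deltaSplit_smul, e]
  ext c
  have s := Classical.arbitrary ((I ⊕ Fin 2) ⊕ J)
  have h1 := key s 1
  rw [derA_one h, derA_one h', mul_one, mul_one, add_zero, add_zero] at h1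
  have h3 := key s c
  rw [h1] at h3
  exact add_left_cancel h3

include hq hA h2 in
theorem deltaSplit_endComp {α : ZMod 2} {Δ : AddMonoid.End A} :
    deltaSplit q b bar (endComp (pr 𝒜) α Δ) = endComp (pr ℳ) α (deltaSplit q b bar Δ) := by
  have G := isGrading_pr 𝒜
  have d := fun α => hasDegree_deltaSplit hq hA h2 (hasDegree_endComp G α Δ)
  conv_rhs => rw [← endComp_add_endComp G Δ, deltaSplit_add, endComp_add]
  rcases zmod_two_cases α with rfl | rfl
  · rw [endComp_of_hasDegree (isGrading_pr ℳ) (d 0),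
      endComp_of_ne (isGrading_pr ℳ) (d 1) (by decide), add_zero]
  · rw [endComp_of_hasDegree (isGrading_pr ℳ) (d 1),
      endComp_of_ne (isGrading_pr ℳ) (d 0) (by decide), zero_add]

include hA h2 in
theorem deltaSplit_lmul (a : A) (Δ : AddMonoid.End A) :
    deltaSplit q b bar (lmul A a * Δ) = lmul M a * deltaSplit q b bar Δ := by
  refine end_ext_basis 𝒜 b fun s i c _ => ?_
  have e : deltaCoeff q b bar (lmul A a * Δ) s = a * deltaCoeff q b bar Δ s := by
    rcases s with s | j
    · show _ * (a * _) * _ = a * (_ * _ * _)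
      rw [← mul_assoc, hA.even_comm (half_mem (𝒜 := 𝒜) h2), mul_assoc, mul_assoc, mul_assoc]
      rfl
    · exact (mul_zero a).symm
  rw [end_mul_apply, lmul_apply, deltaSplit_smul, deltaSplit_smul, ← mul_smul, mul_add,
    end_mul_apply, lmul_apply, smul_eq_mul, e, mul_assoc]

include hq hA h2 in
/-- The coefficients of `[Δ, Δ']_M`; on the basis vectors `n_i` they are determined by the
values of `Δ`, `Δ'` and `[Δ, Δ']` on `q(n_i, n_{bar i})`. -/
theorem deltaCoeff_sBr {α β : ZMod 2} {Δ Δ' : AddMonoid.End A} (h : Δ ∈ derAHom 𝒜 ι α)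
    (h' : Δ' ∈ derAHom 𝒜 ι β) (s : (I ⊕ Fin 2) ⊕ J) :
    deltaCoeff q b bar (sBr (pr 𝒜) Δ Δ') s =
      Δ (deltaCoeff q b bar Δ' s) - kos α β • Δ' (deltaCoeff q b bar Δ s) := by
  rcases s with s | j
  swap
  · show (0 : A) = Δ 0 - kos α β • Δ' 0
    simp
  refine deltaCoeff_eq_of hq h2 ?_
  rw [sBr_of_hasDegree (isGrading_pr 𝒜) h.1 h'.1]
  have e := deltaCoeff_add_self_mul hq h2 Δ s
  have e' := deltaCoeff_add_self_mul hq h2 Δ' s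
  have hγ := deltaCoeff_mem hq hA h2 h.1 (.inl s)
  have hγ' := deltaCoeff_mem hq hA h2 h'.1 (.inl s)
  simp only [end_sub_apply, end_zsmul_apply, end_mul_apply]
  set u := q.toFun (b (.inl s)) (b (.inl (Sum.map bar id s)))
  set γ := deltaCoeff q b bar Δ (.inl s)
  set γ' := deltaCoeff q b bar Δ' (.inl s)
  have hc : γ * γ' = kos α β • (γ' * γ) := hA _ _ _ _ hγ hγ'
  rw [← e, ← e', derAHom_leibniz h (add_mem hγ' hγ'), derAHom_leibniz h' (add_mem hγ hγ), ← e,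
    ← e', map_add, map_add]
  simp only [add_mul, mul_add, sub_mul, smul_add, smul_mul_assoc, ← mul_assoc, hc,
    kos_comm β α, kos_smul_smul]
  abel

include hq hA h2 in
theorem deltaSplit_sBr_of_derAHom {α β : ZMod 2} {Δ Δ' : AddMonoid.End A} (h : Δ ∈ derAHom 𝒜 ι α)
    (h' : Δ' ∈ derAHom 𝒜 ι β) : deltaSplit q b bar (sBr (pr 𝒜) Δ Δ') =
      sBr (pr ℳ) (deltaSplit q b bar Δ) (deltaSplit q b bar Δ') := by
  refine end_ext_basis 𝒜 b fun s i c hc => ?_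
  have hγ := deltaCoeff_mem hq hA h2 h.1 s
  have hγ' := deltaCoeff_mem hq hA h2 h'.1 s
  rw [deltaSplit_smul, deltaCoeff_sBr hq hA h2 h h', sBr_of_hasDegree (isGrading_pr 𝒜) h.1 h'.1,
    sBr_of_hasDegree (isGrading_pr ℳ) (hasDegree_deltaSplit hq hA h2 h.1)
      (hasDegree_deltaSplit hq hA h2 h'.1)]
  simp only [end_sub_apply, end_zsmul_apply, end_mul_apply]
  rw [deltaSplit_smul, deltaSplit_smul, deltaSplit_smul, deltaSplit_smul, ← smul_assoc, ← sub_smul]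
  congr 1
  rw [map_add, map_add, derAHom_leibniz h hγ', derAHom_leibniz h' hγ]
  have hcc : deltaCoeff q b bar Δ s * deltaCoeff q b bar Δ' s =
    kos α β • (deltaCoeff q b bar Δ' s * deltaCoeff q b bar Δ s) := hA _ _ _ _ hγ hγ'
  simp only [mul_add, sub_mul, smul_add, smul_mul_assoc, ← mul_assoc, hcc,
    kos_comm β α, kos_smul_smul]
  abel

include hq hA h2 hι in
/-- `Δ ↦ Δ_M` is a monomorphism of Lie superalgebras. -/
theorem isLieMono_deltaSplit : IsLieMono (pr 𝒜) (fun k : K => lmul A (ι k)) (pr ℳ)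
    (fun k : K => lmul M (ι k)) (derA 𝒜 ι) (deltaSplit q b bar) where
  source := isLieSubalgebra_derA hA hι
  injOn := by
    have : Nonempty ((I ⊕ Fin 2) ⊕ J) := ⟨.inl (.inr 0)⟩
    exact deltaSplit_injOn
  map_add f _ g _ := deltaSplit_add f g
  map_smul k f _ := deltaSplit_lmul hA h2 (ι k) f
  map_comp α f _ := deltaSplit_endComp hq hA h2
  map_bracket f hf g hg := by
    rw [sBr_comp_comp (isGrading_pr 𝒜), sBr_comp_comp (isGrading_pr ℳ)]
    simp only [← deltaHom_apply, map_sum]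
    refine Finset.sum_congr rfl fun i _ => Finset.sum_congr rfl fun j _ => ?_
    rw [deltaHom_apply, deltaHom_apply, deltaHom_apply, ← deltaSplit_endComp hq hA h2,
      ← deltaSplit_endComp hq hA h2]
    exact deltaSplit_sBr_of_derAHom hq hA h2 ((mem_derA hA hι).1 hf i) ((mem_derA hA hι).1 hg j)

theorem deltaSplit_zero : deltaSplit q b bar 0 = 0 := map_zero (deltaHom q b bar)

include hA h2 hι in
theorem isLieSubalgebra_derAM (hq : IsSplit q b bar) :
    IsLieSubalgebra (pr ℳ) (fun k : K => lmul M (ι k)) (derAM ι q b bar) := by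
  have mono := isLieMono_deltaSplit hq hA h2 hι
  have hX := mono.source
  constructor
  · exact ⟨0, hX.zero_mem, deltaSplit_zero⟩
  · rintro _ ⟨f, hf, rfl⟩ _ ⟨g, hg, rfl⟩
    exact ⟨_, hX.add_mem f hf g hg, mono.map_add f hf g hg⟩
  · rintro _ ⟨f, hf, rfl⟩
    exact ⟨-f, hX.neg_mem f hf, map_neg (deltaHom q b bar) f⟩
  · rintro α _ ⟨f, hf, rfl⟩
    exact ⟨_, hX.comp_mem α f hf, mono.map_comp α f hf⟩
  · rintro k _ ⟨f, hf, rfl⟩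
    exact ⟨_, hX.smul_mem k f hf, mono.map_smul k f hf⟩
  · rintro _ ⟨f, hf, rfl⟩ _ ⟨g, hg, rfl⟩
    exact ⟨_, hX.bracket_mem f hf g hg, mono.map_bracket f hf g hg⟩

include hq hA h2 in
/-- `Δ_M` is `A`-linear only for `Δ = 0`. -/
theorem eq_zero_of_deltaSplit_mem_endA {Δ : AddMonoid.End A} (h : Δ ∈ derA 𝒜 ι)
    (hE : deltaSplit q b bar Δ ∈ endA 𝒜 ℳ) : Δ = 0 := by
  ext c
  have hn := hq.even_two hA h2 0
  have e := hE (b (.inl (.inr 0))) c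
  have hγ : deltaSplit q b bar Δ (b (.inl (.inr 0))) =
      deltaCoeff q b bar Δ (.inl (.inr 0)) • b (.inl (.inr 0)) := by
    conv_lhs => rw [← one_smul A (b (.inl (.inr 0)))]
    rw [deltaSplit_smul, mul_one, derA_one h, add_zero]
  rw [rsmul_of_even hn, deltaSplit_smul, hγ, ← lmul_apply (deltaCoeff _ _ _ _ _),
    ← lmul_mem_endA hA, rsmul_of_even hn, lmul_apply, ← mul_smul, add_smul] at e
  exact eq_zero_of_smul_basis_eq_zero b (add_eq_left.1 e)

include hq hA h2 hι in
theorem inter_derAM {X : Set (AddMonoid.End M)} (h0 : 0 ∈ X) (hX : X ⊆ endA 𝒜 ℳ) :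
    X ∩ derAM ι q b bar = {0} := by
  refine Set.Subset.antisymm ?_ (Set.singleton_subset_iff.2
    ⟨h0, (isLieSubalgebra_derAM hA h2 hι hq).zero_mem⟩)
  rintro _ ⟨hx, Δ, hΔ, rfl⟩
  rw [Set.mem_singleton_iff, eq_zero_of_deltaSplit_mem_endA hq hA h2 hΔ (hX hx), deltaSplit_zero]

variable (E : OspSubalgebra ι q) (hinj : Function.Injective (lmul M : A → AddMonoid.End M))

include hq hA h2 hι hinj in
/-- The homogeneous superderivations of `(M, q)` are the sums of an element of `osp(q)` and some
`Δ_M`. -/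
theorem IsAlong.mem_osp_add {α : ZMod 2} {S : AddMonoid.End M} {Δ : AddMonoid.End A}
    (h : IsAlong q α S Δ) (hS : S ∈ endK 𝒜 ℳ ι) :
    Δ ∈ derAHom 𝒜 ι α ∧ S - deltaSplit q b bar Δ ∈ osp q := by
  have hk : ∀ k : K, Δ (ι k) = 0 := fun k => hinj (by
    rw [← h.sBr_lmul, sBr_lmul_of_mem_endK hι h.deg hS, lmul_zero])
  have hΔ : Δ ∈ derAHom 𝒜 ι α := by
    refine ⟨h.hasDegree hinj, fun k a => ?_, fun i x y hx => h.leibniz hinj (pr_eq_iff.1 hx) y⟩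
    refine induction_deg 𝒜 (P := fun a => Δ (a * ι k) = Δ a * ι k) (fun x y hx hy => ?_)
      (fun i a ha => ?_) a
    · rw [add_mul, map_add, hx, hy, map_add, add_mul]
    · rw [h.leibniz hinj ha, hk, mul_zero, smul_zero, add_zero]
  refine ⟨hΔ, ?_⟩
  have := h.sub (isAlong_deltaSplit hq hA h2 hΔ)
  rw [sub_self] at this
  exact this.mem_osp

include hq hA h2 hι hinj in
theorem sAlg_eq_normIn : sAlg E = normIn E (osp q + derAM ι q b bar) := by
  have G := isGrading_pr ℳ
  ext S
  constructor
  · intro hS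
    refine ⟨?_, sAlg_normalizes E hinj hS⟩
    have hc := (mem_sAlg_iff E hinj).1 hS
    have key : ∀ α, ∃ Δ ∈ derA 𝒜 ι, endComp (pr ℳ) α S - deltaSplit q b bar Δ ∈ osp q := by
      intro α
      obtain ⟨hK, ⟨Δ, h⟩, -⟩ := (mem_sHom_iff E hinj).1 (hc α)
      obtain ⟨hΔ, h⟩ := h.mem_osp_add hq hA h2 hι hinj hK
      exact ⟨Δ, derAHom_subset_derA hA hι α hΔ, h⟩
    obtain ⟨Δ₀, h₀, e₀⟩ := key 0
    obtain ⟨Δ₁, h₁, e₁⟩ := key 1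
    refine ⟨_, (ospSubgroup q).add_mem e₀ e₁, _,
      ⟨Δ₀ + Δ₁, (isLieSubalgebra_derA hA hι).add_mem _ h₀ _ h₁, rfl⟩, ?_⟩
    show _ + deltaSplit q b bar (Δ₀ + Δ₁) = S
    rw [deltaSplit_add]
    conv_rhs => rw [← endComp_add_endComp G S]
    abel
  · rintro ⟨⟨x, hx, _, ⟨Δ, hΔ, rfl⟩, rfl⟩, hN⟩
    replace hN : ∀ y ∈ E.carrier, sBr (pr ℳ) (x + deltaSplit q b bar Δ) y ∈ E.carrier := hN
    show x + deltaSplit q b bar Δ ∈ _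
    refine (mem_sAlg_iff E hinj).2 fun α => (mem_sHom_iff E hinj).2 ⟨?_, ?_, ?_⟩
    · rw [endComp_add, ← deltaSplit_endComp hq hA h2]
      refine (endKSubgroup 𝒜 ℳ ι).add_mem (fun m k => (endComp_mem_osp hx α).1 m (ι k))
        (deltaSplit_mem_endK hq hA h2 hι ((isLieSubalgebra_derA hA hι).comp_mem α Δ hΔ))
    · rw [endComp_add, ← deltaSplit_endComp hq hA h2]
      exact ⟨_, (isAlong_of_mem_osp (endComp_mem_osp hx α) (hasDegree_endComp G α x)).add
        (isAlong_deltaSplit hq hA h2 ((mem_derA hA hι).1 hΔ α))⟩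
    · intro y hy
      generalize x + deltaSplit q b bar Δ = S at hN
      have key : ∀ β, sBr (pr ℳ) (endComp (pr ℳ) α S) (endComp (pr ℳ) β y) ∈ E.carrier := by
        intro β
        have hβ := hasDegree_endComp G β y
        have h1 := E.comp_mem (α + β) _ (hN _ (E.comp_mem β y hy))
        rw [← endComp_add_endComp G S, sBr_add_left, endComp_add] at h1
        have d := fun γ => hasDegree_sBr G (hasDegree_endComp G γ S) hβ
        rcases zmod_two_cases α with rfl | rfl
        · rwa [endComp_of_hasDegree G (d 0), endComp_of_ne G (d 1)
            (fun e => absurd (add_right_cancel e) (by decide)), add_zero] at h1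
        · rwa [endComp_of_hasDegree G (d 1), endComp_of_ne G (d 0)
            (fun e => absurd (add_right_cancel e) (by decide)), zero_add] at h1
      rw [← endComp_add_endComp G y, sBr_add_right]
      exact E.carrier.add_mem (key 0) (key 1)

end DerAM

/-! ### The radical `R` and the decomposition of `osp(q)` -/

section Radical

/-- The sum of two Lie superalgebras, one of which normalizes the other, is a Lie superalgebra. -/
theorem isLieSubalgebra_add {L K : Type*} [AddCommGroup L] {π : ZMod 2 → AddMonoid.End L}
    {l : K → AddMonoid.End L} {X Y : Set (AddMonoid.End L)} (hX : IsLieSubalgebra π l X)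
    (hY : IsLieSubalgebra π l Y) (h : ∀ x ∈ X, ∀ y ∈ Y, sBr π x y ∈ X ∧ sBr π y x ∈ X) :
    IsLieSubalgebra π l (X + Y) where
  zero_mem := ⟨0, hX.zero_mem, 0, hY.zero_mem, add_zero 0⟩
  add_mem := by
    rintro _ ⟨x, hx, y, hy, rfl⟩ _ ⟨x', hx', y', hy', rfl⟩
    exact ⟨_, hX.add_mem x hx x' hx', _, hY.add_mem y hy y' hy', add_add_add_comm _ _ _ _⟩
  neg_mem := by
    rintro _ ⟨x, hx, y, hy, rfl⟩
    exact ⟨_, hX.neg_mem x hx, _, hY.neg_mem y hy, (neg_add x y).symm⟩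
  comp_mem := by
    rintro α _ ⟨x, hx, y, hy, rfl⟩
    exact ⟨_, hX.comp_mem α x hx, _, hY.comp_mem α y hy, (endComp_add α x y).symm⟩
  smul_mem := by
    rintro k _ ⟨x, hx, y, hy, rfl⟩
    exact ⟨_, hX.smul_mem k x hx, _, hY.smul_mem k y hy, (mul_add (l k) x y).symm⟩
  bracket_mem := by
    rintro _ ⟨x, hx, y, hy, rfl⟩ _ ⟨x', hx', y', hy', rfl⟩
    refine ⟨_, hX.add_mem _ (hX.add_mem _ (hX.bracket_mem x hx x' hx') _ (h x hx y' hy').1) _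
      (h x' hx' y hy).2, _, hY.bracket_mem y hy y' hy', ?_⟩
    show sBr π x x' + sBr π x y' + sBr π y x' + sBr π y y' = sBr π (x + y) (x' + y')
    rw [sBr_add_left, sBr_add_right, sBr_add_right]
    abel

theorem endComp_mul_of_degree_zero {L : Type*} [AddCommGroup L] {π : ZMod 2 → AddMonoid.End L}
    (G : IsGrading π) {g : AddMonoid.End L} (hg : HasDegree π 0 g) (α : ZMod 2)
    (f : AddMonoid.End L) : endComp π α (f * g) = endComp π α f * g := by
  have d : ∀ α, HasDegree π α (endComp π α f * g) := fun α => by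
    simpa using (hasDegree_endComp G α f).mul hg
  conv_lhs => rw [← endComp_add_endComp G f, add_mul, endComp_add]
  rcases zmod_two_cases α with rfl | rfl
  · rw [endComp_of_hasDegree G (d 0), endComp_of_ne G (d 1) (by decide), add_zero]
  · rw [endComp_of_hasDegree G (d 1), endComp_of_ne G (d 0) (by decide), zero_add]

theorem endComp_degree_zero_mul {L : Type*} [AddCommGroup L] {π : ZMod 2 → AddMonoid.End L}
    (G : IsGrading π) {g : AddMonoid.End L} (hg : HasDegree π 0 g) (α : ZMod 2)
    (f : AddMonoid.End L) : endComp π α (g * f) = g * endComp π α f := by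
  have d : ∀ α, HasDegree π α (g * endComp π α f) := fun α => by
    simpa using hg.mul (hasDegree_endComp G α f)
  conv_lhs => rw [← endComp_add_endComp G f, mul_add, endComp_add]
  rcases zmod_two_cases α with rfl | rfl
  · rw [endComp_of_hasDegree G (d 0), endComp_of_ne G (d 1) (by decide), add_zero]
  · rw [endComp_of_hasDegree G (d 1), endComp_of_ne G (d 0) (by decide), zero_add]

variable {A : Type u} {K : Type v} {M : Type w} [Ring A] [Ring K] [AddCommGroup M] [Module A M]
  {𝒜 : ZMod 2 → AddSubgroup A} [GradedRing 𝒜]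
  {ℳ : ZMod 2 → AddSubgroup M} [DirectSum.Decomposition ℳ]
  {ι : K →+* A} {𝒦 : ZMod 2 → AddSubgroup K} [GradedRing 𝒦]

/-- The projection of `M = N ⊕ R` onto `R`, for a basis of `M` adapted to this decomposition. -/
noncomputable def projR {N J : Type*} (b : Module.Basis (N ⊕ J) A M) : AddMonoid.End M :=
  (b.constr ℕ (Sum.elim (fun _ => 0) fun j => b (.inr j))).toAddMonoidHom

section Proj

variable {N J : Type*} (b : Module.Basis (N ⊕ J) A M)

theorem projR_smul (c : A) (m : M) : projR b (c • m) = c • projR b m :=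
  map_smul (b.constr ℕ (Sum.elim (fun _ => 0) fun j => b (.inr j))) c m

theorem projR_inl (s : N) : projR b (b (.inl s)) = 0 :=
  b.constr_basis ℕ _ (.inl s)

theorem projR_inr (j : J) : projR b (b (.inr j)) = b (.inr j) :=
  b.constr_basis ℕ _ (.inr j)

theorem projR_mul_self (𝒜 : ZMod 2 → AddSubgroup A) [GradedRing 𝒜] :
    projR b * projR b = projR b := by
  refine end_ext_basis 𝒜 b fun s i c _ => ?_
  rw [end_mul_apply, projR_smul]
  rcases s with s | j
  · rw [projR_inl, smul_zero, map_zero]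
  · rw [projR_inr, projR_smul, projR_inr]

theorem mem_span_inl_iff (𝒜 : ZMod 2 → AddSubgroup A) [GradedRing 𝒜] {m : M} :
    m ∈ Submodule.span A (Set.range fun s => b (.inl s)) ↔ projR b m = 0 := by
  constructor
  · intro h
    refine Submodule.span_induction (p := fun m _ => projR b m = 0) ?_ (map_zero _) ?_ ?_ h
    · rintro _ ⟨s, rfl⟩
      exact projR_inl b s
    · intro x y _ _ hx hy
      rw [map_add, hx, hy, add_zero]
    · intro c x _ hx
      rw [projR_smul, hx, smul_zero]
  · intro h
    have key : m - projR b m ∈ Submodule.span A (Set.range fun s => b (.inl s)) := by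
      refine basis_induction 𝒜 b (P := fun m => m - projR b m ∈
        Submodule.span A (Set.range fun s => b (.inl s))) ?_ ?_ ?_ m
      · simp
      · intro x y hx hy
        rw [map_add, add_sub_add_comm]
        exact add_mem hx hy
      · rintro (s | j) i c -
        · rw [projR_smul, projR_inl, smul_zero, sub_zero]
          exact Submodule.smul_mem _ _ (Submodule.subset_span ⟨s, rfl⟩)
        · rw [projR_smul, projR_inr, sub_self]
          exact zero_mem _
    rwa [h, sub_zero] at key

theorem mem_span_inr_iff (𝒜 : ZMod 2 → AddSubgroup A) [GradedRing 𝒜] {m : M} :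
    m ∈ Submodule.span A (Set.range fun j => b (.inr j)) ↔ projR b m = m := by
  constructor
  · intro h
    refine Submodule.span_induction (p := fun m _ => projR b m = m) ?_ (map_zero _) ?_ ?_ h
    · rintro _ ⟨j, rfl⟩
      exact projR_inr b j
    · intro x y _ _ hx hy
      rw [map_add, hx, hy]
    · intro c x _ hx
      rw [projR_smul, hx]
  · intro h
    rw [← h]
    refine basis_induction 𝒜 b (P := fun m => projR b m ∈
      Submodule.span A (Set.range fun j => b (.inr j))) ?_ ?_ ?_ m
    · simp
    · intro x y hx hy
      rw [map_add]
      exact add_mem hx hy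
    · rintro (s | j) i c -
      · rw [projR_smul, projR_inl, smul_zero]
        exact zero_mem _
      · rw [projR_smul, projR_inr]
        exact Submodule.smul_mem _ _ (Submodule.subset_span ⟨j, rfl⟩)

/-- `End_A R` in terms of the projection onto `R`. -/
theorem mem_endR_iff {f : AddMonoid.End M} : f ∈ endR 𝒜 ℳ b ↔
    f ∈ endA 𝒜 ℳ ∧ f * projR b = f ∧ projR b * f = f := by
  refine and_congr Iff.rfl (and_congr ⟨fun h => ?_, fun h m hm => ?_⟩
    ⟨fun h => ?_, fun h m => ?_⟩)
  · ext m
    have e := h (m - projR b m) ((mem_span_inl_iff b 𝒜).2 (by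
      rw [map_sub, ← end_mul_apply, projR_mul_self b 𝒜, sub_self]))
    rw [map_sub, sub_eq_zero] at e
    exact e.symm
  · rw [← h, end_mul_apply, (mem_span_inl_iff b 𝒜).1 hm, map_zero]
  · ext m
    exact (mem_span_inr_iff b 𝒜).1 (h m)
  · refine (mem_span_inr_iff b 𝒜).2 ?_
    rw [← end_mul_apply, h]

variable [SetLike.GradedSMul 𝒜 ℳ]

theorem hasDegree_projR (𝒜 : ZMod 2 → AddSubgroup A) [GradedRing 𝒜] [SetLike.GradedSMul 𝒜 ℳ]
    (hb : ∀ s, ∃ α, b s ∈ ℳ α) : HasDegree (pr ℳ) 0 (projR b) := by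
  refine hasDegree_of_basis (𝒜 := 𝒜) b hb fun s i j c hc hs => ?_
  rw [zero_add, projR_smul]
  rcases s with s | k
  · rw [projR_inl, smul_zero]
    exact zero_mem _
  · rw [projR_inr]
    exact smul_mem_deg hc hs

theorem projR_mem_endA (hb : ∀ s, ∃ α, b s ∈ ℳ α) : projR b ∈ endA 𝒜 ℳ :=
  mem_endA_of_map_smul (hasDegree_projR b 𝒜 hb) fun i a _ j m _ => by
    rw [kos_zero_left, one_smul, projR_smul]

theorem isLieSubalgebra_endR (hA : IsSupercommutative 𝒜) (hb : ∀ s, ∃ α, b s ∈ ℳ α) :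
    IsLieSubalgebra (pr ℳ) (fun k : K => lmul M (ι k)) (endR 𝒜 ℳ b) := by
  have G := isGrading_pr ℳ
  have hρ := hasDegree_projR b 𝒜 hb
  have comp : ∀ α, ∀ f ∈ endR 𝒜 ℳ b, endComp (pr ℳ) α f ∈ endR 𝒜 ℳ b := by
    intro α f hf
    obtain ⟨h1, h2, h3⟩ := (mem_endR_iff b).1 hf
    refine (mem_endR_iff b).2 ⟨endComp_mem_endA h1 α, ?_, ?_⟩
    · rw [← endComp_mul_of_degree_zero G hρ, h2]
    · rw [← endComp_degree_zero_mul G hρ, h3]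
  refine ⟨?_, ?_, ?_, comp, ?_, ?_⟩
  · exact (mem_endR_iff b).2 ⟨(endASubgroup 𝒜 ℳ).zero_mem, zero_mul _, mul_zero _⟩
  · intro f hf g hg
    obtain ⟨h1, h2, h3⟩ := (mem_endR_iff b).1 hf
    obtain ⟨h1', h2', h3'⟩ := (mem_endR_iff b).1 hg
    exact (mem_endR_iff b).2 ⟨(endASubgroup 𝒜 ℳ).add_mem h1 h1', by rw [add_mul, h2, h2'],
      by rw [mul_add, h3, h3']⟩
  · intro f hf
    obtain ⟨h1, h2, h3⟩ := (mem_endR_iff b).1 hf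
    exact (mem_endR_iff b).2 ⟨(endASubgroup 𝒜 ℳ).neg_mem h1, by rw [neg_mul, h2],
      by rw [mul_neg, h3]⟩
  · intro k f hf
    obtain ⟨h1, h2, h3⟩ := (mem_endR_iff b).1 hf
    refine (mem_endR_iff b).2 ⟨mul_mem_endA (lmul_mem_endA hA _) h1, by rw [mul_assoc, h2], ?_⟩
    ext m
    show projR b (ι k • f m) = ι k • f m
    rw [projR_smul, ← end_mul_apply, h3]
  · intro f hf g hg
    have e := fun i j => sBr_of_hasDegree G (hasDegree_endComp G i f) (hasDegree_endComp G j g)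
    have hf' := fun i => (mem_endR_iff b).1 (comp i f hf)
    have hg' := fun i => (mem_endR_iff b).1 (comp i g hg)
    refine (mem_endR_iff b).2 ⟨sBr_mem_endA ((mem_endR_iff b).1 hf).1 ((mem_endR_iff b).1 hg).1,
      ?_, ?_⟩
    · rw [sBr_comp_comp G, Finset.sum_mul]
      refine Finset.sum_congr rfl fun i _ => ?_
      rw [Finset.sum_mul]
      refine Finset.sum_congr rfl fun j _ => ?_
      rw [e, sub_mul, smul_mul_assoc, mul_assoc, mul_assoc, (hf' i).2.1, (hg' j).2.1]
    · rw [sBr_comp_comp G, Finset.mul_sum]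
      refine Finset.sum_congr rfl fun i _ => ?_
      rw [Finset.mul_sum]
      refine Finset.sum_congr rfl fun j _ => ?_
      rw [e, mul_sub, mul_smul_comm, ← mul_assoc, ← mul_assoc, (hf' i).2.2, (hg' j).2.2]

end Proj

end Radical

section RadicalForm

variable {A : Type u} {K : Type v} {M : Type w} [Ring A] [Ring K] [AddCommGroup M] [Module A M]
  {𝒜 : ZMod 2 → AddSubgroup A} [GradedRing 𝒜]
  {ℳ : ZMod 2 → AddSubgroup M} [DirectSum.Decomposition ℳ]
  {ι : K →+* A} {𝒦 : ZMod 2 → AddSubgroup K} [GradedRing 𝒦]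
  {I J : Type*} {q : SuperForm 𝒜 ℳ} {b : Module.Basis ((I ⊕ Fin 2) ⊕ J) A M} {bar : I → I}
  [SetLike.GradedSMul 𝒜 ℳ] (hq : IsSplit q b bar) (hA : IsSupercommutative 𝒜)
  (h2 : IsUnit (2 : A)) (hι : ∀ i, ∀ k ∈ 𝒦 i, ι k ∈ 𝒜 i)

theorem repr_projR_inr {N : Type*} (b : Module.Basis (N ⊕ J) A M) (𝒜 : ZMod 2 → AddSubgroup A)
    [GradedRing 𝒜] (m : M) (j : J) : b.repr (projR b m) (.inr j) = b.repr m (.inr j) := by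
  refine basis_induction 𝒜 b (P := fun m => b.repr (projR b m) (.inr j) = b.repr m (.inr j))
    (by simp) (fun x y hx hy => ?_) (fun s i c _ => ?_) m
  · rw [map_add, map_add, map_add, Finsupp.add_apply, hx, hy, Finsupp.add_apply]
  · rcases s with s | k
    · rw [projR_smul, projR_inl]; simp
    · rw [projR_smul, projR_inr]

theorem repr_projR_inl {N : Type*} (b : Module.Basis (N ⊕ J) A M) (𝒜 : ZMod 2 → AddSubgroup A)
    [GradedRing 𝒜] (m : M) (s : N) : b.repr (projR b m) (.inl s) = 0 := by
  refine basis_induction 𝒜 b (P := fun m => b.repr (projR b m) (.inl s) = 0)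
    (by simp) (fun x y hx hy => ?_) (fun s i c _ => ?_) m
  · rw [map_add, map_add, Finsupp.add_apply, hx, hy, add_zero]
  · rcases s with s | k
    · rw [projR_smul, projR_inl]; simp
    · rw [projR_smul, projR_inr]; simp

include hq hA in
theorem form_inr_left (j : J) (n : M) : q.toFun (b (.inr j)) n = 0 := by
  obtain ⟨i, hi⟩ := hq.homogeneous (.inr j)
  refine basis_induction 𝒜 b (P := fun n => q.toFun (b (.inr j)) n = 0) (map_zero _)
    (fun x y hx hy => by rw [map_add, hx, hy, add_zero]) (fun s k c hc => ?_) n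
  rw [q.smul_right hA hc hi, hq.left_eq_zero, mul_zero, smul_zero]

include hq hA in
theorem form_projR_left (m n : M) : q.toFun (projR b m) n = 0 := by
  refine basis_induction 𝒜 b (P := fun m => q.toFun (projR b m) n = 0) (by simp)
    (fun x y hx hy => by rw [map_add, map_add, AddMonoidHom.add_apply, hx, hy, add_zero])
    (fun s k c _ => ?_) m
  rcases s with s | j
  · rw [projR_smul, projR_inl]; simp
  · rw [projR_smul, projR_inr, q.smul_left hA, form_inr_left hq hA, mul_zero]

include hq hA in
theorem form_projR_right (m n : M) : q.toFun m (projR b n) = 0 := by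
  have hρ := hasDegree_projR b 𝒜 hq.homogeneous
  refine induction_deg ℳ (P := fun m => q.toFun m (projR b n) = 0)
    (fun x y hx hy => by rw [map_add, AddMonoidHom.add_apply, hx, hy, add_zero])
    (fun i m hm => ?_) m
  refine induction_deg ℳ (P := fun n => q.toFun m (projR b n) = 0)
    (fun x y hx hy => by rw [map_add, map_add, hx, hy, add_zero]) (fun j n hn => ?_) n
  rw [q.supersymm _ _ _ _ hm (hρ.mem hn), form_projR_left hq hA, smul_zero]

include hq hA in
/-- The form reads off the coordinates with respect to the basis of `N`. -/
theorem form_basis_bar (m : M) (s : I ⊕ Fin 2) :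
    q.toFun m (b (.inl (Sum.map bar id s))) =
      b.repr m (.inl s) * q.toFun (b (.inl s)) (b (.inl (Sum.map bar id s))) := by
  rcases subsingleton_or_nontrivial A with hs | hs
  · exact Subsingleton.elim _ _
  refine basis_induction 𝒜 b (P := fun m => q.toFun m (b (.inl (Sum.map bar id s))) =
      b.repr m (.inl s) * q.toFun (b (.inl s)) (b (.inl (Sum.map bar id s)))) (by simp)
    (fun x y hx hy => ?_) (fun t k c _ => ?_) m
  · rw [map_add, AddMonoidHom.add_apply, hx, hy, map_add, Finsupp.add_apply, add_mul]
  rw [q.smul_left hA, map_smul, b.repr_self, Finsupp.smul_single, smul_eq_mul, mul_one]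
  rcases t with t | j
  · rcases eq_or_ne s t with rfl | h
    · rw [Finsupp.single_eq_same]
    · rw [Finsupp.single_eq_of_ne (by simpa using h), zero_mul, hq.eq_zero, mul_zero]
      intro e
      have := congrArg (Sum.map bar id) e
      rw [hq.bar_bar, hq.bar_bar] at this
      exact h this
  · rw [Finsupp.single_eq_of_ne (by simp), zero_mul, hq.left_eq_zero, mul_zero]

include hq hA in
/-- `R` is the radical of the form. -/
theorem projR_eq_self_of_form_eq_zero {m : M} (h : ∀ n, q.toFun m n = 0) : projR b m = m := by
  refine b.repr.injective (Finsupp.ext fun s => ?_)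
  rcases s with s | j
  · have e := form_basis_bar hq hA m s
    rw [h, eq_comm, (hq.isUnit s).mul_left_eq_zero] at e
    rw [repr_projR_inl b 𝒜, e]
  · exact repr_projR_inr b 𝒜 m j

include hq hA in
/-- A superderivation of the quadratic module preserves the radical `R`. -/
theorem IsAlong.projR_mul_mul {α : ZMod 2} {S : AddMonoid.End M} {Δ : AddMonoid.End A}
    (h : IsAlong q α S Δ) : projR b * (S * projR b) = S * projR b := by
  have hρ := hasDegree_projR b 𝒜 hq.homogeneous
  refine end_ext_of_mem (ℳ := ℳ) fun i m hm => projR_eq_self_of_form_eq_zero hq hA fun n => ?_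
  refine induction_deg ℳ (P := fun n => q.toFun (S (projR b m)) n = 0)
    (fun x y hx hy => by rw [map_add, hx, hy, add_zero]) (fun j n hn => ?_) n
  have e := h.form' (hρ.mem hm) hn
  rw [form_projR_left hq hA, form_projR_left hq hA, map_zero, smul_zero, add_zero] at e
  exact e.symm

include hq hA in
theorem projR_mul_mul_of_mem_osp {x : AddMonoid.End M} (hx : x ∈ osp q) :
    projR b * (x * projR b) = x * projR b := by
  have G := isGrading_pr ℳ
  have key := fun β => (isAlong_of_mem_osp (endComp_mem_osp hx β)
    (hasDegree_endComp G β x)).projR_mul_mul hq hA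
  rw [← endComp_add_endComp G x, add_mul, mul_add, key, key]

/-- The elements of `osp(q)` which vanish on `R`. Every such element is a pointwise finite sum of
elements of `eosp(q)`, and they form a complement of `End_A R` in `osp(q)`. -/
def ospN {N : Type*} (q : SuperForm 𝒜 ℳ) (b : Module.Basis (N ⊕ J) A M) :
    AddSubgroup (AddMonoid.End M) where
  carrier := {x | x ∈ osp q ∧ x * projR b = 0}
  zero_mem' := ⟨(ospSubgroup q).zero_mem, zero_mul _⟩
  add_mem' := fun hx hy => ⟨(ospSubgroup q).add_mem hx.1 hy.1, by rw [add_mul, hx.2, hy.2, add_zero]⟩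
  neg_mem' := fun hx => ⟨(ospSubgroup q).neg_mem hx.1, by rw [neg_mul, hx.2, neg_zero]⟩

include hq hA in
theorem endR_subset_osp : endR 𝒜 ℳ b ⊆ osp q := by
  intro f hf
  obtain ⟨h1, h2, h3⟩ := (mem_endR_iff b).1 hf
  refine ⟨h1, fun i j m n _ _ => ?_⟩
  rw [← h3, end_mul_apply, end_mul_apply, form_projR_left hq hA, form_projR_left hq hA, smul_zero,
    add_zero]

include hq hA in
/-- The summand of `x ∈ osp(q)` in `End_A R` is its restriction to `R`. -/
theorem osp_eq_add : osp q = (ospN q b : Set (AddMonoid.End M)) + endR 𝒜 ℳ b := by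
  refine Set.Subset.antisymm (fun x hx => ?_) ?_
  · have hR : x * projR b ∈ endR 𝒜 ℳ b := (mem_endR_iff b).2
      ⟨mul_mem_endA hx.1 (projR_mem_endA b hq.homogeneous),
        by rw [mul_assoc, projR_mul_self b 𝒜], projR_mul_mul_of_mem_osp hq hA hx⟩
    refine ⟨x - x * projR b, ⟨(ospSubgroup q).sub_mem hx (endR_subset_osp hq hA hR), ?_⟩, _, hR,
      sub_add_cancel _ _⟩
    rw [sub_mul, mul_assoc, projR_mul_self b 𝒜, sub_self]
  · rintro _ ⟨x, hx, y, hy, rfl⟩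
    exact (ospSubgroup q).add_mem hx.1 (endR_subset_osp hq hA hy)

include hq hA in
theorem elem_apply_projR (m n p : M) : elem q m n (projR b p) = 0 := by
  have hρ := hasDegree_projR b 𝒜 hq.homogeneous
  refine induction_deg ℳ (P := fun p => elem q m n (projR b p) = 0)
    (fun x y hx hy => by rw [map_add, map_add, hx, hy, add_zero]) (fun i p hp => ?_) p
  have e : ∀ j, q.toFun m (pr ℳ j (projR b p)) = 0 := by
    intro j
    rcases eq_or_ne i j with rfl | h
    · have := hρ.mem hp
      rw [zero_add] at this
      rw [pr_of_mem this, form_projR_right hq hA]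
    · have := hρ.mem hp
      rw [zero_add] at this
      rw [pr_of_mem_ne this h, map_zero]
  show rsmul 𝒜 ℳ m (q.toFun n (projR b p))
      - ∑ i, ∑ j, kos i j • (q.toFun m (pr ℳ j (projR b p)) • pr ℳ i n) = _
  simp only [e, form_projR_right hq hA, rsmul_zero_right, zero_smul, smul_zero,
    Finset.sum_const_zero, sub_zero]

include hq hA in
theorem eosp_le_ospN : eosp q ≤ ospN q b := by
  refine (AddSubgroup.closure_le _).2 ?_
  rintro _ ⟨m, n, rfl⟩
  exact ⟨elem_mem_osp hA q m n, AddMonoidHom.ext fun p => elem_apply_projR hq hA m n p⟩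

theorem mem_osp_of_locally {x : AddMonoid.End M}
    (h : ∀ F : Finset M, ∃ y ∈ osp q, ∀ m ∈ F, x m = y m) : x ∈ osp q := by
  classical
  refine ⟨fun m a => ?_, fun i j m n hm hn => ?_⟩
  · obtain ⟨y, hy, e⟩ := h {rsmul 𝒜 ℳ m a, m}
    rw [e _ (by simp), e m (by simp), hy.1]
  · obtain ⟨y, hy, e⟩ := h {m, n}
    rw [e m (by simp), e n (by simp), hy.2 i j m n hm hn]

theorem mem_ospN_of_locally {N : Type*} {b : Module.Basis (N ⊕ J) A M} {x : AddMonoid.End M}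
    (h : ∀ F : Finset M, ∃ y ∈ ospN q b, ∀ m ∈ F, x m = y m) : x ∈ ospN q b := by
  refine ⟨mem_osp_of_locally fun F => ?_, ?_⟩
  · obtain ⟨y, hy, e⟩ := h F
    exact ⟨y, hy.1, e⟩
  · ext m
    obtain ⟨y, hy, e⟩ := h {projR b m}
    rw [end_mul_apply, e _ (by simp), ← end_mul_apply, hy.2]

/-! ### Superderivations and the summands of `osp(q)` -/

include hq hA in
theorem IsAlong.sBr_mem_ospN {α : ZMod 2} {S : AddMonoid.End M} {Δ : AddMonoid.End A}
    (h : IsAlong q α S Δ) {x : AddMonoid.End M} (hx : x ∈ ospN q b) :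
    OspDer.sBr (pr ℳ) S x ∈ ospN q b := by
  have G := isGrading_pr ℳ
  refine ⟨sBr_mem_osp hx.1 h, ?_⟩
  have key : ∀ β, OspDer.sBr (pr ℳ) S (endComp (pr ℳ) β x) * projR b = 0 := by
    intro β
    have e : endComp (pr ℳ) β x * projR b = 0 := by
      rw [← endComp_mul_of_degree_zero G (hasDegree_projR b 𝒜 hq.homogeneous), hx.2, endComp_zero]
    rw [sBr_of_hasDegree G h.deg (hasDegree_endComp G β x), sub_mul, mul_assoc, e, mul_zero,
      smul_mul_assoc, mul_assoc, ← h.projR_mul_mul hq hA, ← mul_assoc, e, zero_mul, zsmul_zero,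
      sub_zero]
  rw [← endComp_add_endComp G x, sBr_add_right, add_mul, key, key, add_zero]

include hq hA h2 hι in
theorem exists_isAlong_of_mem_add {S : AddMonoid.End M} (hS : S ∈ osp q + derAM ι q b bar)
    (α : ZMod 2) : ∃ Δ, IsAlong q α (endComp (pr ℳ) α S) Δ := by
  obtain ⟨x, hx, _, ⟨Δ, hΔ, rfl⟩, rfl⟩ := hS
  refine ⟨0 + endComp (pr 𝒜) α Δ, ?_⟩
  show IsAlong q α (endComp (pr ℳ) α (x + deltaSplit q b bar Δ)) _
  rw [endComp_add, ← deltaSplit_endComp hq hA h2]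
  exact (isAlong_of_mem_osp (endComp_mem_osp hx α) (hasDegree_endComp (isGrading_pr ℳ) α x)).add
    (isAlong_deltaSplit hq hA h2 ((mem_derA hA hι).1 hΔ α))

include hq hA h2 hι in
theorem sBr_mem_ospN {S : AddMonoid.End M} (hS : S ∈ osp q + derAM ι q b bar)
    {x : AddMonoid.End M} (hx : x ∈ ospN q b) : sBr (pr ℳ) S x ∈ ospN q b := by
  rw [← endComp_add_endComp (isGrading_pr ℳ) S, sBr_add_left]
  obtain ⟨_, h0⟩ := exists_isAlong_of_mem_add hq hA h2 hι hS 0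
  obtain ⟨_, h1⟩ := exists_isAlong_of_mem_add hq hA h2 hι hS 1
  exact (ospN q b).add_mem (h0.sBr_mem_ospN hq hA hx) (h1.sBr_mem_ospN hq hA hx)

include hq hA h2 hι in
theorem sBr_mem_osp_of_mem_add {S : AddMonoid.End M} (hS : S ∈ osp q + derAM ι q b bar)
    {x : AddMonoid.End M} (hx : x ∈ osp q) : sBr (pr ℳ) S x ∈ osp q := by
  rw [← endComp_add_endComp (isGrading_pr ℳ) S, sBr_add_left]
  obtain ⟨_, h0⟩ := exists_isAlong_of_mem_add hq hA h2 hι hS 0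
  obtain ⟨_, h1⟩ := exists_isAlong_of_mem_add hq hA h2 hι hS 1
  exact (ospSubgroup q).add_mem (sBr_mem_osp hx h0) (sBr_mem_osp hx h1)

theorem IsAlong.sBr_mem_eosp {α : ZMod 2} {S : AddMonoid.End M} {Δ : AddMonoid.End A}
    (h : IsAlong q α S Δ) {x : AddMonoid.End M} (hx : x ∈ eosp q) :
    OspDer.sBr (pr ℳ) S x ∈ eosp q := by
  refine AddSubgroup.closure_induction (p := fun x _ => OspDer.sBr (pr ℳ) S x ∈ eosp q)
    ?_ ?_ ?_ ?_ hx
  · rintro _ ⟨m, n, rfl⟩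
    refine induction_deg ℳ (P := fun m => OspDer.sBr (pr ℳ) S (elem q m n) ∈ eosp q)
      (fun x y hx hy => ?_) (fun i m hm => ?_) m
    · rw [elem_add_left, sBr_add_right]; exact add_mem hx hy
    refine induction_deg ℳ (P := fun n => OspDer.sBr (pr ℳ) S (elem q m n) ∈ eosp q)
      (fun x y hx hy => ?_) (fun j n hn => ?_) n
    · rw [elem_add_right, sBr_add_right]; exact add_mem hx hy
    rw [h.sBr_elem hm hn]
    exact add_mem (elem_mem_eosp q _ _) (zsmul_mem (elem_mem_eosp q _ _) _)
  · rw [sBr_zero_right]; exact zero_mem _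
  · intro x y _ _ hx hy
    rw [sBr_add_right]; exact add_mem hx hy
  · intro x _ hx
    rw [sBr_neg_right]; exact neg_mem hx

include hq hA h2 hι in
theorem sBr_mem_eosp {S : AddMonoid.End M} (hS : S ∈ osp q + derAM ι q b bar)
    {x : AddMonoid.End M} (hx : x ∈ eosp q) : sBr (pr ℳ) S x ∈ eosp q := by
  rw [← endComp_add_endComp (isGrading_pr ℳ) S, sBr_add_left]
  obtain ⟨_, h0⟩ := exists_isAlong_of_mem_add hq hA h2 hι hS 0
  obtain ⟨_, h1⟩ := exists_isAlong_of_mem_add hq hA h2 hι hS 1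
  exact (eosp q).add_mem (h0.sBr_mem_eosp hx) (h1.sBr_mem_eosp hx)

/-- An element of `eosp(q)` supercommutes with all elements of `osp(q)` that vanish at finitely
many given vectors. -/
theorem exists_finset_sBr_eq_zero {z : AddMonoid.End M} (hz : z ∈ eosp q) :
    ∃ F : Finset M, ∀ w ∈ osp q, (∀ m ∈ F, w m = 0) → sBr (pr ℳ) w z = 0 := by
  classical
  refine AddSubgroup.closure_induction (p := fun z _ => ∃ F : Finset M, ∀ w ∈ osp q,
    (∀ m ∈ F, w m = 0) → sBr (pr ℳ) w z = 0) ?_ ?_ ?_ ?_ hz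
  · rintro _ ⟨m, n, rfl⟩
    refine ⟨{pr ℳ 0 m, pr ℳ 1 m, pr ℳ 0 n, pr ℳ 1 n}, fun w hw h => ?_⟩
    have G := isGrading_pr ℳ
    have key : ∀ β i j, w (pr ℳ i m) = 0 → w (pr ℳ j n) = 0 →
        sBr (pr ℳ) (endComp (pr ℳ) β w) (elem q (pr ℳ i m) (pr ℳ j n)) = 0 := by
      intro β i j hi hj
      have hd := hasDegree_endComp G β w
      rw [(isAlong_of_mem_osp (endComp_mem_osp hw β) hd).sBr_elem (pr_mem ℳ i m) (pr_mem ℳ j n),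
        endComp_apply G β w (pr_of_mem (pr_mem ℳ i m)), hi,
        endComp_apply G β w (pr_of_mem (pr_mem ℳ j n)), hj, map_zero, map_zero, elem_zero_left,
        elem_zero_right, zsmul_zero, add_zero]
    have hm : ∀ i, w (pr ℳ i m) = 0 := fun i => by
      rcases zmod_two_cases i with rfl | rfl <;> exact h _ (by simp)
    have hn : ∀ i, w (pr ℳ i n) = 0 := fun i => by
      rcases zmod_two_cases i with rfl | rfl <;> exact h _ (by simp)
    rw [← endComp_add_endComp G w, ← pr_add_pr ℳ m, ← pr_add_pr ℳ n]
    simp only [elem_add_left, elem_add_right, sBr_add_left, sBr_add_right]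
    simp only [key _ _ _ (hm _) (hn _), add_zero]
  · exact ⟨∅, fun w _ _ => sBr_zero_right w⟩
  · rintro x y _ _ ⟨F, hF⟩ ⟨F', hF'⟩
    refine ⟨F ∪ F', fun w hw h => ?_⟩
    rw [sBr_add_right, hF w hw fun m hm => h m (Finset.mem_union_left _ hm),
      hF' w hw fun m hm => h m (Finset.mem_union_right _ hm), add_zero]
  · rintro x _ ⟨F, hF⟩
    exact ⟨F, fun w hw h => by rw [sBr_neg_right, hF w hw h, neg_zero]⟩

theorem deltaSplit_mul_projR (Δ : AddMonoid.End A) :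
    deltaSplit q b bar Δ * projR b = projR b * deltaSplit q b bar Δ := by
  refine end_ext_basis 𝒜 b fun s i c _ => ?_
  rw [end_mul_apply, end_mul_apply, projR_smul, deltaSplit_smul, projR_smul]
  rcases s with s | j
  · rw [projR_inl, smul_zero, smul_zero, map_zero]
  · rw [projR_inr, deltaSplit_smul]

include hq hA h2 in
theorem sBr_deltaSplit_mem_endR {α : ZMod 2} {Δ : AddMonoid.End A} (h : Δ ∈ derAHom 𝒜 ι α)
    {β : ZMod 2} {x : AddMonoid.End M} (hx : x ∈ endR 𝒜 ℳ b) (hd : HasDegree (pr ℳ) β x) :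
    sBr (pr ℳ) (deltaSplit q b bar Δ) x ∈ endR 𝒜 ℳ b := by
  have hS := isAlong_deltaSplit hq hA h2 h
  obtain ⟨-, e2, e3⟩ := (mem_endR_iff b).1 hx
  refine (mem_endR_iff b).2 ⟨(sBr_mem_osp (endR_subset_osp hq hA hx) hS).1, ?_, ?_⟩
  · rw [sBr_of_hasDegree (isGrading_pr ℳ) hS.deg hd, sub_mul, smul_mul_assoc, mul_assoc, e2,
      mul_assoc, deltaSplit_mul_projR, ← mul_assoc, e2]
  · rw [sBr_of_hasDegree (isGrading_pr ℳ) hS.deg hd, mul_sub, mul_smul_comm, ← mul_assoc,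
      ← deltaSplit_mul_projR, mul_assoc, e3, ← mul_assoc, e3]

include hA h2 hι in
theorem isLieSubalgebra_endR_add_derAM (hq : IsSplit q b bar) :
    IsLieSubalgebra (pr ℳ) (fun k : K => lmul M (ι k)) (endR 𝒜 ℳ b + derAM ι q b bar) := by
  have G := isGrading_pr ℳ
  have hR : IsLieSubalgebra (pr ℳ) (fun k : K => lmul M (ι k)) (endR 𝒜 ℳ b) :=
    isLieSubalgebra_endR b hA hq.homogeneous
  let Y : AddSubgroup (AddMonoid.End M) :=
    { carrier := endR 𝒜 ℳ b
      zero_mem' := hR.zero_mem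
      add_mem' := fun {x y} hx hy => hR.add_mem x hx y hy
      neg_mem' := fun {x} hx => hR.neg_mem x hx }
  refine isLieSubalgebra_add hR (isLieSubalgebra_derAM hA h2 hι hq) ?_
  rintro x hx _ ⟨Δ, hΔ, rfl⟩
  have hd := fun i => hasDegree_endComp G i x
  have h1 : ∀ i j, sBr (pr ℳ) (endComp (pr ℳ) i (deltaSplit q b bar Δ)) (endComp (pr ℳ) j x) ∈
      Y := by
    intro i j
    rw [← deltaSplit_endComp hq hA h2]
    exact sBr_deltaSplit_mem_endR hq hA h2 ((mem_derA hA hι).1 hΔ i) (hR.comp_mem j x hx) (hd j)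
  refine ⟨sBr_mem_of_comp G Y _ _ fun i j => ?_, sBr_mem_of_comp G Y _ _ h1⟩
  rw [sBr_skew G (hd i) (hasDegree_endComp G j _)]
  exact Y.neg_mem (Y.zsmul_mem (h1 j i) _)

include hq hA in
theorem osp_add_derAM_eq : osp q + derAM ι q b bar =
    (ospN q b : Set (AddMonoid.End M)) + (endR 𝒜 ℳ b + derAM ι q b bar) := by
  rw [← add_assoc, ← osp_eq_add hq hA]

include hq hA in
theorem endR_add_derAM_subset : endR 𝒜 ℳ b + derAM ι q b bar ⊆ osp q + derAM ι q b bar :=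
  Set.add_subset_add_right (endR_subset_osp hq hA)

include hq hA h2 hι in
theorem eq_zero_of_mem_ospN_of_mem {x : AddMonoid.End M} (hx : x ∈ ospN q b)
    (h : x ∈ endR 𝒜 ℳ b + derAM ι q b bar) : x = 0 := by
  obtain ⟨f, hf, g, hg, rfl⟩ := h
  have hg0 : g = 0 := by
    have e : g ∈ osp q := by
      have := (ospSubgroup q).sub_mem hx.1 (endR_subset_osp hq hA hf)
      rwa [show f + g - f = g from add_sub_cancel_left f g] at this
    have := inter_derAM hq hA h2 hι (X := osp q) (ospSubgroup q).zero_mem fun _ h => h.1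
    exact (Set.ext_iff.1 this g).1 ⟨e, hg⟩
  have e : (f + g) * projR b = 0 := hx.2
  rw [hg0, add_zero, ((mem_endR_iff b).1 hf).2.1] at e
  show f + g = 0
  rw [hg0, e, add_zero]

end RadicalForm

/-! ### Elements of `osp(q)` as sums of elementary ones -/

section Expansion

variable {A : Type u} {M : Type w} [Ring A] [AddCommGroup M] [Module A M]
  {𝒜 : ZMod 2 → AddSubgroup A} [GradedRing 𝒜]
  {ℳ : ZMod 2 → AddSubgroup M} [DirectSum.Decomposition ℳ]
  {I J : Type*} {q : SuperForm 𝒜 ℳ} {b : Module.Basis ((I ⊕ Fin 2) ⊕ J) A M} {bar : I → I}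

/-- The component of a vector along the basis vector `b (inl s)` of `N`. -/
noncomputable def compN {N : Type*} (b : Module.Basis (N ⊕ J) A M) (s : N) : AddMonoid.End M :=
  AddMonoidHom.mk' (fun m => b.repr m (.inl s) • b (.inl s)) (by
    intro x y
    rw [map_add, Finsupp.add_apply, add_smul])

section Comp

variable {N : Type*} (b : Module.Basis (N ⊕ J) A M)

theorem compN_apply (s : N) (m : M) : compN b s m = b.repr m (.inl s) • b (.inl s) := rfl

theorem compN_smul_self (s : N) (c : A) : compN b s (c • b (.inl s)) = c • b (.inl s) := by
  rw [compN_apply]; simp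

theorem compN_smul_of_ne {s : N} {t : N ⊕ J} (h : .inl s ≠ t) (c : A) :
    compN b s (c • b t) = 0 := by
  rw [compN_apply, map_smul, b.repr_self, Finsupp.smul_single, Finsupp.single_eq_of_ne h, zero_smul]

theorem finite_compN_ne_zero (m : M) : {s | compN b s m ≠ 0}.Finite := by
  refine ((b.repr m).finite_support.preimage Sum.inl_injective.injOn).subset fun s hs => ?_
  intro h
  exact hs (by rw [compN_apply, h, zero_smul])

theorem finsum_compN (𝒜 : ZMod 2 → AddSubgroup A) [GradedRing 𝒜] (m : M) :
    ∑ᶠ s, compN b s m = m - projR b m := by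
  refine basis_induction 𝒜 b (P := fun m => ∑ᶠ s, compN b s m = m - projR b m) (by simp)
    (fun x y hx hy => ?_) (fun t i c _ => ?_) m
  · simp only [map_add]
    rw [finsum_add_distrib (finite_compN_ne_zero b x) (finite_compN_ne_zero b y), hx, hy]
    abel
  · rw [projR_smul]
    rcases t with t | j
    · rw [finsum_eq_single _ t fun s hs => compN_smul_of_ne b (by simpa using hs) c,
        compN_smul_self, projR_inl, smul_zero, sub_zero]
    · rw [projR_inr, sub_self]
      exact finsum_eq_zero_of_forall_eq_zero fun s => compN_smul_of_ne b (by simp) c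

/-- The endomorphism `½` on `N` and `1` on `R`. -/
noncomputable def halfN : AddMonoid.End M :=
  lmul M (Ring.inverse (2 : A)) * (1 - projR b) + projR b

theorem halfN_apply (m : M) :
    halfN b m = Ring.inverse (2 : A) • (m - projR b m) + projR b m := rfl

end Comp

variable [SetLike.GradedSMul 𝒜 ℳ] (hq : IsSplit q b bar) (hA : IsSupercommutative 𝒜)
  (h2 : IsUnit (2 : A))

include hq hA in
theorem halfN_mem_endA : halfN b ∈ endA 𝒜 ℳ := by
  have hρ : projR b ∈ endA 𝒜 ℳ := projR_mem_endA b hq.homogeneous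
  refine (endASubgroup 𝒜 ℳ).add_mem (mul_mem_endA (lmul_mem_endA hA _)
    ((endASubgroup 𝒜 ℳ).sub_mem ?_ hρ)) hρ
  exact fun _ _ => rfl

include hq hA in
theorem form_halfN_left (m n : M) :
    q.toFun (halfN b m) n = Ring.inverse (2 : A) * q.toFun m n := by
  rw [halfN_apply, map_add, AddMonoidHom.add_apply, form_projR_left hq hA, add_zero,
    q.smul_left hA, map_sub, AddMonoidHom.sub_apply, form_projR_left hq hA, sub_zero]

/-- The vector `q(n_{bar i}, n_i)⁻¹ n_i`, dual to `n_{bar i}`. -/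
noncomputable def dualVec (q : SuperForm 𝒜 ℳ) (b : Module.Basis ((I ⊕ Fin 2) ⊕ J) A M)
    (bar : I → I) (s : I ⊕ Fin 2) : M :=
  Ring.inverse (q.toFun (b (.inl (Sum.map bar id s))) (b (.inl s))) • b (.inl s)

section Nontrivial

variable [Nontrivial A]

include hq in
theorem isUnit_bar (s : I ⊕ Fin 2) :
    IsUnit (q.toFun (b (.inl (Sum.map bar id s))) (b (.inl s))) := by
  have h := hq.isUnit (Sum.map bar id s)
  rwa [hq.bar_bar] at h

include hq hA h2 in
theorem even_bar (s : I ⊕ Fin 2) :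
    q.toFun (b (.inl (Sum.map bar id s))) (b (.inl s)) ∈ 𝒜 0 := by
  have h := hq.even hA h2 (Sum.map bar id s)
  rwa [hq.bar_bar] at h

include hq hA h2 in
theorem dualVec_mem {s : I ⊕ Fin 2} {i : ZMod 2} (hi : b (.inl s) ∈ ℳ i) :
    dualVec q b bar s ∈ ℳ i := by
  have := smul_mem_deg (inverse_mem (isUnit_bar hq s) (even_bar hq hA h2 s)) hi
  rwa [zero_add] at this

include hq hA h2 in
theorem rsmul_dualVec (s : I ⊕ Fin 2) (p : M) :
    rsmul 𝒜 ℳ (dualVec q b bar s) (q.toFun (b (.inl (Sum.map bar id s))) p) = compN b s p := by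
  obtain ⟨i, hi⟩ := hq.homogeneous (.inl s)
  have hi' := hq.mem_bar hA h2 hi
  have hu := isUnit_bar hq s
  have hu0 := even_bar hq hA h2 s
  refine basis_induction 𝒜 b (P := fun p => rsmul 𝒜 ℳ (dualVec q b bar s)
    (q.toFun (b (.inl (Sum.map bar id s))) p) = compN b s p) (by simp)
    (fun x y hx hy => by rw [map_add, rsmul_add_right, hx, hy, map_add]) (fun t k c hc => ?_) p
  rw [q.smul_right hA hc hi']
  rcases eq_or_ne (.inl s) t with rfl | h
  · have hcu := mul_mem_deg hc hu0
    rw [add_zero] at hcu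
    rw [compN_smul_self, rsmul_of_mem (zsmul_mem hcu _) (dualVec_mem hq hA h2 hi), dualVec,
      smul_assoc, smul_smul, kos_mul_self, one_smul, smul_smul, mul_assoc,
      Ring.mul_inverse_cancel _ hu, mul_one]
  · have e : q.toFun (b (.inl (Sum.map bar id s))) (b t) = 0 := by
      rcases t with t | j
      · refine hq.eq_zero fun e => h ?_
        rw [e, hq.bar_bar]
      · exact hq.right_eq_zero _ _
    rw [compN_smul_of_ne b h, e, mul_zero, smul_zero, rsmul_zero_right]

include hq hA h2 in
theorem form_dualVec_smul (s : I ⊕ Fin 2) (m : M) :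
    q.toFun m (dualVec q b bar s) • b (.inl (Sum.map bar id s)) =
      compN b (Sum.map bar id s) m := by
  have hu := isUnit_bar hq s
  have e := form_basis_bar hq hA m (Sum.map bar id s)
  rw [hq.bar_bar] at e
  rw [dualVec, ← rsmul_even (𝒜 := 𝒜) (ℳ := ℳ) (inverse_mem hu (even_bar hq hA h2 s)),
    q.rsmul_right, e, mul_assoc, Ring.mul_inverse_cancel _ hu, mul_one, compN_apply]

/-- For `x ∈ osp(q)`, the elementary endomorphism built from the images `x(n_i)` of the basis
vectors. The factor `½` on `N` accounts for the two summands, each of which sums up to `½ x` there. -/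
noncomputable def elemOf (q : SuperForm 𝒜 ℳ) (b : Module.Basis ((I ⊕ Fin 2) ⊕ J) A M)
    (bar : I → I) (x : AddMonoid.End M) (s : I ⊕ Fin 2) : AddMonoid.End M :=
  elem q (halfN b (x (dualVec q b bar s))) (b (.inl (Sum.map bar id s)))

theorem elemOf_mem_eosp (x : AddMonoid.End M) (s : I ⊕ Fin 2) : elemOf q b bar x s ∈ eosp q :=
  elem_mem_eosp q _ _

include hq hA h2 in
/-- The first summand is `m q(n, p)` with `x` moved past the scalar by `A`-linearity, the second one
is `q(m, p) n` with `x` moved to the other side of the form. -/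
theorem elemOf_apply {x : AddMonoid.End M} (hx : x ∈ osp q) (s : I ⊕ Fin 2) (p : M) :
    elemOf q b bar x s p = halfN b (x (compN b s p)) +
      Ring.inverse (2 : A) • compN b (Sum.map bar id s) (x p) := by
  refine induction_deg ℳ (P := fun p => elemOf q b bar x s p = halfN b (x (compN b s p)) +
    Ring.inverse (2 : A) • compN b (Sum.map bar id s) (x p)) (fun p p' h h' => ?_)
    (fun k p hp => ?_) p
  · simp only [map_add, h, h', smul_add]
    abel
  obtain ⟨i, hi⟩ := hq.homogeneous (.inl s)
  have e := hx.2 i k _ p (dualVec_mem hq hA h2 hi) hp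
  rw [elemOf, elem_apply_of_mem q _ (hq.mem_bar hA h2 hi) hp, ← halfN_mem_endA hq hA, ← hx.1,
    rsmul_dualVec hq hA h2, form_halfN_left hq hA, eq_neg_of_add_eq_zero_left e, mul_neg,
    neg_smul, smul_neg, sub_neg_eq_add, mul_smul_comm, smul_assoc, smul_smul, kos_mul_self,
    one_smul, mul_smul, form_dualVec_smul hq hA h2]

include hq hA h2 in
theorem finite_elemOf_ne_zero {x : AddMonoid.End M} (hx : x ∈ osp q) (p : M) :
    {s | elemOf q b bar x s p ≠ 0}.Finite := by
  have hinj : Function.Injective (Sum.map bar id : I ⊕ Fin 2 → I ⊕ Fin 2) :=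
    Function.LeftInverse.injective hq.bar_bar
  refine ((finite_compN_ne_zero b p).union
    ((finite_compN_ne_zero b (x p)).preimage hinj.injOn)).subset fun s hs => ?_
  by_contra h
  simp only [Set.mem_union, Set.mem_setOf_eq, Set.mem_preimage, not_or, not_not] at h
  exact hs (by rw [elemOf_apply hq hA h2 hx, h.1, h.2, map_zero, map_zero, smul_zero, add_zero])

include hq hA h2 in
/-- An element of `osp(q)` vanishing on `R` is a pointwise finite sum of elementary
endomorphisms. -/
theorem finsum_elemOf {x : AddMonoid.End M} (hx : x ∈ ospN q b) (p : M) :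
    ∑ᶠ s, elemOf q b bar x s p = x p := by
  have f1 := finite_compN_ne_zero b p
  have f2 := finite_compN_ne_zero b (x p)
  let e : I ⊕ Fin 2 ≃ I ⊕ Fin 2 :=
    ⟨Sum.map bar id, Sum.map bar id, hq.bar_bar, hq.bar_bar⟩
  have e1 : ∑ᶠ s, halfN b (x (compN b s p)) = halfN b (x (p - projR b p)) := by
    rw [← finsum_compN b 𝒜 p]
    exact ((halfN b * x : AddMonoid.End M).map_finsum f1).symm
  have e2 : ∑ᶠ s, Ring.inverse (2 : A) • compN b (Sum.map bar id s) (x p) =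
      Ring.inverse (2 : A) • (x p - projR b (x p)) := by
    rw [← finsum_compN b 𝒜 (x p)]
    refine (finsum_comp_equiv e (f := fun s => Ring.inverse (2 : A) • compN b s (x p))).trans ?_
    exact ((lmul M (Ring.inverse (2 : A))).map_finsum f2).symm
  have hR : x (projR b p) = 0 := DFunLike.congr_fun hx.2 p
  have s1 : {s | halfN b (x (compN b s p)) ≠ 0}.Finite := f1.subset fun s hs h =>
    hs (by rw [h, map_zero, map_zero])
  have s2 : {s | Ring.inverse (2 : A) • compN b (Sum.map bar id s) (x p) ≠ 0}.Finite :=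
    (f2.preimage e.injective.injOn).subset fun s hs h => hs (by
      have h : compN b (Sum.map bar id s) (x p) = 0 := h
      rw [h, smul_zero])
  simp only [elemOf_apply hq hA h2 hx.1]
  rw [finsum_add_distrib s1 s2, e1, e2, map_sub, hR, sub_zero, halfN_apply, add_right_comm,
    ← smul_add, half_smul_add_self h2, sub_add_cancel]

end Nontrivial

include hq hA h2 in
/-- The index set of the expansion of an element of `ospN` injects into `M`, so it may be replaced by
a type in the universe of `M`. -/
theorem mem_eospBar_of_mem_ospN {x : AddMonoid.End M} (hx : x ∈ ospN q b) : x ∈ eospBar q := by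
  rcases subsingleton_or_nontrivial A with hs | hs
  · have := Module.subsingleton A M
    refine ⟨PEmpty, fun i => i.elim, fun i => i.elim, fun m => ⟨Set.toFinite _, ?_⟩⟩
    exact Subsingleton.elim _ _
  have hinj : Function.Injective fun s : I ⊕ Fin 2 => b (.inl s) :=
    b.injective.comp Sum.inl_injective
  let e := (Equiv.ofInjective _ hinj).symm
  refine ⟨Set.range fun s : I ⊕ Fin 2 => b (.inl s), fun i => elemOf q b bar x (e i),
    fun i => elemOf_mem_eosp x _, fun p => ⟨?_, ?_⟩⟩
  · exact (finite_elemOf_ne_zero hq hA h2 hx.1 p).preimage e.injective.injOn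
  · rw [finsum_comp_equiv e (f := fun s => elemOf q b bar x s p), finsum_elemOf hq hA h2 hx]

/-- A pointwise finite sum agrees on a finite set with a finite partial sum. -/
theorem exists_mem_eosp_of_mem_eospBar {x : AddMonoid.End M} (hx : x ∈ eospBar q)
    (F : Finset M) : ∃ y ∈ eosp q, ∀ m ∈ F, x m = y m := by
  classical
  obtain ⟨T, f, hf, h⟩ := hx
  have hfin : (⋃ m ∈ F, {i | f i m ≠ 0}).Finite := F.finite_toSet.biUnion fun m _ => (h m).1
  refine ⟨∑ i ∈ hfin.toFinset, f i, sum_mem fun i _ => hf i, fun m hm => ?_⟩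
  rw [(h m).2, finsum_eq_sum_of_support_subset (s := hfin.toFinset) _ ?_]
  · exact (map_sum (AddMonoidHom.eval m : AddMonoid.End M →+ M) f hfin.toFinset).symm
  · intro i hi
    rw [Set.Finite.coe_toFinset]
    exact Set.mem_biUnion hm hi

include hq hA h2 in
/-- The summable closure of `eosp(q)` consists of the elements of `osp(q)` vanishing on `R`. -/
theorem eospBar_eq : eospBar q = (ospN q b : Set (AddMonoid.End M)) := by
  refine Set.Subset.antisymm (fun x hx => mem_ospN_of_locally fun F => ?_)
    fun x hx => mem_eospBar_of_mem_ospN hq hA h2 hx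
  obtain ⟨y, hy, e⟩ := exists_mem_eosp_of_mem_eospBar hx F
  exact ⟨y, eosp_le_ospN hq hA hy, e⟩

include hq hA h2 in
/-- In finite rank the expansion of an element of `ospN` is a finite sum. -/
theorem eosp_eq_of_finite [Module.Finite A M] : eosp q = ospN q b := by
  refine le_antisymm (eosp_le_ospN hq hA) fun x hx => ?_
  rcases subsingleton_or_nontrivial A with hs | hs
  · have := Module.subsingleton A M
    rw [show x = 0 from AddMonoidHom.ext fun m => Subsingleton.elim _ _]
    exact zero_mem _
  have := Module.Finite.finite_basis b
  have : Finite (I ⊕ Fin 2) := Finite.of_injective _ (Sum.inl_injective (β := J))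
  have := Fintype.ofFinite (I ⊕ Fin 2)
  have e : x = ∑ s, elemOf q b bar x s := by
    ext p
    rw [← finsum_elemOf hq hA h2 hx, finsum_eq_sum_of_fintype]
    exact (map_sum (AddMonoidHom.eval p : AddMonoid.End M →+ M)
      (elemOf q b bar x) Finset.univ).symm
  rw [e]
  exact sum_mem fun s _ => elemOf_mem_eosp x s

end Expansion

/-! ### Splittings of `𝒮` and of the derivation algebra -/

section Main

variable {A : Type u} {K : Type v} {M : Type w} [Ring A] [Ring K] [AddCommGroup M] [Module A M]
  {𝒜 : ZMod 2 → AddSubgroup A} [GradedRing 𝒜]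
  {ℳ : ZMod 2 → AddSubgroup M} [DirectSum.Decomposition ℳ]
  {ι : K →+* A} {𝒦 : ZMod 2 → AddSubgroup K} [GradedRing 𝒦]
  {I J : Type*} {q : SuperForm 𝒜 ℳ} {b : Module.Basis ((I ⊕ Fin 2) ⊕ J) A M} {bar : I → I}
  [SetLike.GradedSMul 𝒜 ℳ] (E : OspSubalgebra ι q)
  (hq : IsSplit q b bar) (hA : IsSupercommutative 𝒜)
  (h2 : IsUnit (2 : A)) (hι : ∀ i, ∀ k ∈ 𝒦 i, ι k ∈ 𝒜 i)
  (hinj : Function.Injective (lmul M : A → AddMonoid.End M))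

include hq hA h2 in
/-- `𝒯` consists of the multiplications by elements of `A`. -/
theorem eq_lmul_of_mem_tHom (hrank : 2 < Cardinal.mk ((I ⊕ Fin 2) ⊕ J)) {α : ZMod 2}
    {T : AddMonoid.End M} (hT : T ∈ tHom E α) : ∃ c ∈ 𝒜 α, T = lmul M c := by
  obtain ⟨-, hd, -, hT2, hT3⟩ := hT
  obtain ⟨s, π, F⟩ := hq.exists_isFrame hA h2 hrank
  obtain ⟨c, hc, hN, hO⟩ := F.exists_scalar hA hd (fun i j m n hm hn h => by
    rw [← hT2 i j m n hm hn, h, lmul_zero, sBr_zero_right])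
    (fun m n => hT3 _ (E.eosp_le (elem_mem_eosp q m n)))
  refine ⟨c, hc, end_ext_basis 𝒜 b fun t k a ha => ?_⟩
  have hO' : ∀ t, q.toFun (b t) (b (.inl (.inr 0))) = 0 → q.toFun (b t) (b (.inl (.inr 1))) = 0 →
      T (a • b t) = c • a • b t := by
    intro t h0 h1
    obtain ⟨i, hi⟩ := hq.homogeneous t
    exact hO (k + i) _ (smul_mem_deg ha hi) (by rw [q.smul_left hA, h0, mul_zero])
      (by rw [q.smul_left hA, h1, mul_zero])
  rw [lmul_apply]
  rcases t with (i | l) | j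
  · exact hO' _ (hq.orthogonal_N i 0) (hq.orthogonal_N i 1)
  · fin_cases l
    · exact (hN k a ha).1
    · exact (hN k a ha).2
  · exact hO' _ (hq.left_eq_zero _ j) (hq.left_eq_zero _ j)

theorem OspSubalgebra.isLieSubalgebra :
    IsLieSubalgebra (pr ℳ) (fun k : K => lmul M (ι k)) (E.carrier : Set (AddMonoid.End M)) where
  zero_mem := E.carrier.zero_mem
  add_mem _ hf _ hg := E.carrier.add_mem hf hg
  neg_mem _ hf := E.carrier.neg_mem hf
  comp_mem α f hf := E.comp_mem α f hf
  smul_mem k f hf := E.smul_mem k f hf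
  bracket_mem f hf g hg := E.bracket_mem f hf g hg

include hq hA h2 hι hinj in
theorem sAlg_eq_of_normalizes
    (h : ∀ S ∈ osp q + derAM ι q b bar, ∀ x ∈ E.carrier, sBr (pr ℳ) S x ∈ E.carrier) :
    sAlg E = osp q + derAM ι q b bar := by
  rw [sAlg_eq_normIn hq hA h2 hι E hinj]
  exact Set.Subset.antisymm (fun S hS => hS.1) fun S hS => ⟨hS, h S hS⟩

include hq hA h2 hι hinj in
theorem isSemidirect_sAlg_of_eq_osp (h : (E.carrier : Set (AddMonoid.End M)) = osp q) :
    IsSemidirect (pr ℳ) (fun k : K => lmul M (ι k)) (sAlg E) E.carrier (derAM ι q b bar) := by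
  have hmem : ∀ x, x ∈ E.carrier ↔ x ∈ osp q := fun x => Set.ext_iff.1 h x
  have hS : sAlg E = osp q + derAM ι q b bar :=
    sAlg_eq_of_normalizes E hq hA h2 hι hinj fun S hS x hx =>
      (hmem _).2 (sBr_mem_osp_of_mem_add hq hA h2 hι hS ((hmem x).1 hx))
  refine ⟨isLieSubalgebra_sAlg E hA hι hinj, E.isLieSubalgebra,
    isLieSubalgebra_derAM hA h2 hι hq, fun S hS x hx => sAlg_normalizes E hinj hS x hx, ?_, ?_⟩
  · rw [hS, h]
  · rw [h]
    exact inter_derAM hq hA h2 hι (ospSubgroup q).zero_mem fun _ h => h.1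

include hq hA h2 hι hinj in
theorem isSemidirect_sAlg_of_eq_ospN (h : E.carrier = ospN q b) :
    IsSemidirect (pr ℳ) (fun k : K => lmul M (ι k)) (sAlg E) E.carrier
      (endR 𝒜 ℳ b + derAM ι q b bar) := by
  have hS : sAlg E = osp q + derAM ι q b bar :=
    sAlg_eq_of_normalizes E hq hA h2 hι hinj fun S hS x hx => by
      rw [h] at hx ⊢
      exact sBr_mem_ospN hq hA h2 hι hS hx
  have hB : IsLieSubalgebra (pr ℳ) (fun k : K => lmul M (ι k)) (endR 𝒜 ℳ b + derAM ι q b bar) :=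
    isLieSubalgebra_endR_add_derAM hA h2 hι hq
  refine ⟨isLieSubalgebra_sAlg E hA hι hinj, E.isLieSubalgebra, hB,
    fun S hS x hx => sAlg_normalizes E hinj hS x hx, ?_, ?_⟩
  · rw [hS, h, osp_add_derAM_eq hq hA]
  · rw [h]
    refine Set.Subset.antisymm (fun x hx => ?_) (Set.singleton_subset_iff.2
      ⟨(ospN q b).zero_mem, hB.zero_mem⟩)
    exact eq_zero_of_mem_ospN_of_mem hq hA h2 hι hx.1 hx.2

namespace Infty

theorem ad_subset_adLoc (hA : IsSupercommutative 𝒜) (hι : ∀ i, ∀ k ∈ 𝒦 i, ι k ∈ 𝒜 i)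
    (hinj : Function.Injective (lmul M : A → AddMonoid.End M)) : ad E ⊆ adLoc E := by
  rintro d ⟨y, hy⟩
  refine ⟨?_, fun s => ⟨y, fun z _ => hy z⟩⟩
  obtain ⟨y', rfl⟩ := (mem_ad_iff E).1 ⟨y, hy⟩
  exact adEnd_mem_derivations E hA hι hinj y'

include hA hι hinj in
/-- If `S ∈ 𝒮 ∩ osp(q)` agrees on every finite set of vectors with an element of `eosp(q) = ℰ`, then
`d_{S,0}` is locally inner. -/
theorem dMap_mem_adLoc (hE : E.carrier = eosp q) {S : AddMonoid.End M} (hS : S ∈ sAlg E)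
    (hS' : S ∈ osp q) (h : ∀ F : Finset M, ∃ y ∈ eosp q, ∀ m ∈ F, S m = y m) :
    dMap E S ∈ adLoc E := by
  classical
  refine ⟨dMap_mem_derivations E hA hι hinj hS, fun s => ?_⟩
  have hF : ∀ z : Infty E, ∃ F : Finset M, ∀ w ∈ osp q, (∀ m ∈ F, w m = 0) →
      sBr (pr ℳ) w z.2.2.2 = 0 := fun z =>
    exists_finset_sBr_eq_zero (by rw [← hE]; exact z.2.2.2.2)
  choose F hF using hF
  obtain ⟨y, hy, e⟩ := h (s.image (fun z => z.2.1) ∪ s.image (fun z => z.2.2.1) ∪ s.biUnion F)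
  have hy' : y ∈ E.carrier := by rwa [hE]
  refine ⟨(0, 0, 0, ⟨y, hy'⟩), fun z hz => ?_⟩
  obtain ⟨b1, b2, b3, b4⟩ := bracket_diag E 0 ⟨y, hy'⟩ z
  obtain ⟨d1, d2, d3, d4⟩ := isD_dMap E hinj hS z.1 z.2.1 z.2.2.1 z.2.2.2
  refine ext_iff'.2 ⟨hinj ?_, ?_, ?_, ?_⟩
  · rw [b1]
    refine d1.trans ?_
    rw [sBr_endA_lmul hS'.1, sBr_zero_left, add_zero, lmul_zero]
  · rw [b2, zero_smul, zero_add]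
    refine d2.trans ?_
    rw [add_zero]
    exact e _ (Finset.mem_union_left _ (Finset.mem_union_left _ (Finset.mem_image_of_mem _ hz)))
  · rw [b3, zero_smul, neg_zero, zero_add]
    refine d3.trans ?_
    rw [sub_zero]
    exact e _ (Finset.mem_union_left _ (Finset.mem_union_right _ (Finset.mem_image_of_mem _ hz)))
  · rw [b4]
    refine d4.trans ?_
    rw [sBr_zero_left, zero_add, ← sub_eq_zero, ← sBr_sub_left]
    refine hF z _ ((ospSubgroup q).sub_mem hS' (E.le_osp y hy')) fun m hm => ?_
    rw [end_sub_apply, e m (Finset.mem_union_right _ (Finset.mem_biUnion.2 ⟨z, hz, hm⟩)), sub_self]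

include hinj h2 in
/-- If `d_{S,0}` is locally inner, then `S` agrees on every finite set of vectors with an element
of `ℰ`: it suffices to test on `(1,0,0,0)` and on the elements `(0,m,m,0)`. -/
theorem exists_mem_of_dMap_mem_adLoc {S : AddMonoid.End M} (hS : S ∈ sAlg E)
    (h : dMap E S ∈ adLoc E) (F : Finset M) : ∃ y ∈ E.carrier, ∀ m ∈ F, S m = y m := by
  classical
  have hD := isD_dMap E hinj hS
  obtain ⟨⟨a, m₁, n₁, x⟩, hy⟩ :=
    h.2 (insert ((1, 0, 0, 0) : Infty E) (F.image fun m => ((0, m, m, 0) : Infty E)))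
  have hu := hy (1, 0, 0, 0) (Finset.mem_insert_self _ _)
  rw [bracket_left_unit] at hu
  have hm₁ : m₁ = 0 := by
    have e : (dMap E S (1, 0, 0, 0)).2.1 = -m₁ := congrArg (fun z : Infty E => z.2.1) hu
    rw [(hD 1 0 0 0).2.1, map_zero] at e
    exact (neg_eq_zero.1 e.symm)
  have hn₁ : n₁ = 0 := by
    have e : (dMap E S (1, 0, 0, 0)).2.2.1 = n₁ := congrArg (fun z : Infty E => z.2.2.1) hu
    rw [(hD 1 0 0 0).2.2.1, map_zero] at e
    exact e.symm
  refine ⟨x, x.2, fun m hm => ?_⟩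
  have e := hy (0, m, m, 0) (Finset.mem_insert_of_mem (Finset.mem_image_of_mem _ hm))
  rw [hm₁, hn₁] at e
  obtain ⟨-, b2, b3, -⟩ := bracket_diag E a x (0, m, m, 0)
  obtain ⟨-, d2, d3, -⟩ := hD 0 m m 0
  rw [e, b2, add_zero] at d2
  rw [e, b3, sub_zero] at d3
  have d2 : a • m + (x : AddMonoid.End M) m = S m := d2
  have d3 : -(a • m) + (x : AddMonoid.End M) m = S m := d3
  refine eq_of_add_self_eq h2 ?_
  calc S m + S m = (a • m + (x : AddMonoid.End M) m) + (-(a • m) + (x : AddMonoid.End M) m) := by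
        rw [d2, d3]
    _ = _ := by abel

include hq hA h2 hι hinj in
/-- For `ℰ = eosp(q)`, the summands `d_{x,0}` with `x ∈ osp(q)` vanishing on `R` are locally inner,
and no other element of `osp(q) ⊕ (Der_K A)_M` gives a locally inner derivation. -/
theorem isSemidirect_adLoc (hT : ∀ α, ∀ T ∈ tHom E α, ∃ c ∈ 𝒜 α, T = lmul M c)
    (hE : E.carrier = eosp q) :
    IsSemidirect (proj E) (lact E) (derivations E) (adLoc E)
      (dSet E (endR 𝒜 ℳ b + derAM ι q b bar)) := by
  have hS : sAlg E = osp q + derAM ι q b bar :=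
    sAlg_eq_of_normalizes E hq hA h2 hι hinj fun S hS x hx => by
      rw [hE] at hx ⊢
      exact sBr_mem_eosp hq hA h2 hι hS hx
  have hB : IsLieSubalgebra (pr ℳ) (fun k : K => lmul M (ι k)) (endR 𝒜 ℳ b + derAM ι q b bar) :=
    isLieSubalgebra_endR_add_derAM hA h2 hι hq
  have hBS : endR 𝒜 ℳ b + derAM ι q b bar ⊆ sAlg E := by
    rw [hS]
    exact endR_add_derAM_subset hq hA
  have hD := (isSuperAlgebra E hA hι).isLieSubalgebra_der
  have hL := isLieSubalgebra_adLoc E hA hι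
  have hosp : osp q ⊆ sAlg E := fun x hx => by
    rw [hS]
    exact ⟨x, hx, 0, (isLieSubalgebra_derAM hA h2 hι hq).zero_mem, add_zero x⟩
  refine ⟨hD, hL, isLieSubalgebra_dSet E hA hι hinj hB hBS,
    fun d hd x hx => sBr_mem_adLoc E hA hι hd hx, ?_, ?_⟩
  · rw [dSet_eq E hinj hBS]
    refine Set.Subset.antisymm (fun d hd => ?_) ?_
    · rw [derivations_eq E hA hι hinj h2 hT] at hd
      obtain ⟨d₀, hd₀, _, ⟨S, hSS, rfl⟩, rfl⟩ := hd
      have hSS' := hSS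
      rw [hS, osp_add_derAM_eq hq hA] at hSS'
      obtain ⟨x, hx, s, hs, rfl⟩ := hSS'
      refine ⟨d₀ + dMap E x, hL.add_mem _ (ad_subset_adLoc E hA hι hinj hd₀) _ ?_, _,
        ⟨s, hs, rfl⟩, ?_⟩
      · exact dMap_mem_adLoc E hA hι hinj hE (hosp hx.1) hx.1 fun F =>
          exists_mem_eosp_of_mem_eospBar (mem_eospBar_of_mem_ospN hq hA h2 hx) F
      · show d₀ + dMap E x + dMap E s = d₀ + dMap E (x + s)
        rw [dMap_add E hinj (hosp hx.1) (hBS hs) hSS, add_assoc]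
    · rintro _ ⟨d, hd, _, ⟨s, hs, rfl⟩, rfl⟩
      exact hD.add_mem _ hd.1 _ (dMap_mem_derivations E hA hι hinj (hBS hs))
  · refine Set.Subset.antisymm ?_ (Set.singleton_subset_iff.2
      ⟨hL.zero_mem, (isLieSubalgebra_dSet E hA hι hinj hB hBS).zero_mem⟩)
    rw [dSet_eq E hinj hBS]
    rintro _ ⟨hd, s, hs, rfl⟩
    have hN : s ∈ ospN q b := mem_ospN_of_locally fun F => by
      obtain ⟨y, hy, e⟩ := exists_mem_of_dMap_mem_adLoc E h2 hinj (hBS hs) hd F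
      rw [hE] at hy
      exact ⟨y, eosp_le_ospN hq hA hy, e⟩
    rw [eq_zero_of_mem_ospN_of_mem hq hA h2 hι hN hs, Set.mem_singleton_iff]
    exact ((isD_iff_eq_dMap E hinj (hBS hB.zero_mem) 0).1 fun a m n x => by
      simp [lmul_zero, sBr_zero_left]).symm

end Infty

end Main

end OspDer

theorem theorem4p8 {K A M I J : Type*} [Ring K] [Ring A] [AddCommGroup M] [Module A M]
    (𝒦 : ZMod 2 → AddSubgroup K) [GradedRing 𝒦] (hK : OspDer.IsSupercommutative 𝒦)
    (h2 : IsUnit (2 : K))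
    (𝒜 : ZMod 2 → AddSubgroup A) [GradedRing 𝒜] (hA : OspDer.IsSupercommutative 𝒜)
    (ι : K →+* A) (hι : ∀ i, ∀ k ∈ 𝒦 i, ι k ∈ 𝒜 i)
    (ℳ : ZMod 2 → AddSubgroup M) [DirectSum.Decomposition ℳ] [SetLike.GradedSMul 𝒜 ℳ]
    (q : OspDer.SuperForm 𝒜 ℳ)
    (b : Module.Basis ((I ⊕ Fin 2) ⊕ J) A M) (bar : I → I) (hq : OspDer.IsSplit q b bar)
    (hrank : 2 < Cardinal.mk ((I ⊕ Fin 2) ⊕ J))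
    (E : OspDer.OspSubalgebra ι q) :
    -- `Δ ↦ Δ_M` is a Lie superalgebra isomorphism of `Der_K A` onto `(Der_K A)_M ⊆ End_K M`
    OspDer.derAM ι q b bar ⊆ OspDer.endK 𝒜 ℳ ι ∧
    OspDer.IsLieMono (OspDer.pr 𝒜) (fun k : K => OspDer.lmul A (ι k))
      (OspDer.pr ℳ) (fun k : K => OspDer.lmul M (ι k))
      (OspDer.derA 𝒜 ι) (OspDer.deltaSplit q b bar) ∧
    -- the sum `osp(q) ⊕ (Der_K A)_M` is direct
    OspDer.osp q ∩ OspDer.derAM ι q b bar = {0} ∧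
    -- `S ↦ d_{S,0}` is a well-defined monomorphism of Lie superalgebras into `𝒟`
    (∃ φ : AddMonoid.End M → AddMonoid.End (OspDer.Infty E),
      (∀ S ∈ OspDer.normIn E (OspDer.osp q + OspDer.derAM ι q b bar),
        φ S ∈ OspDer.dAlg E ∧ ∀ d, OspDer.IsD E S 0 d ↔ d = φ S) ∧
      OspDer.IsLieMono (OspDer.pr ℳ) (fun k : K => OspDer.lmul M (ι k))
        (OspDer.Infty.proj E) (OspDer.Infty.lact E)
        (OspDer.normIn E (OspDer.osp q + OspDer.derAM ι q b bar)) φ) ∧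
    -- the derivations of `ℰ_∞`
    OspDer.Infty.derivations E = OspDer.Infty.ad E +
      OspDer.dSet E (OspDer.normIn E (OspDer.osp q + OspDer.derAM ι q b bar)) ∧
    OspDer.Infty.ad E ∩
      OspDer.dSet E (OspDer.normIn E (OspDer.osp q + OspDer.derAM ι q b bar)) =
        OspDer.Infty.adE E ∧
    OspDer.Infty.ad E ∩ OspDer.dSet E (OspDer.normIn E (OspDer.osp q)) =
      OspDer.Infty.adE E ∧
    OspDer.Infty.adE E = {d | ∃ S ∈ E.carrier, OspDer.IsD E S 0 d} ∧
    -- splittings of `𝒮` give splittings of the derivation algebra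
    (∀ S₀ : Set (AddMonoid.End M),
      OspDer.IsSemidirect (OspDer.pr ℳ) (fun k : K => OspDer.lmul M (ι k))
        (OspDer.sAlg E) E.carrier S₀ →
      OspDer.IsSemidirect (OspDer.Infty.proj E) (OspDer.Infty.lact E)
        (OspDer.Infty.derivations E) (OspDer.Infty.ad E) (OspDer.dSet E S₀)) ∧
    -- the sum `End_A R ⊕ (Der_K A)_M` is direct
    OspDer.endR 𝒜 ℳ b ∩ OspDer.derAM ι q b bar = {0} ∧
    -- (1) `ℰ = eosp(q)`
    (E.carrier = OspDer.eosp q →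
      OspDer.IsSemidirect (OspDer.Infty.proj E) (OspDer.Infty.lact E)
        (OspDer.Infty.derivations E) (OspDer.Infty.adLoc E)
        (OspDer.dSet E (OspDer.endR 𝒜 ℳ b + OspDer.derAM ι q b bar)) ∧
      (Module.Finite A M →
        OspDer.IsSemidirect (OspDer.Infty.proj E) (OspDer.Infty.lact E)
          (OspDer.Infty.derivations E) (OspDer.Infty.ad E)
          (OspDer.dSet E (OspDer.endR 𝒜 ℳ b + OspDer.derAM ι q b bar)))) ∧
    -- (2) `ℰ` is the summable closure of `eosp(q)`
    ((E.carrier : Set (AddMonoid.End M)) = OspDer.eospBar q →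
      OspDer.IsSemidirect (OspDer.Infty.proj E) (OspDer.Infty.lact E)
        (OspDer.Infty.derivations E) (OspDer.Infty.ad E)
        (OspDer.dSet E (OspDer.endR 𝒜 ℳ b + OspDer.derAM ι q b bar))) ∧
    -- (3) `ℰ = osp(q)`
    ((E.carrier : Set (AddMonoid.End M)) = OspDer.osp q →
      OspDer.IsSemidirect (OspDer.Infty.proj E) (OspDer.Infty.lact E)
        (OspDer.Infty.derivations E) (OspDer.Infty.ad E)
        (OspDer.dSet E (OspDer.derAM ι q b bar))) := by
  have h2A : IsUnit (2 : A) := by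
    have := h2.map ι
    rwa [map_ofNat] at this
  have : Nonempty ((I ⊕ Fin 2) ⊕ J) := ⟨.inl (.inr 0)⟩
  have hinj : Function.Injective (OspDer.lmul M : A → AddMonoid.End M) := OspDer.lmul_injective b
  have hT : ∀ α, ∀ T ∈ OspDer.tHom E α, ∃ c ∈ 𝒜 α, T = OspDer.lmul M c :=
    fun α T hT => OspDer.eq_lmul_of_mem_tHom E hq hA h2A hrank hT
  have hS := OspDer.sAlg_eq_normIn hq hA h2A hι E hinj
  have hSS : OspDer.sAlg E ⊆ OspDer.sAlg E := subset_rfl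
  have hES : (E.carrier : Set (AddMonoid.End M)) ⊆ OspDer.sAlg E :=
    fun x hx => OspDer.mem_sAlg_of_mem E hinj hx
  have hOsp : OspDer.normIn E (OspDer.osp q) ⊆ OspDer.sAlg E := by
    rw [hS]
    exact fun x hx => ⟨⟨x, hx.1, 0, (OspDer.isLieSubalgebra_derAM hA h2A hι hq).zero_mem,
      add_zero x⟩, hx.2⟩
  have hL := OspDer.isLieSubalgebra_sAlg E hA hι hinj
  have hsemi : ∀ S₀ : Set (AddMonoid.End M),
      OspDer.IsSemidirect (OspDer.pr ℳ) (fun k : K => OspDer.lmul M (ι k))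
        (OspDer.sAlg E) E.carrier S₀ →
      OspDer.IsSemidirect (OspDer.Infty.proj E) (OspDer.Infty.lact E)
        (OspDer.Infty.derivations E) (OspDer.Infty.ad E) (OspDer.dSet E S₀) :=
    fun S₀ h => OspDer.Infty.isSemidirect_ad E hA hι hinj h2A hT h
  rw [← hS]
  refine ⟨?_, OspDer.isLieMono_deltaSplit hq hA h2A hι,
    OspDer.inter_derAM hq hA h2A hι (OspDer.ospSubgroup q).zero_mem fun _ h => h.1,
    ⟨OspDer.dMap E, fun S h => ⟨OspDer.dMap_mem_dAlg E hinj h, OspDer.isD_iff_eq_dMap E hinj h⟩,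
      OspDer.isLieMono_dMap E hA hι hinj hL hSS⟩, ?_,
    OspDer.Infty.ad_inter_dSet E hinj h2A hSS hES,
    OspDer.Infty.ad_inter_dSet E hinj h2A hOsp fun x hx =>
      ⟨E.le_osp x hx, fun y hy => E.bracket_mem x hx y hy⟩,
    OspDer.Infty.adE_eq E hinj, hsemi, ?_, fun hE => ⟨?_, fun hM => hsemi _ ?_⟩,
    fun hE => hsemi _ ?_, fun hE => hsemi _ ?_⟩
  · rintro _ ⟨Δ, hΔ, rfl⟩
    exact OspDer.deltaSplit_mem_endK hq hA h2A hι hΔ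
  · rw [OspDer.dSet_eq E hinj hSS]
    exact OspDer.Infty.derivations_eq E hA hι hinj h2A hT
  · refine OspDer.inter_derAM hq hA h2A hι ?_ fun _ h => h.1
    exact (OspDer.isLieSubalgebra_endR (ι := ι) b hA hq.homogeneous).zero_mem
  · exact OspDer.Infty.isSemidirect_adLoc E hq hA h2A hι hinj hT hE
  · exact OspDer.isSemidirect_sAlg_of_eq_ospN E hq hA h2A hι hinj
      (hE.trans (OspDer.eosp_eq_of_finite hq hA h2A))
  · exact OspDer.isSemidirect_sAlg_of_eq_ospN E hq hA h2A hι hinj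
      (SetLike.coe_injective (hE.trans (OspDer.eospBar_eq hq hA h2A)))
  · exact OspDer.isSemidirect_sAlg_of_eq_osp E hq hA h2A hι hinj hE
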